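/- Let $1\le m<n$ be integers, let $\Lambda:\mathbb{R}^n\to GL(n,\mathbb{R})$ be an arbitrary map, and let $\mu$ be a finite Borel measure on $\mathbb{R}^n$. Write $B(x,r)$ for the closed Euclidean ball. Suppose that for $\mu$-a.e. $a\in\mathbb{R}^n$ the lower $m$-density is positive, $$\theta^m_*(\mu,a)=\liminf_{r\downarrow 0}\frac{\mu(B(a,r))}{r^m}>0,$$ and that for $\mu$-a.e. $a$ the principal value $$T^m_\Lambda\mu(a)=\lim_{\epsilon\downarrow 0}\int_{|\Lambda(a)^{-1}(y-a)|\ge\epsilon}\frac{\Lambda(a)^{-1}(y-a)}{|\Lambda(a)^{-1}(y-a)|^{m+1}}\,d\mu(y)$$ exists in $\mathbb{R}^n$. For $a\in\mathbb{R}^n$ let $\mathrm{Tan}_\Lambda(\mu,a)$, the set of $\Lambda$-tangents to $\mu$ at $a$, be the set of all non-zero Radon measures $\nu$ on $\mathbb{R}^n$ for which there are $c_i>0$ and $r_i\downarrow 0$ such that $c_i\,T^\Lambda_{a,r_i}[\mu]\to\nu$ in the weak-$*$ sense (against continuous functions with compact support), where $T^\Lambda_{a,r}(y)=\Lambda(a)^{-1}\big(\tfrac{y-a}{r}\big)$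 and $T[\mu](E)=\mu(T^{-1}(E))$. Then for $\mu$-a.e. $a$, every $\nu\in\mathrm{Tan}_\Lambda(\mu,a)$ satisfies $$\int_{r\le|y-x|\le R}\frac{y-x}{|y-x|^{m+1}}\,d\nu(y)=0\qquad\text{for all }x\in\operatorname{spt}\nu\text{ and all }0<r<R<\infty .$$ In particular, for $\mu$-a.e. $a$, $\mathrm{Tan}_\Lambda(\mu,a)\subset\mathcal{S}_n$, where $\mathcal{S}_n$ is the set of all non-zero locally finite Borel measures $\nu$ on $\mathbb{R}^n$ with $0\in\operatorname{spt}\nu$ such that $$\int_{B(x,r)}\langle z-x,y\rangle\,d\nu(z)=0\qquad\text{for all }x\in\operatorname{spt}\nu,\ y\in\mathbb{R}^n,\ r>0 .$$ -/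

import Mathlib

open MeasureTheory Filter Topology
open scoped ENNReal

/-- `ℝⁿ` with the Euclidean norm. -/
abbrev Euc (n : ℕ) : Type := EuclideanSpace ℝ (Fin n)

/-- The invertible matrix `M⁻¹` acting on `ℝⁿ`. -/
noncomputable def invAct {n : ℕ} (M : Matrix.GeneralLinearGroup (Fin n) ℝ) (v : Euc n) : Euc n :=
  Matrix.toEuclideanCLM (𝕜 := ℝ) (n := Fin n) ((M⁻¹ : Matrix.GeneralLinearGroup (Fin n) ℝ).val) v

/-- The lower `m`-density `liminf_{r ↓ 0} μ(B(a,r)) / r^m`, with closed balls `B(a,r)`. -/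
noncomputable def lowerDensity {n : ℕ} (m : ℕ) (μ : Measure (Euc n)) (a : Euc n) : ℝ≥0∞ :=
  liminf (fun r : ℝ => μ (Metric.closedBall a r) / ENNReal.ofReal (r ^ m)) (𝓝[>] (0 : ℝ))

/-- The kernel `v / |v|^(m+1)`. -/
noncomputable def rieszKernel {n : ℕ} (m : ℕ) (v : Euc n) : Euc n :=
  (‖v‖ ^ (m + 1))⁻¹ • v

/-- The truncated integral
`∫_{|Λ(x)⁻¹(y-x)| ≥ ε} Λ(x)⁻¹(y-x) / |Λ(x)⁻¹(y-x)|^(m+1) dμ(y)`. -/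
noncomputable def truncatedIntegral {n : ℕ} (m : ℕ)
    (Λ : Euc n → Matrix.GeneralLinearGroup (Fin n) ℝ) (μ : Measure (Euc n))
    (x : Euc n) (ε : ℝ) : Euc n :=
  ∫ y in {y : Euc n | ε ≤ ‖invAct (Λ x) (y - x)‖}, rieszKernel m (invAct (Λ x) (y - x)) ∂μ

/-- The principal value `T^m_Λ μ(x)` exists (as an element of `ℝⁿ`). -/
def PrincipalValueExists {n : ℕ} (m : ℕ)
    (Λ : Euc n → Matrix.GeneralLinearGroup (Fin n) ℝ) (μ : Measure (Euc n)) (x : Euc n) : Prop :=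
  ∃ v : Euc n, Tendsto (truncatedIntegral m Λ μ x) (𝓝[>] (0 : ℝ)) (𝓝 v)

/-- The rescaling `T^Λ_{a,r}(y) = Λ(a)⁻¹ ((y - a) / r)`. -/
noncomputable def rescale {n : ℕ} (Λ : Euc n → Matrix.GeneralLinearGroup (Fin n) ℝ)
    (a : Euc n) (r : ℝ) (y : Euc n) : Euc n :=
  invAct (Λ a) (r⁻¹ • (y - a))

/-- Weak-* convergence of measures on `ℝⁿ`: convergence against every continuous function with
compact support. -/
def WeakStarTendsto {n : ℕ} (μs : ℕ → Measure (Euc n)) (ν : Measure (Euc n)) : Prop :=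
  ∀ f : Euc n → ℝ, Continuous f → HasCompactSupport f →
    Tendsto (fun i => ∫ y, f y ∂(μs i)) atTop (𝓝 (∫ y, f y ∂ν))

/-- The `Λ`-tangents to `μ` at `a`: the non-zero Radon measures `ν` that are weak-* limits of
`c_i T^Λ_{a,r_i}[μ]` with `c_i > 0` and `r_i ↓ 0`. On `ℝⁿ` the Radon measures are the locally
finite Borel measures. -/
def lambdaTangents {n : ℕ} (Λ : Euc n → Matrix.GeneralLinearGroup (Fin n) ℝ)
    (μ : Measure (Euc n)) (a : Euc n) : Set (Measure (Euc n)) :=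
  {ν | IsLocallyFiniteMeasure ν ∧ ν ≠ 0 ∧
    ∃ c r : ℕ → ℝ, (∀ i, 0 < c i) ∧ (∀ i, 0 < r i) ∧ Tendsto r atTop (𝓝 0) ∧
      WeakStarTendsto
        (fun i => ENNReal.ofReal (c i) • Measure.map (rescale Λ a (r i)) μ) ν}

/-- `x` is a point of symmetry of `ν`: `∫_{B(x,r)} ⟨z - x, y⟩ dν(z) = 0` for all `y` and `r > 0`. -/
def IsPointOfSymmetry {n : ℕ} (ν : Measure (Euc n)) (x : Euc n) : Prop :=
  ∀ y : Euc n, ∀ r : ℝ, 0 < r → ∫ z in Metric.closedBall x r, inner ℝ (z - x) y ∂ν = 0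

/-- Symmetric measures: non-zero locally finite measures such that every point of the support is a
point of symmetry. -/
structure IsSymmetricMeasure {n : ℕ} (ν : Measure (Euc n)) : Prop where
  locallyFinite : IsLocallyFiniteMeasure ν
  ne_zero : ν ≠ 0
  pointOfSymmetry : ∀ x ∈ ν.support, IsPointOfSymmetry ν x

/-- The cone `𝒮ₙ` of symmetric measures on `ℝⁿ` whose support contains `0`. -/
def symmetricMeasures (n : ℕ) : Set (Measure (Euc n)) :=
  {ν | IsSymmetricMeasure ν ∧ (0 : Euc n) ∈ ν.support}

/-! Existence of the principal value means that the truncated integrals at a point b oscillate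
little below some scale. Integrating them against the derivative of w(t) = t^(m+1) h(t) bounds ∫
h(|v|) v dμ, with v = Λ(b)⁻¹(z - b), by a small multiple of R^(m+1) for a C¹ profile h vanishing at
R (`norm_setIntegral_radial_le`). The lower density makes R^m at most a constant times the mass, so
almost every point is an approximate centre of symmetry for the ellipsoids of its own shape.

As Λ is arbitrary, centres are organised by countable decompositions and a density theorem along
ellipsoids (`ae_density_ellipsoid`). At almost every a this gives nested sets of centres F 0 ⊇ F 1 ⊇
... through a, with better and better symmetry and shapes closer and closer to that of a, each set
being dense at the points of the next (`ae_exists_centerData`). A ball of positive ν-mass around x ∈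
spt ν cannot miss the rescaled centres, so x is a limit of them, and near-symmetry passes to the
limit: ∫ f(|z - x|)(z - x) dν = 0 for C¹ profiles f vanishing far out
(`IsBlowUpLimit.integral_radial_eq_zero`). Approximating the indicator of [0, r], and t^(-(m+1)) on
[r, R], gives symmetry and the vanishing annular integrals.

The harder point is 0 ∈ spt ν: it uses doubling of μ at a (`exists_measure_ball_le`), although no
upper density is assumed. Let k be the least dimension such that the centres are, at arbitrarily
small scales and to any precision, close to a subspace of dimension at most k; then at no small
scale are they τ-close to one of dimension less than k. Suppose they are k-flat at some scale. A
centre b almost maximising the smoothed mass ∫ p_b⁴ cannot have its mass concentrated near the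
boundary of its ellipsoid, which gives doubling there (`exists_concentrated_center`). Doubling makes
the derivative of the symmetry relation nondegenerate transversally to the flat, so the centres are
k-flat at a smaller scale too (`exists_near_subspace_of_doubling`). Flatness and doubling thus
descend together to all scales. -/

/-! ### Linear algebra: sets that span a subspace quantitatively. -/

section Spanning
variable {E : Type*} [NormedAddCommGroup E] [InnerProductSpace ℝ E] [FiniteDimensional ℝ E]

/-- Every point of `S` is at distance at most `τ` from the subspace `L`. -/
def NearSubspace (L : Submodule ℝ E) (τ : ℝ) (S : Set E) : Prop :=
  ∀ x ∈ S, ∃ w ∈ L, ‖x - w‖ ≤ τ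

/-- A set in the unit ball which is not close to any subspace of dimension less than `k` controls
all seminorms on a subspace of dimension `k`. -/
theorem exists_subspace_seminorm_le (τ : ℝ) (hτ : 0 < τ) (k : ℕ) :
    ∃ K : ℝ, 0 < K ∧ ∀ S : Set E, S ⊆ Metric.closedBall 0 1 →
      (∀ L : Submodule ℝ E, Module.finrank ℝ L < k → ¬ NearSubspace L τ S) →
      ∃ X : Submodule ℝ E, Module.finrank ℝ X = k ∧
        ∀ (N : Seminorm ℝ E) (B : ℝ), 0 ≤ B → (∀ x ∈ S, N x ≤ B) →
          ∀ u ∈ X, N u ≤ K * B * ‖u‖ := by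
  induction k with
  | zero =>
    refine ⟨1, one_pos, fun S _ _ => ⟨⊥, by simp, fun N B hB _ u hu => ?_⟩⟩
    rw [Submodule.mem_bot] at hu
    simp [hu]
  | succ k ih =>
    obtain ⟨K, hK, h⟩ := ih
    -- A point x of S farther than τ from X adds the direction y = x - P x, where N y ≤ (1 + K) B;
    -- orthogonality and |y| > τ bound the coefficient of y in u by |u| / τ.
    refine ⟨K + (1 + K) / τ, by positivity, fun S hS hflat => ?_⟩
    obtain ⟨X, hX, hN⟩ := h S hS (fun L hL => hflat L (by omega))
    have hx := hflat X (by omega)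
    simp only [NearSubspace, not_forall, not_exists, not_and, not_le] at hx
    obtain ⟨x, hxS, hx⟩ := hx
    set y := x - X.starProjection x with hy
    have hyX : y ∈ Xᗮ := Submodule.sub_starProjection_mem_orthogonal x
    have hyτ : τ < ‖y‖ := hx _ (Submodule.starProjection_apply_mem X x)
    have hy0 : y ≠ 0 := by
      intro h0; rw [h0, norm_zero] at hyτ; linarith
    have hyn : y ∉ X := fun hyX' => hy0 (by
      have := Submodule.inner_right_of_mem_orthogonal hyX' hyX
      simpa using this)
    refine ⟨X ⊔ Submodule.span ℝ {y}, ?_, ?_⟩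
    · have hdisj : X ⊓ Submodule.span ℝ {y} = ⊥ := by
        rw [← disjoint_iff, Submodule.disjoint_span_singleton' hy0]
        exact hyn
      have := Submodule.finrank_sup_add_finrank_inf_eq X (Submodule.span ℝ {y})
      rw [hdisj, finrank_bot, finrank_span_singleton hy0, hX] at this
      omega
    · intro N B hB hNS u hu
      obtain ⟨v, hv, w, hw, rfl⟩ := Submodule.mem_sup.1 hu
      obtain ⟨t, rfl⟩ := Submodule.mem_span_singleton.1 hw
      have horth : inner ℝ v (t • y) = 0 :=
        Submodule.inner_right_of_mem_orthogonal hv (Submodule.smul_mem _ t hyX)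
      have hpy := norm_add_sq_eq_norm_sq_add_norm_sq_of_inner_eq_zero v (t • y) horth
      have h1 : ‖v‖ ≤ ‖v + t • y‖ := by
        nlinarith [norm_nonneg v, norm_nonneg (v + t • y), norm_nonneg (t • y)]
      have h2 : |t| * ‖y‖ ≤ ‖v + t • y‖ := by
        rw [← Real.norm_eq_abs, ← norm_smul]
        nlinarith [norm_nonneg v, norm_nonneg (v + t • y), norm_nonneg (t • y)]
      have hxn : ‖x‖ ≤ 1 := by simpa using hS hxS
      have hpx : ‖X.starProjection x‖ ≤ 1 := (Submodule.norm_starProjection_apply_le X x).trans hxn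
      have hNy : N y ≤ (1 + K) * B := by
        have h3 := hN N B hB hNS _ (Submodule.starProjection_apply_mem X x)
        have h4 : N y ≤ N x + N (X.starProjection x) := map_sub_le_add N _ _
        have h5 : K * B * ‖X.starProjection x‖ ≤ K * B * 1 := by gcongr
        linarith [hNS x hxS]
      have ht : |t| ≤ ‖v + t • y‖ / τ := by
        rw [le_div_iff₀ hτ]
        refine le_trans ?_ h2
        gcongr
      calc N (v + t • y) ≤ N v + N (t • y) := map_add_le_add N _ _
        _ = N v + |t| * N y := by rw [map_smul_eq_mul, Real.norm_eq_abs]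
        _ ≤ K * B * ‖v + t • y‖ + ‖v + t • y‖ / τ * ((1 + K) * B) := by
            have h6 := hN N B hB hNS v hv
            have h7 : K * B * ‖v‖ ≤ K * B * ‖v + t • y‖ := by gcongr
            have h8 : |t| * N y ≤ ‖v + t • y‖ / τ * ((1 + K) * B) := by gcongr
            linarith
        _ = (K + (1 + K) / τ) * B * ‖v + t • y‖ := by ring

/-- A subspace meets the orthogonal complement of any subspace of smaller dimension. -/
theorem exists_unit_mem_orthogonal (X W : Submodule ℝ E)
    (h : Module.finrank ℝ W < Module.finrank ℝ X) : ∃ e ∈ X, e ∈ Wᗮ ∧ ‖e‖ = 1 := by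
  have h1 := Submodule.finrank_sup_add_finrank_inf_eq X Wᗮ
  have h2 := Submodule.finrank_add_finrank_orthogonal W
  have h3 := Submodule.finrank_le (X ⊔ Wᗮ)
  have h4 : X ⊓ Wᗮ ≠ ⊥ := by
    intro h0
    rw [h0, finrank_bot] at h1
    omega
  obtain ⟨v, hv, hv0⟩ := Submodule.exists_mem_ne_zero_of_ne_bot h4
  refine ⟨‖v‖⁻¹ • v, X.smul_mem _ hv.1, Wᗮ.smul_mem _ hv.2, ?_⟩
  rw [norm_smul, norm_inv, norm_norm, inv_mul_cancel₀ (norm_ne_zero_iff.2 hv0)]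

/-- The distance to a subspace as a seminorm. -/
noncomputable def projSeminorm (W : Submodule ℝ E) : Seminorm ℝ E :=
  (normSeminorm ℝ E).comp (Wᗮ.starProjection : E →L[ℝ] E).toLinearMap

theorem projSeminorm_apply (W : Submodule ℝ E) (z : E) :
    projSeminorm W z = ‖z - W.starProjection z‖ := by
  have : Wᗮ.starProjection z = z - W.starProjection z := by
    rw [Submodule.starProjection_orthogonal']; simp
  simp [projSeminorm, this]

theorem norm_sub_starProjection_le (W : Submodule ℝ E) (z : E) {w : E} (hw : w ∈ W) :
    ‖z - W.starProjection z‖ ≤ ‖z - w‖ := by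
  rw [Submodule.starProjection_minimal]
  exact ciInf_le ⟨0, by rintro _ ⟨x, rfl⟩; positivity⟩ (⟨w, hw⟩ : W)

end Spanning

/-! ### Bumps on ellipsoids and the unit-scale hypotheses. -/

section Bump
variable {E : Type*} [NormedAddCommGroup E] [InnerProductSpace ℝ E]

/-- The bump `max 0 (1 - |A (z - b)|²)` supported in the unit ellipsoid of `A` around `b`. -/
noncomputable def ellBump (A : E →L[ℝ] E) (b z : E) : ℝ := max 0 (1 - ‖A (z - b)‖ ^ 2)

/-- The closed ellipsoid of size `s` around `b`. -/
def ellipsoid (A : E →L[ℝ] E) (b : E) (s : ℝ) : Set E := {z | ‖A (z - b)‖ ≤ s}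

theorem continuous_ellBump (A : E →L[ℝ] E) (b : E) : Continuous (ellBump A b) := by
  unfold ellBump; fun_prop

theorem ellBump_nonneg (A : E →L[ℝ] E) (b z : E) : 0 ≤ ellBump A b z := le_max_left _ _

theorem ellBump_le_one (A : E →L[ℝ] E) (b z : E) : ellBump A b z ≤ 1 :=
  max_le zero_le_one (by nlinarith [sq_nonneg ‖A (z - b)‖])

theorem isClosed_ellipsoid (A : E →L[ℝ] E) (b : E) (s : ℝ) : IsClosed (ellipsoid A b s) :=
  isClosed_le (by fun_prop) continuous_const

theorem norm_le_two_mul_norm_apply {A : E →L[ℝ] E} {ε : ℝ} (hA : ‖A - 1‖ ≤ ε) (hε : ε ≤ 1 / 2)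
    (v : E) : ‖v‖ ≤ 2 * ‖A v‖ := by
  have h1 : ‖(A - 1) v‖ ≤ ε * ‖v‖ := ((A - 1).le_opNorm v).trans (by gcongr)
  have h2 : ‖v‖ ≤ ‖A v‖ + ‖(A - 1) v‖ := by
    have : v = A v - (A - 1) v := by simp
    calc ‖v‖ = ‖A v - (A - 1) v‖ := by rw [← this]
      _ ≤ _ := norm_sub_le _ _
  nlinarith [norm_nonneg v]

theorem abs_norm_apply_sub_norm_le {A : E →L[ℝ] E} {ε : ℝ} (hA : ‖A - 1‖ ≤ ε) (v : E) :
    |‖A v‖ - ‖v‖| ≤ ε * ‖v‖ := by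
  have h1 : ‖(A - 1) v‖ ≤ ε * ‖v‖ := ((A - 1).le_opNorm v).trans (by gcongr)
  refine (abs_norm_sub_norm_le _ _).trans ?_
  simpa using h1

theorem abs_norm_apply_sq_sub_le {A : E →L[ℝ] E} {ε : ℝ} (hA : ‖A - 1‖ ≤ ε) (hε : ε ≤ 1)
    (v : E) : |‖A v‖ ^ 2 - ‖v‖ ^ 2| ≤ 3 * ε * ‖v‖ ^ 2 := by
  have h0 : 0 ≤ ε := (norm_nonneg _).trans hA
  have h1 := abs_norm_apply_sub_norm_le hA v
  have h2 : ‖A v‖ ^ 2 - ‖v‖ ^ 2 = (‖A v‖ - ‖v‖) * (‖A v‖ + ‖v‖) := by ring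
  have h3 : ‖A v‖ + ‖v‖ ≤ 3 * ‖v‖ := by nlinarith [(abs_le.1 h1).2, norm_nonneg v]
  rw [h2, abs_mul, abs_of_nonneg (by positivity : 0 ≤ ‖A v‖ + ‖v‖)]
  calc _ ≤ (ε * ‖v‖) * (3 * ‖v‖) := by gcongr
    _ = _ := by ring

theorem norm_lt_two_of_ellBump_ne_zero {A : E →L[ℝ] E} {ε : ℝ} (hA : ‖A - 1‖ ≤ ε)
    (hε : ε ≤ 1 / 2) {b z : E} (h : ellBump A b z ≠ 0) : ‖A (z - b)‖ < 1 ∧ ‖z - b‖ < 2 := by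
  have h1 : ‖A (z - b)‖ < 1 := by
    by_contra h2
    push Not at h2
    apply h
    rw [ellBump, max_eq_left]
    nlinarith
  exact ⟨h1, by linarith [norm_le_two_mul_norm_apply hA hε (z - b)]⟩

theorem ellBump_eq_of_ne_zero {A : E →L[ℝ] E} {b z : E} (h : ellBump A b z ≠ 0) :
    ellBump A b z = 1 - ‖A (z - b)‖ ^ 2 := by
  rw [ellBump] at h ⊢
  rcases le_total (1 - ‖A (z - b)‖ ^ 2) 0 with h1 | h1
  · exact absurd (max_eq_left h1) h
  · exact max_eq_right h1

theorem hasCompactSupport_ellBump [FiniteDimensional ℝ E] {A : E →L[ℝ] E} {ε : ℝ}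
    (hA : ‖A - 1‖ ≤ ε) (hε : ε ≤ 1 / 2) (b : E) : HasCompactSupport (ellBump A b) := by
  have := FiniteDimensional.proper_real E
  refine HasCompactSupport.intro (isCompact_closedBall b 2) (fun z hz => ?_)
  by_contra h
  apply hz
  rw [mem_closedBall_iff_norm]
  exact (norm_lt_two_of_ellBump_ne_zero hA hε h).2.le

variable [FiniteDimensional ℝ E] [MeasurableSpace E] [BorelSpace E]

theorem integrable_ellBump_pow_mul {A : E →L[ℝ] E} {ε : ℝ}
    (hA : ‖A - 1‖ ≤ ε) (hε : ε ≤ 1 / 2) (b : E) (μ : Measure E) [IsFiniteMeasure μ]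
    (N : ℕ) (hN : N ≠ 0) {g : E → ℝ} (hg : Continuous g) :
    Integrable (fun z => ellBump A b z ^ N * g z) μ := by
  have h1 := continuous_ellBump A b
  refine Continuous.integrable_of_hasCompactSupport (by fun_prop) ?_
  have h2 : HasCompactSupport (fun z => ellBump A b z ^ N) :=
    (hasCompactSupport_ellBump hA hε b).comp_left (g := fun t => t ^ N) (zero_pow hN)
  exact h2.mul_right

theorem integrable_ellBump_pow {A : E →L[ℝ] E} {ε : ℝ}
    (hA : ‖A - 1‖ ≤ ε) (hε : ε ≤ 1 / 2) (b : E) (μ : Measure E) [IsFiniteMeasure μ]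
    (N : ℕ) (hN : N ≠ 0) : Integrable (fun z => ellBump A b z ^ N) μ := by
  simpa using integrable_ellBump_pow_mul hA hε b μ N hN (g := fun _ => 1) continuous_const

theorem integrable_ellBump_pow_smul {A : E →L[ℝ] E} {ε : ℝ}
    (hA : ‖A - 1‖ ≤ ε) (hε : ε ≤ 1 / 2) (b : E) (μ : Measure E) [IsFiniteMeasure μ]
    (N : ℕ) (hN : N ≠ 0) {g : E → E} (hg : Continuous g) :
    Integrable (fun z => ellBump A b z ^ N • g z) μ := by
  have h1 := continuous_ellBump A b
  refine Continuous.integrable_of_hasCompactSupport (by fun_prop) ?_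
  have h2 : HasCompactSupport (fun z => ellBump A b z ^ N) :=
    (hasCompactSupport_ellBump hA hε b).comp_left (g := fun t => t ^ N) (zero_pow hN)
  exact h2.smul_right

/-- If `V` occupies a small proportion of all ellipsoids around `b`, it does so for the weight
`ellBump A b ^ N`. -/
theorem setIntegral_ellBump_pow_le {A : E →L[ℝ] E} {ε η : ℝ}
    (hA : ‖A - 1‖ ≤ η) (hη : η ≤ 1 / 2) (b : E) (μ : Measure E) [IsFiniteMeasure μ]
    (hε : 0 ≤ ε) (N : ℕ) (hN : N ≠ 0) {V : Set E}
    (h : ∀ s, 0 ≤ s → s ≤ 1 →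
      μ.real (V ∩ ellipsoid A b s) ≤ ε * μ.real (ellipsoid A b s)) :
    ∫ z in V, ellBump A b z ^ N ∂μ ≤ ε * ∫ z, ellBump A b z ^ N ∂μ := by
  have hi := integrable_ellBump_pow hA hη b μ N hN
  have hn : ∀ z, 0 ≤ ellBump A b z ^ N := fun z => pow_nonneg (ellBump_nonneg A b z) N
  -- Layer-cake formula: the superlevel sets of the weight are ellipsoids around b, where the
  -- hypothesis applies.
  have key : ∫⁻ z in V, ENNReal.ofReal (ellBump A b z ^ N) ∂μ ≤
      ENNReal.ofReal ε * ∫⁻ z, ENNReal.ofReal (ellBump A b z ^ N) ∂μ := by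
    rw [lintegral_eq_lintegral_meas_le _ (Eventually.of_forall hn) hi.aemeasurable.restrict,
      lintegral_eq_lintegral_meas_le _ (Eventually.of_forall hn) hi.aemeasurable,
      ← lintegral_const_mul' _ _ ENNReal.ofReal_ne_top]
    refine setLIntegral_mono' measurableSet_Ioi (fun t ht => ?_)
    have ht : 0 < t := ht
    have hm : MeasurableSet {z | t ≤ ellBump A b z ^ N} :=
      measurableSet_le measurable_const ((continuous_ellBump A b).pow N).measurable
    rw [Measure.restrict_apply hm]
    by_cases ht1 : 1 < t
    · have : {z | t ≤ ellBump A b z ^ N} = ∅ := by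
        ext z
        simp only [Set.mem_ofPred_eq, Set.mem_empty_iff_false, iff_false, not_le]
        exact (pow_le_one₀ (ellBump_nonneg A b z) (ellBump_le_one A b z)).trans_lt ht1
      simp [this]
    push Not at ht1
    set q := t ^ ((N : ℝ)⁻¹) with hq
    have hq0 : 0 < q := Real.rpow_pos_of_pos ht _
    have hq1 : q ≤ 1 := Real.rpow_le_one ht.le ht1 (by positivity)
    have hqN : q ^ N = t := Real.rpow_inv_natCast_pow ht.le hN
    have hset : {z | t ≤ ellBump A b z ^ N} = ellipsoid A b (Real.sqrt (1 - q)) := by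
      ext z
      simp only [Set.mem_ofPred_eq, ellipsoid]
      rw [← hqN, pow_le_pow_iff_left₀ hq0.le (ellBump_nonneg A b z) hN, ellBump, le_max_iff,
        Real.le_sqrt (norm_nonneg _) (by linarith)]
      constructor
      · rintro (h1 | h1) <;> linarith
      · intro h1; right; linarith
    rw [hset]
    have h1 := h (Real.sqrt (1 - q)) (Real.sqrt_nonneg _) (Real.sqrt_le_one.2 (by linarith))
    rw [Set.inter_comm, ← ofReal_measureReal, ← ofReal_measureReal, ← ENNReal.ofReal_mul hε]
    exact ENNReal.ofReal_le_ofReal h1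
  rw [integral_eq_lintegral_of_nonneg_ae (Eventually.of_forall hn) hi.aestronglyMeasurable,
    integral_eq_lintegral_of_nonneg_ae (Eventually.of_forall hn) hi.aestronglyMeasurable.restrict]
  have hfin : ∫⁻ z, ENNReal.ofReal (ellBump A b z ^ N) ∂μ ≠ ⊤ := hi.lintegral_lt_top.ne
  have := ENNReal.toReal_mono (ENNReal.mul_ne_top ENNReal.ofReal_ne_top hfin) key
  rwa [ENNReal.toReal_mul, ENNReal.toReal_ofReal hε] at this

/-- A measure at unit scale: `F` is a set of approximate centres of symmetry, the shape of the
ellipsoid at `b` is `A b`, and `F` has almost full density at the points of `F'`. -/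
structure UnitScale (ε : ℝ) (μ : Measure E) (F F' : Set E) (A : E → E →L[ℝ] E) : Prop where
  subset : F' ⊆ F
  zero_mem : 0 ∈ F'
  shape_zero : A 0 = 1
  shape_near : ∀ b ∈ F, ‖b‖ ≤ 1 → ‖A b - 1‖ ≤ ε
  -- N = 3 is, up to a factor, the derivative of ∫ p⁴ in the centre; N = 2 serves to turn a
  -- one-sided first moment into an absolute one.
  center : ∀ b ∈ F, ‖b‖ ≤ 1 → ∀ N, N = 2 ∨ N = 3 →
    ‖∫ z, ellBump (A b) b z ^ N • (z - b) ∂μ‖ ≤ ε * ∫ z, ellBump (A b) b z ^ 4 ∂μ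
  pos : ∀ b ∈ F, ‖b‖ ≤ 1 → 0 < ∫ z, ellBump (A b) b z ^ 4 ∂μ
  -- Density is tested on measurable sets missing F, so that F itself need not be measurable.
  dense : ∀ b ∈ F', ‖b‖ ≤ 1 → ∀ s, 0 ≤ s → s ≤ 1 → ∀ V, MeasurableSet V → Disjoint V F →
    μ.real (V ∩ ellipsoid (A b) b s) ≤ ε * μ.real (ellipsoid (A b) b s)

/-- Second-order lower Taylor bound for the convex function t ↦ max 0 t ^ 4. The quadratic term is
kept only for b ≥ a, where the remaining terms of the binomial expansion are nonnegative. -/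
theorem max_zero_pow_four_ge (a b : ℝ) :
    max 0 a ^ 4 + 4 * max 0 a ^ 3 * (b - a) + 6 * max 0 a ^ 2 * max 0 (b - a) ^ 2 ≤
      max 0 b ^ 4 := by
  rcases le_total a 0 with ha | ha
  · rw [max_eq_left ha]; simp only [ne_eq, OfNat.ofNat_ne_zero, not_false_eq_true, zero_pow]
    have : 0 ≤ max 0 b ^ 4 := by positivity
    linarith
  rw [max_eq_right ha]
  rcases le_total (b - a) 0 with h | h
  · rw [max_eq_left h]
    rcases le_total b 0 with hb | hb
    · rw [max_eq_left hb]
      have : 0 ≤ a ^ 3 := by positivity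
      nlinarith
    · rw [max_eq_right hb]
      nlinarith [mul_nonneg (sq_nonneg (b - a)) (by positivity : 0 ≤ b ^ 2 + 2 * a * b + 3 * a ^ 2)]
  · rw [max_eq_right h, max_eq_right (by linarith)]
    have h1 : 0 ≤ (b - a) ^ 3 := by positivity
    have h2 : 0 ≤ (b - a) ^ 4 := by positivity
    nlinarith [mul_nonneg ha h1]

end Bump

/-! ### Comparison of bumps at two centres. -/

section Pointwise
variable {E : Type*} [NormedAddCommGroup E] [InnerProductSpace ℝ E]

/-- For round bumps the increment is exactly 2⟨z - b, x - b⟩ - |x - b|². Replacing A and B by the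
identity costs 3ε(4 + 9) ≤ 40ε, since |z - b| ≤ 2 and |z - x| ≤ 3 on the support of the first bump.
-/
theorem ellBump_pow_four_ge {ε : ℝ} {A B : E →L[ℝ] E} (hA : ‖A - 1‖ ≤ ε) (hB : ‖B - 1‖ ≤ ε)
    (hε : ε ≤ 1 / 2) {b x : E} (hbx : ‖x - b‖ ≤ 1) (z : E) :
    ellBump A b z ^ 4 +
      4 * (ellBump A b z ^ 3 * (2 * inner ℝ (z - b) (x - b) - ‖x - b‖ ^ 2 - 40 * ε)) +
      6 * (ellBump A b z ^ 2 *
        max 0 (2 * inner ℝ (z - b) (x - b) - ‖x - b‖ ^ 2 - 40 * ε) ^ 2) ≤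
      ellBump B x z ^ 4 := by
  by_cases hz : ellBump A b z = 0
  · rw [hz]
    have : 0 ≤ ellBump B x z ^ 4 := by positivity
    simpa using this
  have hz2 := (norm_lt_two_of_ellBump_ne_zero hA hε hz).2
  have hε0 : 0 ≤ ε := (norm_nonneg _).trans hA
  set g := 2 * inner ℝ (z - b) (x - b) - ‖x - b‖ ^ 2 - 40 * ε with hg
  set h := (1 - ‖B (z - x)‖ ^ 2) - (1 - ‖A (z - b)‖ ^ 2) with hh
  have hgh : g ≤ h := by
    have e1 := (abs_le.1 (abs_norm_apply_sq_sub_le hA (by linarith) (z - b))).1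
    have e2 := (abs_le.1 (abs_norm_apply_sq_sub_le hB (by linarith) (z - x))).2
    have e3 : ‖z - x‖ ^ 2 = ‖z - b‖ ^ 2 - 2 * inner ℝ (z - b) (x - b) + ‖x - b‖ ^ 2 := by
      rw [← norm_sub_sq_real]; congr 2; abel
    have e4 : ‖z - x‖ ≤ 3 := by
      have : z - x = (z - b) - (x - b) := by abel
      rw [this]; linarith [norm_sub_le (z - b) (x - b)]
    have e5 : ‖z - x‖ ^ 2 ≤ 9 := by nlinarith [norm_nonneg (z - x)]
    have e6 : ‖z - b‖ ^ 2 ≤ 4 := by nlinarith [norm_nonneg (z - b)]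
    have e7 : 3 * ε * ‖z - x‖ ^ 2 ≤ 3 * ε * 9 := by gcongr
    have e8 : 3 * ε * ‖z - b‖ ^ 2 ≤ 3 * ε * 4 := by gcongr
    linarith
  have key := max_zero_pow_four_ge (1 - ‖A (z - b)‖ ^ 2) (1 - ‖B (z - x)‖ ^ 2)
  change ellBump A b z ^ 4 + 4 * ellBump A b z ^ 3 * h + 6 * ellBump A b z ^ 2 * max 0 h ^ 2 ≤
    ellBump B x z ^ 4 at key
  have hp := ellBump_nonneg A b z
  have i1 : ellBump A b z ^ 3 * g ≤ ellBump A b z ^ 3 * h := by gcongr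
  have i2 : ellBump A b z ^ 2 * max 0 g ^ 2 ≤ ellBump A b z ^ 2 * max 0 h ^ 2 := by gcongr
  linarith

end Pointwise

/-! ### Moments at a nearly maximal centre. -/

section Doubling
variable {E : Type*} [NormedAddCommGroup E] [InnerProductSpace ℝ E]
  [FiniteDimensional ℝ E] [MeasurableSpace E] [BorelSpace E]

theorem abs_integral_ellBump_pow_mul_inner_le {ε : ℝ} {μ : Measure E} [IsFiniteMeasure μ]
    {F F' : Set E} {A : E → E →L[ℝ] E} (h : UnitScale ε μ F F' A) (hε : ε ≤ 1 / 2) {b : E}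
    (hb : b ∈ F) (hb1 : ‖b‖ ≤ 1) {N : ℕ} (hN : N = 2 ∨ N = 3) (v : E) :
    |∫ z, ellBump (A b) b z ^ N * inner ℝ (z - b) v ∂μ| ≤
      ε * (∫ z, ellBump (A b) b z ^ 4 ∂μ) * ‖v‖ := by
  have hint := integrable_ellBump_pow_smul (h.shape_near b hb hb1) hε b μ N (by omega)
    (g := fun z => z - b) (by fun_prop)
  have h1 : ∫ z, ellBump (A b) b z ^ N * inner ℝ (z - b) v ∂μ =
      inner ℝ v (∫ z, ellBump (A b) b z ^ N • (z - b) ∂μ) := by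
    rw [← integral_inner hint]
    congr 1; ext z
    rw [inner_smul_right, real_inner_comm]
  rw [h1]
  refine (abs_real_inner_le_norm _ _).trans ?_
  rw [mul_comm]
  gcongr
  exact h.center b hb hb1 N hN

theorem integral_ellBump_pow_antitone {A : E →L[ℝ] E} {ε : ℝ}
    (hA : ‖A - 1‖ ≤ ε) (hε : ε ≤ 1 / 2) (b : E) (μ : Measure E) [IsFiniteMeasure μ]
    {M N : ℕ} (hM : M ≠ 0) (h : M ≤ N) :
    ∫ z, ellBump A b z ^ N ∂μ ≤ ∫ z, ellBump A b z ^ M ∂μ := by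
  refine integral_mono (integrable_ellBump_pow hA hε b μ N (by omega))
    (integrable_ellBump_pow hA hε b μ M hM) (fun z => ?_)
  exact pow_le_pow_of_le_one (ellBump_nonneg A b z) (ellBump_le_one A b z) h

/-- Integrate `ellBump_pow_four_ge`. The zeroth-order terms nearly cancel because b almost maximises
∫ p⁴, the linear term is small by symmetry at b, and what is left bounds the quadratic term. -/
theorem integral_ellBump_sq_mul_sq_le {ε : ℝ} {μ : Measure E} [IsFiniteMeasure μ]
    {F F' : Set E} {A : E → E →L[ℝ] E} (h : UnitScale ε μ F F' A) (hε : ε ≤ 1 / 2) {b x : E}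
    (hb : b ∈ F) (hb1 : ‖b‖ ≤ 1 / 2) (hx : x ∈ F) (hx1 : ‖x‖ ≤ 1 / 2)
    (hmax : ∫ z, ellBump (A x) x z ^ 4 ∂μ ≤ (1 + 2 * ε) * ∫ z, ellBump (A b) b z ^ 4 ∂μ) :
    ∫ z, ellBump (A b) b z ^ 2 *
        max 0 (2 * inner ℝ (z - b) (x - b) - ‖x - b‖ ^ 2 - 40 * ε) ^ 2 ∂μ ≤
      (‖x - b‖ ^ 2 + 30 * ε) * ∫ z, ellBump (A b) b z ^ 3 ∂μ := by
  have hA := h.shape_near b hb (by linarith)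
  have hε0 : 0 ≤ ε := (norm_nonneg _).trans hA
  have hB := h.shape_near x hx (by linarith)
  have hbx : ‖x - b‖ ≤ 1 := by linarith [norm_sub_le x b]
  set v := x - b with hv
  have i4 := integrable_ellBump_pow hA hε b μ 4 (by norm_num)
  have i3 := integrable_ellBump_pow hA hε b μ 3 (by norm_num)
  have i3g := integrable_ellBump_pow_mul hA hε b μ 3 (by norm_num)
    (g := fun z => inner ℝ (z - b) v) (by fun_prop)
  have i3h := integrable_ellBump_pow_mul hA hε b μ 3 (by norm_num)
    (g := fun z => 2 * inner ℝ (z - b) v - ‖v‖ ^ 2 - 40 * ε) (by fun_prop)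
  have i2 := integrable_ellBump_pow_mul hA hε b μ 2 (by norm_num)
    (g := fun z => max 0 (2 * inner ℝ (z - b) v - ‖v‖ ^ 2 - 40 * ε) ^ 2) (by fun_prop)
  have i43 : Integrable (fun z => ellBump (A b) b z ^ 4 + 4 * (ellBump (A b) b z ^ 3 *
      (2 * inner ℝ (z - b) v - ‖v‖ ^ 2 - 40 * ε))) μ := i4.add (i3h.const_mul 4)
  have hmono := integral_mono (i43.add (i2.const_mul 6))
    (integrable_ellBump_pow hB hε x μ 4 (by norm_num))
    (fun z => ellBump_pow_four_ge hA hB hε hbx z)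
  simp only [Pi.add_apply] at hmono
  have e1 : ∫ z, ellBump (A b) b z ^ 3 * (2 * inner ℝ (z - b) v - ‖v‖ ^ 2 - 40 * ε) ∂μ =
      2 * (∫ z, ellBump (A b) b z ^ 3 * inner ℝ (z - b) v ∂μ) -
        (‖v‖ ^ 2 + 40 * ε) * ∫ z, ellBump (A b) b z ^ 3 ∂μ := by
    rw [← integral_const_mul, ← integral_const_mul, ← integral_sub (i3g.const_mul 2)
      (i3.const_mul _)]
    congr 1; ext z; ring
  rw [integral_add i43 (i2.const_mul 6), integral_add i4 (i3h.const_mul 4), integral_const_mul,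
    integral_const_mul, e1] at hmono
  have hc := (abs_le.1 (abs_integral_ellBump_pow_mul_inner_le h hε hb (by linarith)
    (Or.inr rfl) v)).1
  have h43 := integral_ellBump_pow_antitone hA hε b μ (M := 3) (N := 4) (by norm_num) (by norm_num)
  have h40 : 0 ≤ ∫ z, ellBump (A b) b z ^ 4 ∂μ :=
    integral_nonneg fun z => pow_nonneg (ellBump_nonneg _ _ _) _
  set A4 := ∫ z, ellBump (A b) b z ^ 4 ∂μ
  set A3 := ∫ z, ellBump (A b) b z ^ 3 ∂μ
  have hA3 : 0 ≤ A3 := h40.trans h43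
  have hc2 : ε * A4 * ‖v‖ ≤ ε * A3 * 1 := by gcongr
  have hc3 : ε * A4 ≤ ε * A3 := by gcongr
  have hc4 : 0 ≤ ‖v‖ ^ 2 * A3 := by positivity
  have hc5 : 0 ≤ ε * A3 := mul_nonneg hε0 (h40.trans h43)
  nlinarith

/-- With t = ⟨z - b, x - b⟩ one has |t| = 2 max 0 t - t; the mean of t is small by symmetry, and 2
max 0 t is at most Y + |x - b|² + 40ε. By the previous bound and ∫ p³ ≤ σ² ∫ p² the second moment of
Y is O(κ²σ²) ∫ p², so the arithmetic-geometric inequality balanced at Y = 6κσ gives a first moment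
of order κσ. The gain over the trivial order κ is the factor σ. -/
theorem integral_ellBump_sq_mul_abs_inner_le {ε κ σ : ℝ} {μ : Measure E} [IsFiniteMeasure μ]
    {F F' : Set E} {A : E → E →L[ℝ] E} (h : UnitScale ε μ F F' A) (hε : ε ≤ 1 / 2) {b x : E}
    (hκ0 : 0 < κ) (hσ : 0 < σ) (hκ : κ ≤ 1 / 2) (hεκ : ε ≤ κ ^ 2)
    (hb : b ∈ F) (hb1 : ‖b‖ ≤ κ) (hx : x ∈ F) (hx1 : ‖x‖ ≤ κ)
    (hmax : ∫ z, ellBump (A x) x z ^ 4 ∂μ ≤ (1 + 2 * ε) * ∫ z, ellBump (A b) b z ^ 4 ∂μ)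
    (hsmall : ∫ z, ellBump (A b) b z ^ 3 ∂μ ≤ σ ^ 2 * ∫ z, ellBump (A b) b z ^ 2 ∂μ) :
    ∫ z, ellBump (A b) b z ^ 2 * |inner ℝ (z - b) (x - b)| ∂μ ≤
      (6 * κ * σ + 4 * κ ^ 2 + 42 * ε) * ∫ z, ellBump (A b) b z ^ 2 ∂μ := by
  have hA := h.shape_near b hb (by linarith)
  have hε0 : 0 ≤ ε := (norm_nonneg _).trans hA
  have hsec := integral_ellBump_sq_mul_sq_le h hε hb (hb1.trans hκ) hx (hx1.trans hκ) hmax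
  have hbx : ‖x - b‖ ≤ 2 * κ := by linarith [norm_sub_le x b]
  set v := x - b with hv
  set Y : E → ℝ := fun z => max 0 (2 * inner ℝ (z - b) v - ‖v‖ ^ 2 - 40 * ε) with hY
  have i2 := integrable_ellBump_pow hA hε b μ 2 (by norm_num)
  have iin := integrable_ellBump_pow_mul hA hε b μ 2 (by norm_num)
    (g := fun z => inner ℝ (z - b) v) (by fun_prop)
  have iabs := integrable_ellBump_pow_mul hA hε b μ 2 (by norm_num)
    (g := fun z => |inner ℝ (z - b) v|) (by fun_prop)
  have iY2 := integrable_ellBump_pow_mul hA hε b μ 2 (by norm_num)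
    (g := fun z => Y z ^ 2) (by fun_prop)
  have h42 := integral_ellBump_pow_antitone hA hε b μ (M := 2) (N := 4) (by norm_num) (by norm_num)
  have hc := (abs_le.1 (abs_integral_ellBump_pow_mul_inner_le h hε hb (by linarith)
    (Or.inl rfl) v)).1
  have h40 : 0 ≤ ∫ z, ellBump (A b) b z ^ 4 ∂μ :=
    integral_nonneg fun z => pow_nonneg (ellBump_nonneg _ _ _) _
  have hpt : ∀ z, ellBump (A b) b z ^ 2 * |inner ℝ (z - b) v| ≤
      (3 * κ * σ + (‖v‖ ^ 2 + 40 * ε)) * ellBump (A b) b z ^ 2 +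
      (12 * κ * σ)⁻¹ * (ellBump (A b) b z ^ 2 * Y z ^ 2) -
        ellBump (A b) b z ^ 2 * inner ℝ (z - b) v := by
    intro z
    have hp : 0 ≤ ellBump (A b) b z ^ 2 := by positivity
    have y0 : 0 ≤ Y z := le_max_left _ _
    have y1 : 2 * inner ℝ (z - b) v - ‖v‖ ^ 2 - 40 * ε ≤ Y z := le_max_right _ _
    have y2 : Y z ≤ 3 * κ * σ + (12 * κ * σ)⁻¹ * Y z ^ 2 := by
      have hks : 0 < κ * σ := by positivity
      have : 3 * κ * σ + (12 * κ * σ)⁻¹ * Y z ^ 2 - Y z =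
          (12 * (κ * σ))⁻¹ * (6 * (κ * σ) - Y z) ^ 2 := by field_simp; ring
      have h2 : 0 ≤ (12 * (κ * σ))⁻¹ * (6 * (κ * σ) - Y z) ^ 2 := by positivity
      linarith
    have y3 : |inner ℝ (z - b) v| ≤ 3 * κ * σ + (‖v‖ ^ 2 + 40 * ε) +
        (12 * κ * σ)⁻¹ * Y z ^ 2 - inner ℝ (z - b) v := by
      rcases abs_cases (inner ℝ (z - b) v : ℝ) with h1 | h1
      · linarith
      · have : 0 ≤ ‖v‖ ^ 2 := by positivity
        linarith
    nlinarith [mul_le_mul_of_nonneg_left y3 hp]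
  have iadd : Integrable (fun z => (3 * κ * σ + (‖v‖ ^ 2 + 40 * ε)) * ellBump (A b) b z ^ 2 +
      (12 * κ * σ)⁻¹ * (ellBump (A b) b z ^ 2 * Y z ^ 2)) μ :=
    (i2.const_mul _).add (iY2.const_mul _)
  have hint := integral_mono iabs (iadd.sub iin) hpt
  simp only [Pi.sub_apply] at hint
  rw [integral_sub iadd iin, integral_add (i2.const_mul _) (iY2.const_mul _), integral_const_mul,
    integral_const_mul] at hint
  set A2 := ∫ z, ellBump (A b) b z ^ 2 ∂μ
  set A3 := ∫ z, ellBump (A b) b z ^ 3 ∂μ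
  set A4 := ∫ z, ellBump (A b) b z ^ 4 ∂μ
  have hA2 : 0 ≤ A2 := h40.trans h42
  have hv2 : ‖v‖ ^ 2 ≤ 4 * κ ^ 2 := by nlinarith [norm_nonneg v]
  have hsec2 : (12 * κ * σ)⁻¹ * (∫ z, ellBump (A b) b z ^ 2 * Y z ^ 2 ∂μ) ≤ 3 * κ * σ * A2 := by
    have s1 : (‖v‖ ^ 2 + 30 * ε) * A3 ≤ (34 * κ ^ 2) * (σ ^ 2 * A2) :=
      mul_le_mul (by linarith) hsmall
        (integral_nonneg fun z => pow_nonneg (ellBump_nonneg _ _ _) _) (by positivity)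
    rw [inv_mul_le_iff₀ (by positivity)]
    have : 0 ≤ κ ^ 2 * σ ^ 2 * A2 := by positivity
    nlinarith
  have hc2 : ε * A4 * ‖v‖ ≤ ε * A2 * 1 := by
    have : ‖v‖ ≤ 1 := by linarith
    gcongr
  have hv3 : ‖v‖ ^ 2 * A2 ≤ 4 * κ ^ 2 * A2 := by gcongr
  have : 0 ≤ ε * A2 := by positivity
  nlinarith

end Doubling

section Mono
variable {E : Type*} [NormedAddCommGroup E] [InnerProductSpace ℝ E] [MeasurableSpace E]

theorem UnitScale.mono {ε ε' : ℝ} {μ : Measure E} {F F' : Set E} {A : E → E →L[ℝ] E}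
    (h : UnitScale ε μ F F' A) (hε : ε ≤ ε') : UnitScale ε' μ F F' A where
  subset := h.subset
  zero_mem := h.zero_mem
  shape_zero := h.shape_zero
  shape_near b hb hb1 := (h.shape_near b hb hb1).trans hε
  center b hb hb1 N hN := (h.center b hb hb1 N hN).trans (by have := h.pos b hb hb1; gcongr)
  pos := h.pos
  dense b hb hb1 s hs0 hs1 V hV hVF := (h.dense b hb hb1 s hs0 hs1 V hV hVF).trans (by gcongr)

end Mono

/-! ### The absolute first moment as a seminorm, and concentration near a subspace. -/

section Doubling
variable {E : Type*} [NormedAddCommGroup E] [InnerProductSpace ℝ E]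
  [FiniteDimensional ℝ E] [MeasurableSpace E] [BorelSpace E]

/-- The first absolute moment in direction `v` of the measure with density `ellBump A b ^ 2`. -/
noncomputable def momentSeminorm {A : E →L[ℝ] E} {ε : ℝ} (hA : ‖A - 1‖ ≤ ε) (hε : ε ≤ 1 / 2)
    (b : E) (μ : Measure E) [IsFiniteMeasure μ] : Seminorm ℝ E :=
  Seminorm.of (fun v => ∫ z, ellBump A b z ^ 2 * |inner ℝ (z - b) v| ∂μ)
    (fun v w => by
      have h1 := integrable_ellBump_pow_mul hA hε b μ 2 (by norm_num)
        (g := fun z => |inner ℝ (z - b) v|) (by fun_prop)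
      have h2 := integrable_ellBump_pow_mul hA hε b μ 2 (by norm_num)
        (g := fun z => |inner ℝ (z - b) w|) (by fun_prop)
      rw [← integral_add h1 h2]
      refine integral_mono (integrable_ellBump_pow_mul hA hε b μ 2 (by norm_num)
        (g := fun z => |inner ℝ (z - b) (v + w)|) (by fun_prop)) (h1.add h2) (fun z => ?_)
      have := abs_add_le (inner ℝ (z - b) v : ℝ) (inner ℝ (z - b) w)
      simp only [inner_add_right]
      rw [← mul_add]
      gcongr)
    (fun a v => by
      rw [← integral_const_mul]
      congr 1; ext z
      rw [inner_smul_right, abs_mul, Real.norm_eq_abs]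
      ring)

theorem momentSeminorm_apply {A : E →L[ℝ] E} {ε : ℝ} (hA : ‖A - 1‖ ≤ ε) (hε : ε ≤ 1 / 2)
    (b : E) (μ : Measure E) [IsFiniteMeasure μ] (v : E) :
    momentSeminorm hA hε b μ v = ∫ z, ellBump A b z ^ 2 * |inner ℝ (z - b) v| ∂μ := rfl

theorem momentSeminorm_le {A : E →L[ℝ] E} {ε : ℝ} (hA : ‖A - 1‖ ≤ ε) (hε : ε ≤ 1 / 2)
    (b : E) (μ : Measure E) [IsFiniteMeasure μ] (v : E) :
    momentSeminorm hA hε b μ v ≤ 2 * ‖v‖ * ∫ z, ellBump A b z ^ 2 ∂μ := by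
  rw [momentSeminorm_apply, ← integral_const_mul]
  refine integral_mono (integrable_ellBump_pow_mul hA hε b μ 2 (by norm_num) (by fun_prop))
    ((integrable_ellBump_pow hA hε b μ 2 (by norm_num)).const_mul _) (fun z => ?_)
  by_cases hz : ellBump A b z = 0
  · simp [hz]
  have h2 := (norm_lt_two_of_ellBump_ne_zero hA hε hz).2
  have h3 := abs_real_inner_le_norm (z - b) v
  have h4 : |inner ℝ (z - b) v| ≤ 2 * ‖v‖ := h3.trans (by gcongr)
  calc _ ≤ ellBump A b z ^ 2 * (2 * ‖v‖) := by gcongr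
    _ = _ := by ring

/-- If the weighted mass is near a subspace `W` and its first moments along `W` are small, it is
concentrated near the centre. -/
theorem integral_ellBump_sq_sub_cube_le {ε θ B : ℝ} {μ : Measure E} [IsFiniteMeasure μ]
    {F F' : Set E} {A : E → E →L[ℝ] E} (h : UnitScale ε μ F F' A) (hε : ε ≤ 1 / 4) (hθ : 0 ≤ θ) (hB0 : 0 ≤ B)
    {b : E} (hbF : b ∈ F') (hb1 : ‖b‖ ≤ 1 / 2) (hA : ‖A b - 1‖ ≤ ε) (hε' : ε ≤ 1 / 2)
    (W : Submodule ℝ E)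
    (hflat : NearSubspace W θ (F ∩ Metric.closedBall 0 2))
    (hB : ∀ u ∈ W, momentSeminorm hA hε' b μ u ≤ B * ‖u‖) :
    ∫ z, ellBump (A b) b z ^ 2 ∂μ - ∫ z, ellBump (A b) b z ^ 3 ∂μ ≤
      2 * (Module.finrank ℝ E * B + (2 * θ + 2 * ε) * ∫ z, ellBump (A b) b z ^ 2 ∂μ) := by
  have hε0 : 0 ≤ ε := (norm_nonneg _).trans hA
  have i2 := integrable_ellBump_pow hA hε' b μ 2 (by norm_num)
  have i3 := integrable_ellBump_pow hA hε' b μ 3 (by norm_num)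
  have iW := integrable_ellBump_pow_mul hA hε' b μ 2 (by norm_num)
    (g := fun z => ‖W.starProjection (z - b)‖) (by fun_prop)
  have iO := integrable_ellBump_pow_mul hA hε' b μ 2 (by norm_num)
    (g := fun z => ‖(z - b) - W.starProjection (z - b)‖) (by fun_prop)
  -- On the support 1 - p = |A(z - b)|² ≤ 2|z - b|, so a first moment suffices; it is split into
  -- components along W and orthogonal to W.
  have hpt : ∀ z, ellBump (A b) b z ^ 2 - ellBump (A b) b z ^ 3 ≤
      2 * (ellBump (A b) b z ^ 2 * ‖W.starProjection (z - b)‖ +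
        ellBump (A b) b z ^ 2 * ‖(z - b) - W.starProjection (z - b)‖) := by
    intro z
    by_cases hz : ellBump (A b) b z = 0
    · simp [hz]
    have h1 := (norm_lt_two_of_ellBump_ne_zero hA hε' hz).1
    have h2 := ellBump_eq_of_ne_zero hz
    have h3 := (abs_le.1 (abs_norm_apply_sub_norm_le hA (z - b))).2
    have h4 : 1 - ellBump (A b) b z ≤ 2 * ‖z - b‖ := by
      rw [h2]; nlinarith [norm_nonneg (A b (z - b)), norm_nonneg (z - b)]
    have h5 : ‖z - b‖ ≤ ‖W.starProjection (z - b)‖ + ‖(z - b) - W.starProjection (z - b)‖ := by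
      have := norm_add_le (W.starProjection (z - b)) ((z - b) - W.starProjection (z - b))
      simpa using this
    have h6 : 0 ≤ ellBump (A b) b z ^ 2 := by positivity
    nlinarith [mul_le_mul_of_nonneg_left (h4.trans (mul_le_mul_of_nonneg_left h5 zero_le_two)) h6]
  have hI := integral_mono (i2.sub i3) ((iW.add iO).const_mul 2) hpt
  simp only [Pi.sub_apply, Pi.add_apply] at hI
  rw [integral_sub i2 i3, integral_const_mul, integral_add iW iO] at hI
  have hW : ∫ z, ellBump (A b) b z ^ 2 * ‖W.starProjection (z - b)‖ ∂μ ≤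
      Module.finrank ℝ E * B := by
    let o := stdOrthonormalBasis ℝ W
    have hproj : ∀ z, ‖W.starProjection (z - b)‖ ≤ ∑ i, |inner ℝ (z - b) (o i : E)| := by
      intro z
      have e1 : W.starProjection (z - b) = ∑ i, (inner ℝ (o i : E) (z - b) : ℝ) • (o i : E) := by
        rw [Submodule.starProjection_apply,
          OrthonormalBasis.orthogonalProjectionOnto_apply_eq_sum o (z - b)]
        simp
      rw [e1]
      refine (norm_sum_le _ _).trans (Finset.sum_le_sum fun i _ => ?_)
      have : ‖(o i : E)‖ = 1 := o.orthonormal.1 i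
      rw [norm_smul, this, mul_one, Real.norm_eq_abs, real_inner_comm]
    have hi : ∀ i, Integrable (fun z => ellBump (A b) b z ^ 2 * |inner ℝ (z - b) (o i : E)|) μ :=
      fun i => integrable_ellBump_pow_mul hA hε' b μ 2 (by norm_num) (by fun_prop)
    calc ∫ z, ellBump (A b) b z ^ 2 * ‖W.starProjection (z - b)‖ ∂μ
        ≤ ∫ z, ∑ i, ellBump (A b) b z ^ 2 * |inner ℝ (z - b) (o i : E)| ∂μ := by
          refine integral_mono iW (integrable_finsetSum _ fun i _ => hi i) (fun z => ?_)
          simp only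
          rw [← Finset.mul_sum]
          gcongr
          exact hproj z
      _ = ∑ i, ∫ z, ellBump (A b) b z ^ 2 * |inner ℝ (z - b) (o i : E)| ∂μ :=
          integral_finsetSum _ fun i _ => hi i
      _ ≤ ∑ i, B := by
          refine Finset.sum_le_sum fun i _ => ?_
          have h1 := hB (o i : E) (o i).2
          have h2 : ‖(o i : E)‖ = 1 := o.orthonormal.1 i
          rw [h2, mul_one] at h1
          exact h1
      _ = Module.finrank ℝ W * B := by simp
      _ ≤ Module.finrank ℝ E * B := by
          gcongr
          exact Submodule.finrank_le W
  have hO : ∫ z, ellBump (A b) b z ^ 2 * ‖(z - b) - W.starProjection (z - b)‖ ∂μ ≤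
      (2 * θ + 2 * ε) * ∫ z, ellBump (A b) b z ^ 2 ∂μ := by
    -- V contains no centre, so the density of F at b makes its weight negligible; off V both z and
    -- b are within θ of W.
    set V : Set E := {z | ‖z‖ ≤ 2} ∩ {z | θ < ‖z - W.starProjection z‖} with hV
    have hVm : MeasurableSet V :=
      (isClosed_le (by fun_prop) continuous_const).measurableSet.inter
        (isOpen_lt continuous_const (by fun_prop)).measurableSet
    have hVF : Disjoint V F := by
      rw [Set.disjoint_left]
      rintro z ⟨hz1, hz2⟩ hzF
      obtain ⟨w, hw, hzw⟩ := hflat z ⟨hzF, by simpa using hz1⟩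
      have hz2 : θ < ‖z - W.starProjection z‖ := hz2
      linarith [norm_sub_starProjection_le W z hw]
    have hVi := setIntegral_ellBump_pow_le hA hε' b μ hε0 2 (by norm_num) (V := V)
      (fun s hs0 hs1 => h.dense b hbF (by linarith) s hs0 hs1 V hVm hVF)
    rw [← integral_indicator hVm] at hVi
    have hpt2 : ∀ z, ellBump (A b) b z ^ 2 * ‖(z - b) - W.starProjection (z - b)‖ ≤
        2 * θ * ellBump (A b) b z ^ 2 + 2 * V.indicator (fun z => ellBump (A b) b z ^ 2) z := by
      intro z
      by_cases hz : ellBump (A b) b z = 0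
      · simp [hz, Set.indicator]
      have hz1 := (norm_lt_two_of_ellBump_ne_zero hA hε' hz).1
      have hzn : ‖z - b‖ ≤ 3 / 2 := by
        nlinarith [(abs_le.1 (abs_norm_apply_sub_norm_le hA (z - b))).1, norm_nonneg (z - b)]
      have hz2 : ‖z‖ ≤ 2 := by
        have := norm_add_le (z - b) b
        simp only [sub_add_cancel] at this; linarith
      by_cases hzV : z ∈ V
      · rw [Set.indicator_of_mem hzV]
        have : ‖(z - b) - W.starProjection (z - b)‖ ≤ 2 := by
          have := norm_sub_starProjection_le W (z - b) (Submodule.zero_mem W)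
          rw [sub_zero] at this; linarith
        have h6 : 0 ≤ ellBump (A b) b z ^ 2 := by positivity
        nlinarith [mul_nonneg hθ h6, mul_le_mul_of_nonneg_left this h6]
      · rw [Set.indicator_of_notMem hzV, mul_zero, add_zero, mul_comm]
        gcongr
        have h7 : ‖z - W.starProjection z‖ ≤ θ := by
          by_contra hc
          exact hzV ⟨hz2, not_le.1 hc⟩
        have h8 : ‖b - W.starProjection b‖ ≤ θ := by
          obtain ⟨w, hw, hbw⟩ := hflat b ⟨h.subset hbF, by simp; linarith⟩
          exact (norm_sub_starProjection_le W b hw).trans hbw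
        have h9 : (z - b) - W.starProjection (z - b) =
            (z - W.starProjection z) - (b - W.starProjection b) := by rw [map_sub]; abel
        rw [h9]
        linarith [norm_sub_le (z - W.starProjection z) (b - W.starProjection b)]
    have := integral_mono iO ((i2.const_mul (2 * θ)).add ((i2.indicator hVm).const_mul 2)) hpt2
    simp only [Pi.add_apply] at this
    rw [integral_add (i2.const_mul _) ((i2.indicator hVm).const_mul 2), integral_const_mul,
      integral_const_mul] at this
    linarith
  linarith

end Doubling

/-! ### A centre whose mass is not at the boundary. -/

section Doubling
variable {E : Type*} [NormedAddCommGroup E] [InnerProductSpace ℝ E]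
  [FiniteDimensional ℝ E] [MeasurableSpace E] [BorelSpace E]

/-- Take b almost maximising ∫ p⁴ over F' ∩ B(0, κ). If ∫ p³ < σ² ∫ p², the first moments in the
directions x - b, x ∈ F' ∩ B(0, κ), are O(κσ) ∫ p². Non-flatness at scale κ makes these points span
W quantitatively, so dividing by κ all first moments along W are O(Kσ) ∫ p². As the mass lies near
W, it sits near b, where p is close to 1: contradiction. -/
theorem exists_concentrated_center (τ : ℝ) (hτ : 0 < τ) (k : ℕ) :
    ∃ σ κ θ ε : ℝ, 0 < σ ∧ σ ≤ 1 / 2 ∧ 0 < κ ∧ κ ≤ σ ^ 2 / 100 ∧ 0 < θ ∧ 0 < ε ∧ ε ≤ κ ∧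
      ∀ (μ : Measure E) [IsFiniteMeasure μ]
      (F F' : Set E) (A : E → E →L[ℝ] E), UnitScale ε μ F F' A →
      ∀ W : Submodule ℝ E, Module.finrank ℝ W ≤ k →
        NearSubspace W θ (F ∩ Metric.closedBall 0 2) →
        (∀ L : Submodule ℝ E, Module.finrank ℝ L < k →
          ¬ NearSubspace L (τ * κ) (F' ∩ Metric.closedBall 0 κ)) →
        ∃ b ∈ F', ‖b‖ ≤ κ ∧
          σ ^ 2 * ∫ z, ellBump (A b) b z ^ 2 ∂μ ≤ ∫ z, ellBump (A b) b z ^ 3 ∂μ ∧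
          ∫ z, ellBump (A 0) 0 z ^ 4 ∂μ ≤ 2 * ∫ z, ellBump (A b) b z ^ 4 ∂μ := by
  obtain ⟨K, hK, hspan⟩ := exists_subspace_seminorm_le (E := E) (τ / 2) (by positivity) k
  obtain ⟨n, hn⟩ : ∃ n : ℝ, n = (Module.finrank ℝ E : ℝ) := ⟨_, rfl⟩
  have hn0 : 0 ≤ n := by rw [hn]; positivity
  -- Order of choice: σ against the dimension and the spanning constant K, then κ against σ², ε
  -- against κ² and κσ, and θ against κτ and κσ.
  obtain ⟨σ, hσ, hnK, hσ1⟩ : ∃ σ : ℝ, 0 < σ ∧ n * K * σ ≤ 1 / 100 ∧ σ ≤ 1 / 100 := by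
    refine ⟨1 / (100 * (n + 1) * (K + 1)), by positivity, ?_, ?_⟩
    · rw [mul_one_div, div_le_div_iff₀ (by positivity) (by norm_num)]
      nlinarith
    · rw [div_le_div_iff₀ (by positivity) (by norm_num)]
      nlinarith [mul_nonneg hn0 hK.le]
  obtain ⟨κ, hκ, hκσ2, hκσ⟩ : ∃ κ : ℝ, 0 < κ ∧ κ ≤ σ ^ 2 / 100 ∧ κ ≤ σ / 10000 :=
    ⟨σ ^ 2 / 100, by positivity, le_rfl, by nlinarith⟩
  obtain ⟨ε, hε, hεκ2, hεκ, hεσ⟩ : ∃ ε : ℝ, 0 < ε ∧ ε ≤ κ ^ 2 ∧ ε ≤ κ / 1000 ∧ ε ≤ κ * σ / 1000 :=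
    ⟨κ ^ 2 / 1000, by positivity, by nlinarith, by nlinarith, by nlinarith⟩
  obtain ⟨θ, hθ, hθτ, hθσ⟩ : ∃ θ : ℝ, 0 < θ ∧ θ ≤ κ * (τ / 2) ∧ θ ≤ κ * σ / 1000 :=
    ⟨min (κ * (τ / 2)) (κ * σ / 1000), lt_min (by positivity) (by positivity), min_le_left _ _,
      min_le_right _ _⟩
  have hθκ : θ ≤ κ / 1000 := by nlinarith
  refine ⟨σ, κ, θ, ε, hσ, by linarith, hκ, hκσ2, hθ, hε, by linarith,
    fun μ _ F F' A h W hW hflat hrob => ?_⟩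
  have hε4 : ε ≤ 1 / 4 := by linarith
  have hε2 : ε ≤ 1 / 2 := by linarith
  set T : Set ℝ := (fun x => ∫ z, ellBump (A x) x z ^ 4 ∂μ) '' (F' ∩ Metric.closedBall 0 κ) with hT
  have hmem : ∀ x ∈ F' ∩ Metric.closedBall 0 κ, x ∈ F ∧ ‖x‖ ≤ κ :=
    fun x hx => ⟨h.subset hx.1, by simpa using hx.2⟩
  have h0 : (0 : E) ∈ F' ∩ Metric.closedBall 0 κ := ⟨h.zero_mem, by simp [hκ.le]⟩
  have hTb : BddAbove T := by
    refine ⟨μ.real Set.univ, ?_⟩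
    rintro _ ⟨x, hx, rfl⟩
    have hA := h.shape_near x (hmem x hx).1 ((hmem x hx).2.trans (by linarith))
    have := integral_mono (integrable_ellBump_pow hA hε2 x μ 4 (by norm_num))
      (integrable_const (1 : ℝ)) (fun z => pow_le_one₀ (ellBump_nonneg (A x) x z)
        (ellBump_le_one (A x) x z))
    simpa using this
  have hT0 : 0 < sSup T :=
    (h.pos 0 (hmem 0 h0).1 (by simp)).trans_le (le_csSup hTb ⟨0, h0, rfl⟩)
  -- The supremum need not be attained; the factor 1 + 2ε is absorbed by the error terms.
  obtain ⟨_, ⟨b, hb, rfl⟩, hbmax⟩ := exists_lt_of_lt_csSup (s := T) (b := sSup T / (1 + 2 * ε))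
    ⟨_, 0, h0, rfl⟩ (div_lt_self hT0 (by linarith))
  have hmax : ∀ x ∈ F' ∩ Metric.closedBall 0 κ, ∫ z, ellBump (A x) x z ^ 4 ∂μ ≤
      (1 + 2 * ε) * ∫ z, ellBump (A b) b z ^ 4 ∂μ := by
    intro x hx
    rw [div_lt_iff₀ (by positivity)] at hbmax
    have := le_csSup hTb ⟨x, hx, rfl⟩
    simp only at this hbmax
    linarith
  have hA := h.shape_near b (hmem b hb).1 ((hmem b hb).2.trans (by linarith))
  have hA4 : 0 < ∫ z, ellBump (A b) b z ^ 4 ∂μ :=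
    h.pos b (hmem b hb).1 ((hmem b hb).2.trans (by linarith))
  refine ⟨b, hb.1, (hmem b hb).2, ?_, (hmax 0 h0).trans (by nlinarith)⟩
  have hA2 : 0 < ∫ z, ellBump (A b) b z ^ 2 ∂μ :=
    hA4.trans_le (integral_ellBump_pow_antitone hA hε2 b μ (by norm_num) (by norm_num))
  by_contra hsmall
  push Not at hsmall
  set A2 := ∫ z, ellBump (A b) b z ^ 2 ∂μ with hA2d
  set A3 := ∫ z, ellBump (A b) b z ^ 3 ∂μ
  set N := momentSeminorm hA hε2 b μ with hN
  set c := 6 * κ * σ + 4 * κ ^ 2 + 42 * ε with hc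
  have hNv : ∀ x ∈ F' ∩ Metric.closedBall 0 κ, N (x - b) ≤ c * A2 := fun x hx =>
    integral_ellBump_sq_mul_abs_inner_le h hε2 hκ hσ (by linarith) hεκ2
      (hmem b hb).1 (hmem b hb).2 (hmem x hx).1 (hmem x hx).2 (hmax x hx) hsmall.le
  have hNx : ∀ x ∈ F' ∩ Metric.closedBall 0 κ, N x ≤ 2 * c * A2 := by
    intro x hx
    have e1 := hNv x hx
    have e2 := hNv 0 h0
    have e3 : N x ≤ N (x - b) + N (0 - b) := by
      have : x = (x - b) - (0 - b) := by abel
      conv_lhs => rw [this]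
      exact map_sub_le_add N _ _
    linarith
  have hPx : ∀ x ∈ F' ∩ Metric.closedBall 0 κ, ‖x - W.starProjection x‖ ≤ θ := by
    intro x hx
    obtain ⟨w, hw, hxw⟩ := hflat x ⟨(hmem x hx).1, by
      have := (hmem x hx).2
      simp; linarith⟩
    exact (norm_sub_starProjection_le W x hw).trans hxw
  have hNP : ∀ x ∈ F' ∩ Metric.closedBall 0 κ,
      N (W.starProjection x) ≤ (2 * c + 2 * θ) * A2 := by
    intro x hx
    have e1 : N (W.starProjection x) ≤ N x + N (x - W.starProjection x) := by
      have : W.starProjection x = x - (x - W.starProjection x) := by abel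
      conv_lhs => rw [this]
      exact map_sub_le_add N _ _
    have e2 : N (x - W.starProjection x) ≤ 2 * θ * A2 := by
      refine (momentSeminorm_le hA hε2 b μ _).trans ?_
      gcongr
      exact hPx x hx
    linarith [hNx x hx]
  set S : Set E := (fun x => κ⁻¹ • W.starProjection x) '' (F' ∩ Metric.closedBall 0 κ) with hS
  obtain ⟨X, hX, hXN⟩ := hspan S (by
      rintro _ ⟨x, hx, rfl⟩
      simp only [mem_closedBall_zero_iff, norm_smul, norm_inv, Real.norm_of_nonneg hκ.le]
      rw [inv_mul_le_iff₀ hκ, mul_one]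
      exact (Submodule.norm_starProjection_apply_le W x).trans (hmem x hx).2) (by
    intro L hL hnear
    refine hrob L hL (fun x hx => ?_)
    obtain ⟨w, hw, hxw⟩ := hnear _ ⟨x, hx, rfl⟩
    refine ⟨κ • w, L.smul_mem _ hw, ?_⟩
    have e1 : x - κ • w = (x - W.starProjection x) + κ • (κ⁻¹ • W.starProjection x - w) := by
      rw [smul_sub, smul_smul, mul_inv_cancel₀ hκ.ne', one_smul]; abel
    rw [e1]
    refine (norm_add_le _ _).trans ?_
    rw [norm_smul, Real.norm_of_nonneg hκ.le]
    have e2 : κ * ‖κ⁻¹ • W.starProjection x - w‖ ≤ κ * (τ / 2) := by gcongr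
    linarith [hPx x hx])
  -- The distance to W is a seminorm vanishing on S, hence on X; so X ≤ W, and the dimensions force
  -- equality.
  have hXW : X = W := by
    refine Submodule.eq_of_le_of_finrank_le (fun u hu => ?_) (by omega)
    have := hXN (projSeminorm W) 0 le_rfl (by
      rintro _ ⟨x, hx, rfl⟩
      rw [projSeminorm_apply]
      have : W.starProjection (κ⁻¹ • W.starProjection x) = κ⁻¹ • W.starProjection x :=
        Submodule.starProjection_eq_self_iff.2
          (W.smul_mem _ (Submodule.starProjection_apply_mem W x))
      simp [this]) u hu
    rw [projSeminorm_apply, mul_zero, zero_mul] at this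
    rw [sub_eq_zero.1 (norm_le_zero_iff.1 this)]
    exact Submodule.starProjection_apply_mem W u
  subst hXW
  have hθ0 := hθ.le
  have hc0 : 0 ≤ c := by positivity
  have hB := hXN N (κ⁻¹ * ((2 * c + 2 * θ) * A2)) (by positivity) (by
    rintro _ ⟨x, hx, rfl⟩
    rw [map_smul_eq_mul, norm_inv, Real.norm_of_nonneg hκ.le]
    have := hNP x hx
    gcongr)
  have hfin := integral_ellBump_sq_sub_cube_le h hε4 hθ.le
    (B := K * (κ⁻¹ * ((2 * c + 2 * θ) * A2))) (by positivity) hb.1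
    ((hmem b hb).2.trans (by linarith)) hA hε2 X hflat hB
  have e1 : κ⁻¹ * (2 * c + 2 * θ) ≤ 15 * σ := by
    rw [inv_mul_le_iff₀ hκ, hc]
    nlinarith [mul_le_mul_of_nonneg_left hκσ hκ.le, mul_pos hκ hσ]
  have e2 : n * (K * (κ⁻¹ * ((2 * c + 2 * θ) * A2))) ≤ 15 / 100 * A2 := by
    calc n * (K * (κ⁻¹ * ((2 * c + 2 * θ) * A2))) =
        (n * K) * (κ⁻¹ * (2 * c + 2 * θ)) * A2 := by ring
      _ ≤ (n * K) * (15 * σ) * A2 := by gcongr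
      _ = 15 * (n * K * σ) * A2 := by ring
      _ ≤ 15 * (1 / 100) * A2 := by gcongr
      _ = _ := by ring
  rw [← hn] at hfin
  have e3 : σ ^ 2 * A2 ≤ 1 / 100 * A2 := by gcongr; nlinarith
  have e4 : (2 * θ + 2 * ε) * A2 ≤ 1 / 100 * A2 := by gcongr; linarith
  linarith

end Doubling

/-! ### From a concentrated centre to a comparison of balls. -/

section Doubling
variable {E : Type*} [NormedAddCommGroup E] [InnerProductSpace ℝ E]
  [FiniteDimensional ℝ E] [MeasurableSpace E] [BorelSpace E]

/-- If the centres are close to a `k`-dimensional subspace and, at a smaller scale, not close to any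
subspace of smaller dimension, then the measure of balls does not explode. -/
theorem measure_ball_le_of_near_subspace (τ : ℝ) (hτ : 0 < τ) (k : ℕ) :
    ∃ κ θ ε s C : ℝ, 0 < κ ∧ κ ≤ 1 ∧ 0 < θ ∧ 0 < ε ∧ 0 < s ∧ s ≤ 1 / 4 ∧ 0 < C ∧
      ∀ (μ : Measure E) [IsFiniteMeasure μ]
      (F F' : Set E) (A : E → E →L[ℝ] E), UnitScale ε μ F F' A →
      ∀ W : Submodule ℝ E, Module.finrank ℝ W ≤ k →
        NearSubspace W θ (F ∩ Metric.closedBall 0 2) →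
        (∀ L : Submodule ℝ E, Module.finrank ℝ L < k →
          ¬ NearSubspace L (τ * κ) (F' ∩ Metric.closedBall 0 κ)) →
        μ.real (Metric.closedBall 0 (1 - s)) ≤ C * μ.real (Metric.closedBall 0 (1 - 2 * s)) := by
  obtain ⟨σ, κ, θ, ε, hσ, hσ1, hκ, hκσ, hθ, hε, hεκ, hmain⟩ :=
    exists_concentrated_center (E := E) τ hτ k
  have hκ1 : κ ≤ 1 / 400 := by nlinarith
  refine ⟨κ, θ, ε, σ ^ 2 / 10, 4 / (σ ^ 2 * (σ ^ 2 / 10) ^ 4), hκ, by linarith, hθ, hε,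
    by positivity, by nlinarith, by positivity, fun μ _ F F' A h W hW hflat hrob => ?_⟩
  obtain ⟨b, hb, hbκ, h32, h44⟩ := hmain μ F F' A h W hW hflat hrob
  have hA := h.shape_near b (h.subset hb) (by linarith)
  have hε2 : ε ≤ 1 / 2 := by linarith
  have i2 := integrable_ellBump_pow hA hε2 b μ 2 (by norm_num)
  have i3 := integrable_ellBump_pow hA hε2 b μ 3 (by norm_num)
  have h42 := integral_ellBump_pow_antitone hA hε2 b μ (M := 2) (N := 4) (by norm_num)
    (by norm_num)
  set s := σ ^ 2 / 10 with hs
  have hs0 : 0 < s := by positivity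
  set T : Set E := Metric.closedBall 0 (1 - 2 * s) with hT
  have hTm : MeasurableSet T := Metric.isClosed_closedBall.measurableSet
  -- Points where p ≥ σ²/2 stay away from the boundary of the ellipsoid of b, hence lie in T because
  -- κ and ε are small against σ². Elsewhere p³ ≤ (σ²/2) p², which is absorbed by σ² ∫ p² ≤ ∫ p³.
  have hpt : ∀ z, ellBump (A b) b z ^ 3 ≤
      T.indicator (fun _ => (1 : ℝ)) z + σ ^ 2 / 2 * ellBump (A b) b z ^ 2 := by
    intro z
    have hp0 := ellBump_nonneg (A b) b z
    have hp1 := ellBump_le_one (A b) b z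
    by_cases hz : σ ^ 2 / 2 ≤ ellBump (A b) b z
    · have hzne : ellBump (A b) b z ≠ 0 := by
        have : 0 < σ ^ 2 / 2 := by positivity
        linarith
      have h1 := ellBump_eq_of_ne_zero hzne
      have h2 := norm_lt_two_of_ellBump_ne_zero hA hε2 hzne
      have h3 : ‖A b (z - b)‖ ≤ 1 - σ ^ 2 / 4 := by
        by_contra hc
        push Not at hc
        have : (1 - σ ^ 2 / 4) ^ 2 < ‖A b (z - b)‖ ^ 2 := by
          gcongr
          nlinarith
        nlinarith [sq_nonneg (σ ^ 2)]
      have h4 := (abs_le.1 (abs_norm_apply_sub_norm_le hA (z - b))).1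
      have h5 : ‖z‖ ≤ ‖z - b‖ + ‖b‖ := by
        have := norm_add_le (z - b) b
        simpa using this
      have hzT : z ∈ T := by
        rw [hT, mem_closedBall_zero_iff]
        nlinarith
      rw [Set.indicator_of_mem hzT]
      have : ellBump (A b) b z ^ 3 ≤ 1 := pow_le_one₀ hp0 hp1
      have : 0 ≤ σ ^ 2 / 2 * ellBump (A b) b z ^ 2 := by positivity
      linarith
    · push Not at hz
      have : 0 ≤ T.indicator (fun _ => (1 : ℝ)) z := Set.indicator_nonneg (fun _ _ => zero_le_one) z
      have : ellBump (A b) b z * ellBump (A b) b z ^ 2 ≤ σ ^ 2 / 2 * ellBump (A b) b z ^ 2 := by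
        gcongr
      nlinarith
  have iT : Integrable (T.indicator (fun _ => (1 : ℝ))) μ := (integrable_const 1).indicator hTm
  have hI := integral_mono i3 (iT.add (i2.const_mul _)) hpt
  simp only [Pi.add_apply] at hI
  rw [integral_add iT (i2.const_mul _), integral_const_mul, integral_indicator hTm,
    setIntegral_const, smul_eq_mul, mul_one] at hI
  have hball : s ^ 4 * μ.real (Metric.closedBall 0 (1 - s)) ≤
      ∫ z, ellBump (A 0) 0 z ^ 4 ∂μ := by
    have hm : MeasurableSet (Metric.closedBall (0 : E) (1 - s)) :=
      Metric.isClosed_closedBall.measurableSet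
    have hA0 := h.shape_near 0 (h.subset h.zero_mem) (by simp)
    have hpt0 : ∀ z, (Metric.closedBall (0 : E) (1 - s)).indicator (fun _ : E => s ^ 4) z ≤
        ellBump (A 0) 0 z ^ 4 := by
      intro z
      by_cases hz : z ∈ Metric.closedBall (0 : E) (1 - s)
      · rw [Set.indicator_of_mem hz]
        rw [mem_closedBall_zero_iff] at hz
        have : s ≤ ellBump (A 0) 0 z := by
          rw [ellBump, h.shape_zero]
          refine le_max_of_le_right ?_
          simp only [sub_zero, one_apply_eq_self]
          nlinarith [norm_nonneg z]
        gcongr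
      · rw [Set.indicator_of_notMem hz]
        exact pow_nonneg (ellBump_nonneg _ _ _) _
    have := integral_mono (((integrable_const (s ^ 4)).indicator hm : Integrable _ μ))
      (integrable_ellBump_pow hA0 hε2 0 μ 4 (by norm_num)) hpt0
    rw [integral_indicator hm, setIntegral_const, smul_eq_mul] at this
    linarith
  have hσ2 : 0 < σ ^ 2 := by positivity
  rw [div_mul_eq_mul_div, le_div_iff₀ (by positivity)]
  have h24 : s ^ 4 * μ.real (Metric.closedBall 0 (1 - s)) ≤ 2 * ∫ z, ellBump (A b) b z ^ 2 ∂μ := by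
    linarith
  nlinarith [mul_le_mul_of_nonneg_left h24 hσ2.le]

end Doubling

/-- The function t ↦ max 0 t ^ 3 has a locally Lipschitz derivative, whence a quadratic Taylor
remainder even across 0. -/
theorem abs_max_zero_cube_sub_le (a b : ℝ) :
    |max 0 b ^ 3 - max 0 a ^ 3 - 3 * max 0 a ^ 2 * (b - a)| ≤
      3 * (|a| + |b|) * (b - a) ^ 2 := by
  rcases le_total a 0 with ha | ha <;> rcases le_total b 0 with hb | hb
  · rw [max_eq_left ha, max_eq_left hb]
    simp only [ne_eq, OfNat.ofNat_ne_zero, not_false_eq_true, zero_pow, sub_self, mul_zero,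
      zero_mul, abs_zero]
    positivity
  · rw [max_eq_left ha, max_eq_right hb, abs_of_nonpos ha, abs_of_nonneg hb]
    have h1 : b ^ 2 ≤ (b - a) ^ 2 := by nlinarith
    have h2 : 0 ≤ b ^ 3 := by positivity
    simp only [ne_eq, OfNat.ofNat_ne_zero, not_false_eq_true, zero_pow, sub_zero, mul_zero,
      zero_mul]
    rw [abs_of_nonneg h2]
    nlinarith [mul_le_mul_of_nonneg_left h1 hb, mul_nonneg (neg_nonneg.2 ha) (sq_nonneg (b - a)),
      mul_nonneg hb (sq_nonneg (b - a))]
  · rw [max_eq_right ha, max_eq_left hb, abs_of_nonneg ha, abs_of_nonpos hb]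
    have h1 : a ^ 2 ≤ (b - a) ^ 2 := by nlinarith
    have h2 : (0 : ℝ) ^ 3 - a ^ 3 - 3 * a ^ 2 * (b - a) = a ^ 2 * (2 * a + 3 * -b) := by ring
    rw [h2, abs_of_nonneg (mul_nonneg (sq_nonneg a) (by linarith))]
    calc a ^ 2 * (2 * a + 3 * -b) ≤ (b - a) ^ 2 * (3 * (a + -b)) := by
          apply mul_le_mul h1 (by linarith) (by linarith) (sq_nonneg _)
      _ = _ := by ring
  · rw [max_eq_right ha, max_eq_right hb, abs_of_nonneg ha, abs_of_nonneg hb]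
    have h2 : b ^ 3 - a ^ 3 - 3 * a ^ 2 * (b - a) = (b - a) ^ 2 * (b + 2 * a) := by ring
    rw [h2, abs_of_nonneg (mul_nonneg (sq_nonneg _) (by linarith))]
    nlinarith [mul_nonneg ha (sq_nonneg (b - a)), mul_nonneg hb (sq_nonneg (b - a))]

/-! ### First-order expansion of the symmetry relation in the centre. -/

section Taylor
variable {E : Type*} [NormedAddCommGroup E] [InnerProductSpace ℝ E]

theorem ellBump_eq_zero_of_two_le {ε : ℝ} {A : E →L[ℝ] E} (hA : ‖A - 1‖ ≤ ε) (hε : ε ≤ 1 / 4)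
    {x : E} (hx : ‖x‖ ≤ 1 / 2) {z : E} (hz : z ∉ Metric.closedBall (0 : E) 2) :
    ellBump A x z = 0 := by
  rw [mem_closedBall_zero_iff, not_le] at hz
  by_contra hne
  have h2 := (norm_lt_two_of_ellBump_ne_zero hA (by linarith) hne).1
  have h3 := (abs_le.1 (abs_norm_apply_sub_norm_le hA (z - x))).1
  have h4 := norm_sub_norm_le z x
  nlinarith

-- At x = 0 with round shape, the derivative of p_x(z)³ (z - x) in x is -p³ x + 6 p² ⟨z, x⟩ z; its
-- integral is minus the inertia map. The quadratic remainder and the change of shape are bounded on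
-- B(0, 2), outside of which both bumps vanish.
set_option maxHeartbeats 1000000 in
theorem norm_taylor_ellBump_le {ε : ℝ} {A : E →L[ℝ] E} (hA : ‖A - 1‖ ≤ ε) (hε : ε ≤ 1 / 4)
    {x : E} (hx : ‖x‖ ≤ 1 / 2) (z : E) :
    ‖ellBump A x z ^ 3 • (z - x) - ellBump 1 0 z ^ 3 • z + ellBump 1 0 z ^ 3 • x -
      (6 * ellBump 1 0 z ^ 2 * inner ℝ z x) • z‖ ≤
      (Metric.closedBall 0 2).indicator (fun _ => 50000 * (‖x‖ ^ 2 + ε)) z := by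
  have hε0 : 0 ≤ ε := (norm_nonneg _).trans hA
  have hε2 : ε ≤ 1 / 2 := by linarith
  have h10 : ‖(1 : E →L[ℝ] E) - 1‖ ≤ 0 := by simp
  by_cases hz : z ∈ Metric.closedBall (0 : E) 2
  swap
  · rw [Set.indicator_of_notMem hz]
    have h1 : ellBump A x z = 0 := ellBump_eq_zero_of_two_le hA hε hx hz
    have h2 : ellBump (1 : E →L[ℝ] E) 0 z = 0 :=
      ellBump_eq_zero_of_two_le h10 (by norm_num) (by simp) hz
    simp [h1, h2]
  rw [Set.indicator_of_mem hz]
  rw [mem_closedBall_zero_iff] at hz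
  set a := 1 - ‖z‖ ^ 2 with ha
  set b := 1 - ‖A (z - x)‖ ^ 2 with hb
  have hpa : ellBump (1 : E →L[ℝ] E) 0 z = max 0 a := by simp [ellBump, ha]
  have hpb : ellBump A x z = max 0 b := rfl
  have hp0 : 0 ≤ ellBump (1 : E →L[ℝ] E) 0 z := ellBump_nonneg _ _ _
  have hp1 : ellBump (1 : E →L[ℝ] E) 0 z ≤ 1 := ellBump_le_one _ _ _
  have hzx : ‖z - x‖ ≤ 5 / 2 := (norm_sub_le z x).trans (by linarith)
  have hzx2 : ‖z - x‖ ^ 2 ≤ 25 / 4 := by nlinarith [norm_nonneg (z - x)]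
  have hin : |inner ℝ z x| ≤ 2 * ‖x‖ := (abs_real_inner_le_norm z x).trans (by gcongr)
  have hsq := abs_norm_apply_sq_sub_le hA (by linarith) (z - x)
  have hexp : ‖z - x‖ ^ 2 = ‖z‖ ^ 2 - 2 * inner ℝ z x + ‖x‖ ^ 2 := norm_sub_sq_real z x
  have h3 : 3 * ε * ‖z - x‖ ^ 2 ≤ 20 * ε := by nlinarith
  have hh : |(b - a) - 2 * inner ℝ z x| ≤ ‖x‖ ^ 2 + 20 * ε := by
    rw [abs_le] at hsq ⊢
    constructor <;> nlinarith [sq_nonneg ‖x‖]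
  have hh2 : |b - a| ≤ 5 * ‖x‖ + 20 * ε := by
    have e1 : |b - a| ≤ |(b - a) - 2 * inner ℝ z x| + |2 * inner ℝ z x| := by
      have := abs_add_le ((b - a) - 2 * inner ℝ z x) (2 * inner ℝ z x)
      simpa using this
    rw [abs_mul, abs_two] at e1
    nlinarith [norm_nonneg x]
  have hh3 : (b - a) ^ 2 ≤ 50 * ‖x‖ ^ 2 + 200 * ε := by
    rw [← sq_abs]
    have : |b - a| ^ 2 ≤ (5 * ‖x‖ + 20 * ε) ^ 2 := by gcongr
    nlinarith [sq_nonneg (5 * ‖x‖ - 20 * ε)]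
  have ha3 : |a| ≤ 3 := by
    rw [abs_le]; constructor <;> nlinarith [norm_nonneg z]
  have hb3 : |b| ≤ 11 := by
    rw [abs_le]; rw [abs_le] at hsq; constructor <;> nlinarith [sq_nonneg ‖A (z - x)‖]
  have hcube := abs_max_zero_cube_sub_le a b
  have hr : |max 0 b ^ 3 - max 0 a ^ 3 - 3 * max 0 a ^ 2 * (b - a)| ≤
      2100 * ‖x‖ ^ 2 + 8400 * ε := by
    refine hcube.trans ?_
    calc 3 * (|a| + |b|) * (b - a) ^ 2 ≤ 3 * (3 + 11) * (50 * ‖x‖ ^ 2 + 200 * ε) := by gcongr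
      _ = _ := by ring
  rw [hpa, hpb] at *
  have hdecomp : max 0 b ^ 3 • (z - x) - max 0 a ^ 3 • z + max 0 a ^ 3 • x -
      (6 * max 0 a ^ 2 * inner ℝ z x) • z =
      (max 0 b ^ 3 - max 0 a ^ 3 - 3 * max 0 a ^ 2 * (b - a)) • (z - x) +
      (3 * max 0 a ^ 2 * ((b - a) - 2 * inner ℝ z x)) • (z - x) -
      (6 * max 0 a ^ 2 * inner ℝ z x) • x := by
    module
  rw [hdecomp]
  have hq : max 0 a ^ 2 ≤ 1 := pow_le_one₀ hp0 hp1
  have hq0 : 0 ≤ max 0 a ^ 2 := by positivity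
  have n1 : ‖(max 0 b ^ 3 - max 0 a ^ 3 - 3 * max 0 a ^ 2 * (b - a)) • (z - x)‖ ≤
      (2100 * ‖x‖ ^ 2 + 8400 * ε) * (5 / 2) := by
    rw [norm_smul, Real.norm_eq_abs]; gcongr
  have n2 : ‖(3 * max 0 a ^ 2 * ((b - a) - 2 * inner ℝ z x)) • (z - x)‖ ≤
      3 * 1 * (‖x‖ ^ 2 + 20 * ε) * (5 / 2) := by
    rw [norm_smul, Real.norm_eq_abs, abs_mul, abs_of_nonneg (by positivity : 0 ≤ 3 * max 0 a ^ 2)]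
    gcongr
  have n3 : ‖(6 * max 0 a ^ 2 * inner ℝ z x) • x‖ ≤ 6 * 1 * (2 * ‖x‖) * ‖x‖ := by
    rw [norm_smul, Real.norm_eq_abs, abs_mul, abs_of_nonneg (by positivity : 0 ≤ 6 * max 0 a ^ 2)]
    gcongr
  refine (norm_sub_le _ _).trans ((add_le_add_left (norm_add_le _ _) _).trans ?_)
  nlinarith [sq_nonneg ‖x‖]

end Taylor

/-! ### The inertia map and flatness at a smaller scale. -/

section Flat
variable {E : Type*} [NormedAddCommGroup E] [InnerProductSpace ℝ E]
  [FiniteDimensional ℝ E] [MeasurableSpace E] [BorelSpace E]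

theorem integrable_inertia (μ : Measure E) [IsFiniteMeasure μ] (x : E) :
    Integrable (fun z => ellBump 1 0 z ^ 3 • x - (6 * ellBump 1 0 z ^ 2 * inner ℝ z x) • z) μ := by
  have h10 : ‖(1 : E →L[ℝ] E) - 1‖ ≤ 0 := by simp
  have h2 := (integrable_ellBump_pow_smul h10 (by norm_num) 0 μ 2 (by norm_num)
    (g := fun z => (6 * inner ℝ z x) • z) (by fun_prop))
  refine (integrable_ellBump_pow_smul h10 (by norm_num) 0 μ 3 (by norm_num)
    (g := fun _ => x) (by fun_prop)).sub (h2.congr (Eventually.of_forall fun z => ?_))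
  simp only [smul_smul]
  congr 1
  ring

/-- The linear map `x ↦ (∫ p³) x - 6 ∫ p² ⟨z, x⟩ z` for the round bump `p` at the origin. -/
noncomputable def inertia (μ : Measure E) [IsFiniteMeasure μ] : E →ₗ[ℝ] E where
  toFun x := ∫ z, (ellBump 1 0 z ^ 3 • x - (6 * ellBump 1 0 z ^ 2 * inner ℝ z x) • z) ∂μ
  map_add' x y := by
    rw [← integral_add (integrable_inertia μ x) (integrable_inertia μ y)]
    refine integral_congr_ae (Eventually.of_forall fun z => ?_)
    simp only [inner_add_right]
    module
  map_smul' c x := by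
    rw [← integral_smul]
    refine integral_congr_ae (Eventually.of_forall fun z => ?_)
    simp only [inner_smul_right, RingHom.id_apply]
    module

theorem inertia_apply (μ : Measure E) [IsFiniteMeasure μ] (x : E) : inertia μ x =
    ∫ z, (ellBump 1 0 z ^ 3 • x - (6 * ellBump 1 0 z ^ 2 * inner ℝ z x) • z) ∂μ := rfl

theorem inner_inertia_self (μ : Measure E) [IsFiniteMeasure μ] {e : E} (he : ‖e‖ = 1) :
    inner ℝ e (inertia μ e) = ∫ z, ellBump (1 : E →L[ℝ] E) 0 z ^ 3 ∂μ -
      6 * ∫ z, ellBump (1 : E →L[ℝ] E) 0 z ^ 2 * inner ℝ z e ^ 2 ∂μ := by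
  have h10 : ‖(1 : E →L[ℝ] E) - 1‖ ≤ 0 := by simp
  have i3 := integrable_ellBump_pow h10 (by norm_num) 0 μ 3 (by norm_num)
  have i2 := integrable_ellBump_pow_mul h10 (by norm_num) 0 μ 2 (by norm_num)
    (g := fun z => inner ℝ z e ^ 2) (by fun_prop)
  rw [inertia_apply, ← integral_inner (integrable_inertia μ e), ← integral_const_mul,
    ← integral_sub i3 (i2.const_mul 6)]
  refine integral_congr_ae (Eventually.of_forall fun z => ?_)
  simp only [inner_sub_right, inner_smul_right, real_inner_self_eq_norm_sq, he,
    real_inner_comm z e]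
  ring

theorem integral_ellBump_pow_four_le {ε : ℝ} {A : E →L[ℝ] E} (hA : ‖A - 1‖ ≤ ε) (hε : ε ≤ 1 / 4)
    {x : E} (hx : ‖x‖ ≤ 1 / 2) (μ : Measure E) [IsFiniteMeasure μ] :
    ∫ z, ellBump A x z ^ 4 ∂μ ≤ μ.real (Metric.closedBall 0 2) := by
  have hm : MeasurableSet (Metric.closedBall (0 : E) 2) := Metric.isClosed_closedBall.measurableSet
  have hpt : ∀ z, ellBump A x z ^ 4 ≤ (Metric.closedBall (0 : E) 2).indicator 1 z := by
    intro z
    by_cases hz : z ∈ Metric.closedBall (0 : E) 2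
    · rw [Set.indicator_of_mem hz]
      exact pow_le_one₀ (ellBump_nonneg _ _ _) (ellBump_le_one _ _ _)
    · rw [Set.indicator_of_notMem hz, ellBump_eq_zero_of_two_le hA hε hx hz]
      norm_num
  have := integral_mono (integrable_ellBump_pow hA (by linarith) x μ 4 (by norm_num))
    ((integrable_const (1 : ℝ)).indicator hm : Integrable _ μ) hpt
  rwa [integral_indicator hm, setIntegral_const, smul_eq_mul, mul_one] at this

/-- Both x and 0 are approximate centres, so the difference of their symmetry integrals is O(ε)
times the mass; its first-order part is minus the inertia map at x. -/
theorem norm_inertia_le {ε : ℝ} {μ : Measure E} [IsFiniteMeasure μ]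
    {F F' : Set E} {A : E → E →L[ℝ] E} (h : UnitScale ε μ F F' A) (hε : ε ≤ 1 / 4) {x : E}
    (hx : x ∈ F) (hx1 : ‖x‖ ≤ 1 / 2) :
    ‖inertia μ x‖ ≤ (50000 * (‖x‖ ^ 2 + ε) + 2 * ε) * μ.real (Metric.closedBall 0 2) := by
  have h10 : ‖(1 : E →L[ℝ] E) - 1‖ ≤ 0 := by simp
  have hA := h.shape_near x hx (by linarith)
  have hε0 : 0 ≤ ε := (norm_nonneg _).trans hA
  have hm : MeasurableSet (Metric.closedBall (0 : E) 2) := Metric.isClosed_closedBall.measurableSet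
  have i1 := integrable_ellBump_pow_smul hA (by linarith) x μ 3 (by norm_num)
    (g := fun z => z - x) (by fun_prop)
  have i0 := integrable_ellBump_pow_smul h10 (by norm_num) 0 μ 3 (by norm_num)
    (g := fun z : E => z) (by fun_prop)
  have i10 : Integrable (fun z => ellBump (A x) x z ^ 3 • (z - x) - ellBump 1 0 z ^ 3 • z) μ :=
    i1.sub i0
  have c1 := h.center x hx (by linarith) 3 (Or.inr rfl)
  have c0 := h.center 0 (h.subset h.zero_mem) (by simp) 3 (Or.inr rfl)
  simp only [h.shape_zero, sub_zero] at c0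
  have g1 := integral_ellBump_pow_four_le hA hε hx1 μ
  have g0 := integral_ellBump_pow_four_le h10 (by norm_num) (x := (0 : E)) (by simp) μ
  have ht : ‖(∫ z, ellBump (A x) x z ^ 3 • (z - x) ∂μ) - (∫ z, ellBump 1 0 z ^ 3 • z ∂μ) +
      inertia μ x‖ ≤ 50000 * (‖x‖ ^ 2 + ε) * μ.real (Metric.closedBall 0 2) := by
    rw [inertia_apply, ← integral_sub i1 i0, ← integral_add i10 (integrable_inertia μ x)]
    refine (norm_integral_le_of_norm_le
      ((integrable_const (50000 * (‖x‖ ^ 2 + ε))).indicator hm : Integrable _ μ)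
      (Eventually.of_forall fun z => ?_)).trans_eq ?_
    · rw [← add_sub_assoc]
      exact norm_taylor_ellBump_le hA hε hx1 z
    · rw [integral_indicator hm, setIntegral_const, smul_eq_mul, mul_comm]
  set I1 := ∫ z, ellBump (A x) x z ^ 3 • (z - x) ∂μ
  set I0 := ∫ z, ellBump 1 0 z ^ 3 • z ∂μ
  have e : inertia μ x = (I1 - I0 + inertia μ x) - I1 + I0 := by abel
  have n : ‖inertia μ x‖ ≤ ‖I1 - I0 + inertia μ x‖ + ‖I1‖ + ‖I0‖ := by
    calc ‖inertia μ x‖ = ‖(I1 - I0 + inertia μ x) - I1 + I0‖ := by rw [← e]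
      _ ≤ ‖(I1 - I0 + inertia μ x) - I1‖ + ‖I0‖ := norm_add_le _ _
      _ ≤ _ := by gcongr; exact norm_sub_le _ _
  nlinarith [mul_le_mul_of_nonneg_left g1 hε0, mul_le_mul_of_nonneg_left g0 hε0]

theorem integral_sq_mul_inner_sq_le {ε θ : ℝ} {μ : Measure E} [IsFiniteMeasure μ]
    {F F' : Set E} {A : E → E →L[ℝ] E} (h : UnitScale ε μ F F' A) 
    (W : Submodule ℝ E) (hW : NearSubspace W θ (F ∩ Metric.closedBall 0 2))
    {e : E} (he : ‖e‖ = 1) (heW : e ∈ Wᗮ) :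
    ∫ z, ellBump (1 : E →L[ℝ] E) 0 z ^ 2 * inner ℝ z e ^ 2 ∂μ ≤
      (θ ^ 2 + ε) * μ.real (Metric.closedBall 0 2) := by
  have h10 : ‖(1 : E →L[ℝ] E) - 1‖ ≤ 0 := by simp
  have hA := h.shape_near 0 (h.subset h.zero_mem) (by simp)
  have hε0 : 0 ≤ ε := (norm_nonneg _).trans hA
  set B : Set E := Metric.closedBall 0 1 with hB
  have hBm : MeasurableSet B := Metric.isClosed_closedBall.measurableSet
  set V : Set E := {z | θ < ‖z - W.starProjection z‖} ∩ B with hV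
  have hVm : MeasurableSet V :=
    (isOpen_lt continuous_const (by fun_prop)).measurableSet.inter hBm
  have hdisj : Disjoint V F := by
    rw [Set.disjoint_left]
    rintro z ⟨hz1, hz2⟩ hzF
    rw [hB, mem_closedBall_zero_iff] at hz2
    obtain ⟨w, hw, hzw⟩ := hW z ⟨hzF, by rw [mem_closedBall_zero_iff]; linarith⟩
    have := norm_sub_starProjection_le W z hw
    have hz1 : θ < ‖z - W.starProjection z‖ := hz1
    linarith
  have hell : ellipsoid (A 0) 0 1 = B := by
    ext z
    simp [ellipsoid, h.shape_zero, hB]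
  have hd := h.dense 0 h.zero_mem (by simp) 1 (by norm_num) le_rfl V hVm hdisj
  rw [hell, Set.inter_eq_left.2 Set.inter_subset_right] at hd
  have hBG : μ.real B ≤ μ.real (Metric.closedBall 0 2) :=
    measureReal_mono (Metric.closedBall_subset_closedBall (by norm_num))
  have hpt : ∀ z, ellBump (1 : E →L[ℝ] E) 0 z ^ 2 * inner ℝ z e ^ 2 ≤
      B.indicator (fun _ => θ ^ 2) z + V.indicator (fun _ => (1 : ℝ)) z := by
    intro z
    have hp0 := ellBump_nonneg (1 : E →L[ℝ] E) 0 z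
    have hp2 : ellBump (1 : E →L[ℝ] E) 0 z ^ 2 ≤ 1 := pow_le_one₀ hp0 (ellBump_le_one _ _ _)
    by_cases hzB : z ∈ B
    · rw [Set.indicator_of_mem hzB]
      by_cases hzV : z ∈ V
      · rw [Set.indicator_of_mem hzV]
        rw [hB, mem_closedBall_zero_iff] at hzB
        have h1 : |inner ℝ z e| ≤ 1 := (abs_real_inner_le_norm z e).trans (by rw [he]; linarith)
        have h2 : inner ℝ z e ^ 2 ≤ 1 := (sq_le_one_iff_abs_le_one _).2 h1
        nlinarith [sq_nonneg (inner ℝ z e : ℝ), sq_nonneg θ]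
      · rw [Set.indicator_of_notMem hzV, add_zero]
        have h3 : ‖z - W.starProjection z‖ ≤ θ := by
          by_contra hc
          exact hzV ⟨not_le.1 hc, hzB⟩
        have h4 : (inner ℝ z e : ℝ) = inner ℝ (z - W.starProjection z) e := by
          have : (inner ℝ (W.starProjection z) e : ℝ) = 0 :=
            (Submodule.mem_orthogonal W e).1 heW _ (W.starProjection_apply_mem z)
          rw [inner_sub_left, this, sub_zero]
        have h5 : |inner ℝ z e| ≤ θ := by
          rw [h4]
          exact (abs_real_inner_le_norm _ e).trans (by rw [he]; linarith)
        have h6 : inner ℝ z e ^ 2 ≤ θ ^ 2 := by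
          rw [← sq_abs (inner ℝ z e : ℝ)]; gcongr
        nlinarith [sq_nonneg (inner ℝ z e : ℝ)]
    · have hz : ellBump (1 : E →L[ℝ] E) 0 z = 0 := by
        by_contra hne
        apply hzB
        have := (norm_lt_two_of_ellBump_ne_zero h10 (by norm_num) hne).1
        rw [hB, mem_closedBall_zero_iff]
        simpa using this.le
      rw [hz]
      simp only [ne_eq, OfNat.ofNat_ne_zero, not_false_eq_true, zero_pow, zero_mul]
      exact add_nonneg (Set.indicator_nonneg (fun _ _ => sq_nonneg _) _)
        (Set.indicator_nonneg (fun _ _ => zero_le_one) _)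
  have iB : Integrable (B.indicator (fun _ => θ ^ 2)) μ := (integrable_const _).indicator hBm
  have iV : Integrable (V.indicator (fun _ => (1 : ℝ))) μ := (integrable_const _).indicator hVm
  have i2 := integrable_ellBump_pow_mul h10 (by norm_num) 0 μ 2 (by norm_num)
    (g := fun z => inner ℝ z e ^ 2) (by fun_prop)
  have hI := integral_mono i2 (iB.add iV) hpt
  simp only [Pi.add_apply] at hI
  rw [integral_add iB iV, integral_indicator hBm, integral_indicator hVm, setIntegral_const,
    setIntegral_const, smul_eq_mul, smul_eq_mul, mul_one] at hI
  nlinarith [mul_le_mul_of_nonneg_left hBG hε0, mul_le_mul_of_nonneg_left hBG (sq_nonneg θ)]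

/-- If the centres are close to a `k`-dimensional subspace and the measure is doubling, then
the centres are close to a `k`-dimensional subspace at a smaller scale, with any prescribed relative
precision. -/
theorem exists_near_subspace_of_doubling (C₁ θ θ' : ℝ) (hC : 0 < C₁)
    (hθ : 24 * C₁ * θ ^ 2 ≤ 1) (hθ' : 0 < θ') (k : ℕ) :
    ∃ κ ε : ℝ, 0 < κ ∧ κ ≤ 1 / 2 ∧ 0 < ε ∧
      ∀ (μ : Measure E) [IsFiniteMeasure μ]
      (F F' : Set E) (A : E → E →L[ℝ] E), UnitScale ε μ F F' A →
      ∀ W : Submodule ℝ E, Module.finrank ℝ W ≤ k →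
        NearSubspace W θ (F ∩ Metric.closedBall 0 2) →
        μ.real (Metric.closedBall 0 2) ≤ C₁ * ∫ z, ellBump (A 0) 0 z ^ 3 ∂μ →
        ∃ W' : Submodule ℝ E, Module.finrank ℝ W' ≤ k ∧
          NearSubspace W' (θ' * κ) (F ∩ Metric.closedBall 0 κ) := by
  obtain ⟨K, hK, hgs⟩ := exists_subspace_seminorm_le (E := E) θ' hθ' (k + 1)
  obtain ⟨κ, hκ, hκ2, hκK⟩ : ∃ κ : ℝ, 0 < κ ∧ κ ≤ 1 / 2 ∧ C₁ * (K * (120000 * κ)) ≤ 1 / 4 := by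
    refine ⟨min (1 / 2) (1 / (480000 * C₁ * K)), by positivity, min_le_left _ _, ?_⟩
    have := min_le_right (1 / 2) (1 / (480000 * C₁ * K))
    rw [le_div_iff₀ (by positivity)] at this
    linarith
  refine ⟨κ, min (κ ^ 2) (min (1 / 4) (1 / (25 * C₁))), hκ, hκ2, by positivity,
    fun μ _ F F' A h W hW hflat hdoub => ?_⟩
  set ε := min (κ ^ 2) (min (1 / 4) (1 / (25 * C₁))) with hε
  have hε1 : ε ≤ κ ^ 2 := min_le_left _ _
  have hε2 : ε ≤ 1 / 4 := (min_le_right _ _).trans (min_le_left _ _)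
  have hε3 : ε ≤ 1 / (25 * C₁) := (min_le_right _ _).trans (min_le_right _ _)
  rw [le_div_iff₀ (by positivity)] at hε3
  have hε0 : 0 ≤ ε := by positivity
  set G := μ.real (Metric.closedBall 0 2) with hG
  have h10 : ‖(1 : E →L[ℝ] E) - 1‖ ≤ 0 := by simp
  have hGpos : 0 < G := by
    have h1 := h.pos 0 (h.subset h.zero_mem) (by simp)
    rw [h.shape_zero] at h1
    exact h1.trans_le (integral_ellBump_pow_four_le h10 (by norm_num) (by simp) μ)
  by_contra hno
  push Not at hno
  -- If F were not k-flat at scale κ, its points would quantitatively span a subspace X of dimension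
  -- k + 1 on which the inertia map is O(κ) G. But X contains a unit vector e orthogonal to W, and
  -- ⟨e, inertia e⟩ ≥ ∫ p³ - 6(θ² + ε) G because the mass is near W; doubling makes this too large.
  obtain ⟨X, hX, hXN⟩ := hgs ((fun y => κ • y) ⁻¹' (F ∩ Metric.closedBall 0 κ)) (by
    intro y hy
    have := hy.2
    simp only [mem_closedBall_zero_iff, norm_smul, Real.norm_eq_abs, abs_of_pos hκ] at this ⊢
    nlinarith) (by
    intro L hL hnear
    refine hno L (by omega) (fun x hx => ?_)
    obtain ⟨w, hw, hxw⟩ := hnear (κ⁻¹ • x) (by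
      simp only [Set.mem_preimage, smul_smul, mul_inv_cancel₀ hκ.ne', one_smul]
      exact hx)
    refine ⟨κ • w, L.smul_mem _ hw, ?_⟩
    have : x - κ • w = κ • (κ⁻¹ • x - w) := by
      rw [smul_sub, smul_smul, mul_inv_cancel₀ hκ.ne', one_smul]
    rw [this, norm_smul, Real.norm_eq_abs, abs_of_pos hκ, mul_comm]
    gcongr)
  obtain ⟨e, heX, heW, he⟩ := exists_unit_mem_orthogonal X W (by omega)
  have hLe := hXN ((normSeminorm ℝ E).comp (inertia μ)) (120000 * κ * G) (by positivity) (by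
    intro y hy
    have hxF : κ • y ∈ F := hy.1
    have hxn : ‖κ • y‖ ≤ κ := by simpa using hy.2
    have h1 := norm_inertia_le h hε2 hxF (by linarith)
    have h2 : ‖κ • y‖ ^ 2 ≤ κ ^ 2 := by gcongr
    rw [map_smul, norm_smul, Real.norm_eq_abs, abs_of_pos hκ] at h1
    rw [Seminorm.comp_apply, coe_normSeminorm]
    have h3 : (50000 * (‖κ • y‖ ^ 2 + ε) + 2 * ε) * G ≤ κ * (120000 * κ * G) := by
      have : 50000 * (‖κ • y‖ ^ 2 + ε) + 2 * ε ≤ 120000 * κ ^ 2 := by linarith [sq_nonneg κ]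
      nlinarith
    exact le_of_mul_le_mul_left (h1.trans h3) hκ) e heX
  rw [Seminorm.comp_apply, coe_normSeminorm, he, mul_one] at hLe
  have h1 := inner_inertia_self μ he
  have h2 := integral_sq_mul_inner_sq_le h W hflat he heW
  have h3 : inner ℝ e (inertia μ e) ≤ ‖inertia μ e‖ := by
    simpa [he] using real_inner_le_norm e (inertia μ e)
  rw [h.shape_zero] at hdoub
  set A3 := ∫ z, ellBump (1 : E →L[ℝ] E) 0 z ^ 3 ∂μ
  have h4 : A3 ≤ K * (120000 * κ * G) + 6 * ((θ ^ 2 + ε) * G) := by linarith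
  have h5 : G ≤ C₁ * (K * (120000 * κ * G) + 6 * ((θ ^ 2 + ε) * G)) :=
    hdoub.trans (by gcongr)
  have h6 : C₁ * (K * (120000 * κ * G) + 6 * ((θ ^ 2 + ε) * G)) =
      (C₁ * (K * (120000 * κ)) + 6 * C₁ * θ ^ 2 + 6 * (C₁ * ε)) * G := by ring
  rw [h6] at h5
  have h7 : C₁ * (K * (120000 * κ)) + 6 * C₁ * θ ^ 2 + 6 * (C₁ * ε) ≤ 3 / 4 := by linarith
  nlinarith

end Flat

/-! ### Passing between unit scale and scale r. -/

section Rescaling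
variable {E : Type*} [NormedAddCommGroup E] [InnerProductSpace ℝ E]

theorem nearSubspace_dilation_iff {r : ℝ} (hr : 0 < r) (L : Submodule ℝ E) (τ ρ : ℝ) (F : Set E) :
    NearSubspace L τ ({b | r • b ∈ F} ∩ Metric.closedBall 0 ρ) ↔
      NearSubspace L (τ * r) (F ∩ Metric.closedBall 0 (ρ * r)) := by
  constructor
  · rintro h x ⟨hxF, hx⟩
    have hrx : r • r⁻¹ • x = x := by rw [smul_smul, mul_inv_cancel₀ hr.ne', one_smul]
    obtain ⟨w, hw, hxw⟩ := h (r⁻¹ • x) ⟨by simpa only [Set.mem_ofPred_eq, hrx] using hxF, by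
      rw [mem_closedBall_zero_iff] at hx ⊢
      rw [norm_smul, norm_inv, Real.norm_eq_abs, abs_of_pos hr, inv_mul_le_iff₀ hr]
      linarith⟩
    refine ⟨r • w, L.smul_mem _ hw, ?_⟩
    have : x - r • w = r • (r⁻¹ • x - w) := by rw [smul_sub, hrx]
    rw [this, norm_smul, Real.norm_eq_abs, abs_of_pos hr, mul_comm]
    gcongr
  · rintro h x ⟨hxF, hx⟩
    obtain ⟨w, hw, hxw⟩ := h (r • x) ⟨hxF, by
      rw [mem_closedBall_zero_iff] at hx ⊢
      rw [norm_smul, Real.norm_eq_abs, abs_of_pos hr, mul_comm]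
      gcongr⟩
    refine ⟨r⁻¹ • w, L.smul_mem _ hw, ?_⟩
    have : x - r⁻¹ • w = r⁻¹ • (r • x - w) := by
      rw [smul_sub, smul_smul, inv_mul_cancel₀ hr.ne', one_smul]
    rw [this, norm_smul, norm_inv, Real.norm_eq_abs, abs_of_pos hr, inv_mul_le_iff₀ hr]
    linarith

theorem NearSubspace.mono {L : Submodule ℝ E} {τ τ' : ℝ} {S S' : Set E}
    (h : NearSubspace L τ S) (hτ : τ ≤ τ') (hS : S' ⊆ S) : NearSubspace L τ' S' := fun x hx =>
  let ⟨w, hw, hxw⟩ := h x (hS hx)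
  ⟨w, hw, hxw.trans hτ⟩

theorem measureReal_map_dilation_closedBall [MeasurableSpace E] [BorelSpace E] {r : ℝ}
    (hr : 0 < r) (μ : Measure E) (t : ℝ) :
    (μ.map (fun z => r⁻¹ • z)).real (Metric.closedBall 0 t) =
      μ.real (Metric.closedBall 0 (t * r)) := by
  rw [map_measureReal_apply (by fun_prop) Metric.isClosed_closedBall.measurableSet]
  congr 1
  ext z
  simp only [Set.mem_preimage, mem_closedBall_zero_iff, norm_smul, norm_inv, Real.norm_eq_abs,
    abs_of_pos hr]
  rw [inv_mul_le_iff₀ hr, mul_comm]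

/-- The conditions `UnitScale` after blowing up by the factor `r⁻¹`. -/
def AtScale [MeasurableSpace E] (ε : ℝ) (μ : Measure E) (F F' : Set E) (A : E → E →L[ℝ] E) (r : ℝ) : Prop :=
  UnitScale ε (μ.map (fun z => r⁻¹ • z)) {b | r • b ∈ F} {b | r • b ∈ F'} (fun b => A (r • b))

theorem AtScale.mono [MeasurableSpace E] {ε ε' : ℝ} {μ : Measure E} [IsFiniteMeasure μ] {F F' : Set E}
    {A : E → E →L[ℝ] E} {r : ℝ} (h : AtScale ε μ F F' A r) (hε : ε ≤ ε') :
    AtScale ε' μ F F' A r := UnitScale.mono h hε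

/-- Every point of `F` in the ball of radius `r` is at distance at most `θ r` from some subspace of
dimension at most `k`. -/
def FlatAt (k : ℕ) (θ : ℝ) (F : Set E) (r : ℝ) : Prop :=
  ∃ W : Submodule ℝ E, Module.finrank ℝ W ≤ k ∧ NearSubspace W (θ * r) (F ∩ Metric.closedBall 0 r)

theorem FlatAt.of_le {k : ℕ} {θ θ' : ℝ} {F : Set E} {r r' : ℝ} (h : FlatAt k θ F r)
    (hr : r' ≤ r) (hθ : θ * r ≤ θ' * r') : FlatAt k θ' F r' :=
  let ⟨W, hW, hn⟩ := h
  ⟨W, hW, hn.mono hθ (Set.inter_subset_inter_right _ (Metric.closedBall_subset_closedBall hr))⟩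

end Rescaling

/-! ### Descending through the scales: doubling at the origin. -/

section Iteration
variable {E : Type*} [NormedAddCommGroup E] [InnerProductSpace ℝ E]
  [FiniteDimensional ℝ E] [MeasurableSpace E] [BorelSpace E]

/-- If the centres are flat at the scale `8 r` and not degenerate at smaller scales then the measure
is doubling at scale `r`. -/
theorem exists_doubling_of_flatAt (τ : ℝ) (hτ : 0 < τ) (k : ℕ) :
    ∃ θ ε C : ℝ, 0 < θ ∧ 0 < ε ∧ 0 < C ∧
      ∀ (μ : Measure E) [IsFiniteMeasure μ] (F F' : Set E) (A : E → E →L[ℝ] E) (R : ℝ),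
        (∀ r, 0 < r → r < R → AtScale ε μ F F' A r) →
        (∀ r, 0 < r → r < R → ∀ L : Submodule ℝ E, Module.finrank ℝ L < k →
          ¬ NearSubspace L (τ * r) (F' ∩ Metric.closedBall 0 r)) →
        ∀ r, 0 < r → 8 * r ≤ R → FlatAt k θ F (8 * r) →
          μ.real (Metric.closedBall 0 (2 * r)) ≤ C * μ.real (Metric.closedBall 0 (r / 2)) := by
  obtain ⟨κ, θ, ε, s, C, hκ, hκ1, hθ, hε, hs, hs1, hC, hmain⟩ :=
    measure_ball_le_of_near_subspace (E := E) τ hτ k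
  set β := (1 - 2 * s) / (1 - s) with hβ
  have h1s : 0 < 1 - s := by linarith
  have hβ0 : 0 < β := div_pos (by linarith) h1s
  have hβ1 : β < 1 := (div_lt_one h1s).2 (by linarith)
  obtain ⟨p, hp⟩ := exists_pow_lt_of_lt_one (show (0 : ℝ) < 1 / 4 by norm_num) hβ1
  -- Below, the unit scale is r' ∈ [r/2, 8r/3]: the ball of radius 2r' fits in that of radius 8r,
  -- and precision (θ/16)·8r is at most θ r'. The p steps of ratio β lead from radius 2r to r/2.
  refine ⟨θ / 16, ε, max C 1 ^ p, by positivity, hε, by positivity,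
    fun μ _ F F' A R hU hrob r hr hrR ⟨W, hW, hflat⟩ => ?_⟩
  have step : ∀ t, r / 2 ≤ t → t ≤ 2 * r →
      μ.real (Metric.closedBall 0 t) ≤ C * μ.real (Metric.closedBall 0 (β * t)) := by
    intro t ht1 ht2
    set r' := t / (1 - s) with hr'
    have ht : t = (1 - s) * r' := by rw [hr']; field_simp
    have hr0 : 0 < r' := div_pos (by linarith) h1s
    have hrt : t ≤ r' := by rw [ht]; nlinarith
    have hrt2 : r' ≤ 8 / 3 * r := by nlinarith
    have hβt : β * t = (1 - 2 * s) * r' := by rw [ht, hβ]; field_simp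
    have h1 := hmain (μ.map (fun z => r'⁻¹ • z)) _ _ _ (hU r' hr0 (by linarith)) W hW
      ((nearSubspace_dilation_iff hr0 _ _ _ _).2 (hflat.mono (by nlinarith)
        (Set.inter_subset_inter_right _ (Metric.closedBall_subset_closedBall (by linarith)))))
      (fun L hL hn => by
        rw [nearSubspace_dilation_iff hr0, mul_assoc] at hn
        exact hrob (κ * r') (by positivity) (by nlinarith) L hL hn)
    rwa [measureReal_map_dilation_closedBall hr0, measureReal_map_dilation_closedBall hr0, ← hβt,
      ← ht] at h1
  have iter : ∀ i : ℕ, μ.real (Metric.closedBall 0 (2 * r)) ≤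
      max C 1 ^ i * μ.real (Metric.closedBall 0 (max (β ^ i * (2 * r)) (r / 2))) := by
    intro i
    induction i with
    | zero =>
      rw [pow_zero, one_mul, pow_zero, one_mul]
      exact measureReal_mono (Metric.closedBall_subset_closedBall (le_max_left _ _))
    | succ i ih =>
      refine ih.trans ?_
      rw [pow_succ, mul_assoc]
      gcongr
      rcases le_total (β ^ i * (2 * r)) (r / 2) with h | h
      · rw [max_eq_right h]
        have h2 : μ.real (Metric.closedBall (0 : E) (r / 2)) ≤
            μ.real (Metric.closedBall 0 (max (β ^ (i + 1) * (2 * r)) (r / 2))) :=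
          measureReal_mono (Metric.closedBall_subset_closedBall (le_max_right _ _))
        have h3 : 0 ≤ μ.real (Metric.closedBall (0 : E) (r / 2)) := measureReal_nonneg
        nlinarith [le_max_right C 1]
      · rw [max_eq_left h]
        refine (step _ h ?_).trans ?_
        · have : β ^ i ≤ 1 := pow_le_one₀ hβ0.le hβ1.le
          nlinarith
        · have h2 : μ.real (Metric.closedBall (0 : E) (β * (β ^ i * (2 * r)))) ≤
              μ.real (Metric.closedBall 0 (max (β ^ (i + 1) * (2 * r)) (r / 2))) := by
            refine measureReal_mono (Metric.closedBall_subset_closedBall ?_)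
            refine le_trans (le_of_eq ?_) (le_max_left _ _)
            ring
          gcongr
          exact le_max_left _ _
  have := iter p
  rwa [max_eq_right (a := β ^ p * (2 * r)) (by nlinarith)] at this

/-- Flatness of the centres propagates to smaller scales, and the measure is doubling. -/
theorem exists_flatAt_mul_of_flatAt (τ : ℝ) (hτ : 0 < τ) (k : ℕ) :
    ∃ θ ε C q : ℝ, 0 < θ ∧ 0 < ε ∧ 0 < C ∧ 0 < q ∧ q < 1 ∧
      ∀ (μ : Measure E) [IsFiniteMeasure μ] (F F' : Set E) (A : E → E →L[ℝ] E) (R : ℝ),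
        (∀ r, 0 < r → r < R → AtScale ε μ F F' A r) →
        (∀ r, 0 < r → r < R → ∀ L : Submodule ℝ E, Module.finrank ℝ L < k →
          ¬ NearSubspace L (τ * r) (F' ∩ Metric.closedBall 0 r)) →
        ∀ r, 0 < r → r ≤ R → FlatAt k θ F r →
          FlatAt k θ F (q * r) ∧
          μ.real (Metric.closedBall 0 (r / 4)) ≤ C * μ.real (Metric.closedBall 0 (r / 16)) := by
  obtain ⟨θ₁, ε₁, C₁, hθ₁, hε₁, hC₁, hdoub⟩ := exists_doubling_of_flatAt (E := E) τ hτ k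
  obtain ⟨θ, hθ, hθθ, hθC⟩ : ∃ θ : ℝ, 0 < θ ∧ θ ≤ θ₁ ∧ 24 * (3 * C₁) * (8 * θ) ^ 2 ≤ 1 := by
    refine ⟨min θ₁ (min 1 (1 / (4608 * C₁))), by positivity, min_le_left _ _, ?_⟩
    set θ := min θ₁ (min 1 (1 / (4608 * C₁))) with hθ
    have h1 : θ ≤ 1 := (min_le_right _ _).trans (min_le_left _ _)
    have h2 : θ ≤ 1 / (4608 * C₁) := (min_le_right _ _).trans (min_le_right _ _)
    have h0 : 0 ≤ θ := by positivity
    rw [le_div_iff₀ (by positivity)] at h2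
    nlinarith
  -- The unit scale will be r/8, where precision θ r becomes 8θ. The factor 3 comes from p³ ≥ (3/4)³
  -- ≥ 1/3 on the ball of radius 1/2.
  obtain ⟨κ, ε₂, hκ, hκ2, hε₂, hB⟩ :=
    exists_near_subspace_of_doubling (E := E) (3 * C₁) (8 * θ) θ (by positivity) hθC hθ k
  refine ⟨θ, min ε₁ ε₂, C₁, κ / 8, hθ, by positivity, hC₁, by positivity, by linarith,
    fun μ _ F F' A R hU hrob r hr hrR hflat => ?_⟩
  have hd := hdoub μ F F' A R (fun t h0 h1 => (hU t h0 h1).mono (min_le_left _ _)) hrob (r / 8)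
    (by positivity) (by linarith) (by
      rw [mul_div_cancel₀ _ (by norm_num : (8 : ℝ) ≠ 0)]
      exact hflat.of_le le_rfl (by gcongr))
  rw [show 2 * (r / 8) = r / 4 by ring, show r / 8 / 2 = r / 16 by ring] at hd
  refine ⟨?_, hd⟩
  have hr8 : 0 < r / 8 := by positivity
  obtain ⟨W, hW, hn⟩ := hflat
  have hUr : AtScale ε₂ μ F F' A (r / 8) :=
    (hU (r / 8) hr8 (by linarith)).mono (min_le_right _ _)
  obtain ⟨W', hW', hn'⟩ := hB (μ.map (fun z => (r / 8)⁻¹ • z)) _ _ _ hUr W hW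
    ((nearSubspace_dilation_iff hr8 _ _ _ _).2 (hn.mono (by linarith)
      (Set.inter_subset_inter_right _ (Metric.closedBall_subset_closedBall (by linarith))))) (by
      rw [measureReal_map_dilation_closedBall hr8, show 2 * (r / 8) = r / 4 by ring]
      have hm : MeasurableSet (Metric.closedBall (0 : E) (1 / 2)) :=
        Metric.isClosed_closedBall.measurableSet
      have h10 : ‖(1 : E →L[ℝ] E) - 1‖ ≤ 0 := by simp
      rw [hUr.shape_zero]
      have hpt : ∀ z, (Metric.closedBall (0 : E) (1 / 2)).indicator (fun _ : E => (1 / 3 : ℝ)) z ≤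
          ellBump (1 : E →L[ℝ] E) 0 z ^ 3 := by
        intro z
        by_cases hz : z ∈ Metric.closedBall (0 : E) (1 / 2)
        · rw [Set.indicator_of_mem hz]
          rw [mem_closedBall_zero_iff] at hz
          have h1 : 3 / 4 ≤ ellBump (1 : E →L[ℝ] E) 0 z := by
            refine le_max_of_le_right ?_
            simp only [sub_zero, one_apply_eq_self]
            nlinarith [norm_nonneg z]
          calc (1 / 3 : ℝ) ≤ (3 / 4) ^ 3 := by norm_num
            _ ≤ _ := by gcongr
        · rw [Set.indicator_of_notMem hz]
          exact pow_nonneg (ellBump_nonneg _ _ _) _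
      have h3 := integral_mono
        (((integrable_const (1 / 3 : ℝ)).indicator hm :
          Integrable _ (μ.map (fun z : E => (r / 8)⁻¹ • z))))
        (integrable_ellBump_pow h10 (by norm_num) 0 _ 3 (by norm_num)) hpt
      rw [integral_indicator hm, setIntegral_const, smul_eq_mul,
        measureReal_map_dilation_closedBall hr8, show 1 / 2 * (r / 8) = r / 16 by ring] at h3
      nlinarith)
  rw [nearSubspace_dilation_iff hr8] at hn'
  refine ⟨W', hW', hn'.mono (by linarith) ?_⟩
  rw [show κ / 8 * r = κ * (r / 8) by ring]

/-- Choose k minimal such that flatness in dimension at most k occurs at arbitrarily small scales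
with any precision. Minimality provides one τ for which every F j fails, at all its small scales, to
be τ-flat in a dimension below k; θ is then chosen from τ, and flatness at one scale R propagates to
all smaller ones. -/
theorem exists_measure_ball_le (μ : Measure E) [IsFiniteMeasure μ] (F : ℕ → Set E)
    (hF : Antitone F) (A : E → E →L[ℝ] E)
    (hU : ∀ ε > 0, ∃ j₀, ∀ j ≥ j₀, ∃ ρ > 0, ∀ r, 0 < r → r < ρ →
      AtScale ε μ (F j) (F (j + 1)) A r) :
    ∃ C > 0, ∃ ρ > 0, ∀ r, 0 < r → r < ρ →
      μ.real (Metric.closedBall 0 (4 * r)) ≤ C * μ.real (Metric.closedBall 0 r) := by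
  let P : ℕ → Prop := fun d => ∀ θ > 0, ∃ j, ∀ r₀ > 0, ∃ r, 0 < r ∧ r < r₀ ∧
    ∃ L : Submodule ℝ E, Module.finrank ℝ L < d ∧
      NearSubspace L (θ * r) (F j ∩ Metric.closedBall 0 r)
  have hex : ∃ d, P d := by
    refine ⟨Module.finrank ℝ E + 1, fun θ hθ => ⟨0, fun r₀ hr₀ => ⟨r₀ / 2, by positivity,
      by linarith, ⊤, by simp, fun x _ => ⟨x, trivial, ?_⟩⟩⟩⟩
    rw [sub_self, norm_zero]
    positivity
  classical
  obtain ⟨k, hk1, hk⟩ : ∃ k, P (k + 1) ∧ ¬ P k := by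
    have h1 := Nat.find_spec hex
    cases hd : Nat.find hex with
    | zero =>
      rw [hd] at h1
      obtain ⟨j, hj⟩ := h1 1 one_pos
      obtain ⟨r, _, _, L, hL, _⟩ := hj 1 one_pos
      exact absurd hL (Nat.not_lt_zero _)
    | succ k =>
      rw [hd] at h1
      exact ⟨k, h1, Nat.find_min hex (by omega)⟩
  simp only [P, not_forall, not_exists, not_and] at hk
  obtain ⟨τ, hτ, hrob⟩ := hk
  obtain ⟨θ, ε, C, q, hθ, hε, hC, hq, hq1, hmain⟩ :=
    exists_flatAt_mul_of_flatAt (E := E) τ hτ k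
  obtain ⟨j₀, hj₀⟩ := hU ε hε
  -- Precision qθ at scale R is precision at least as good as θ at every scale in [qR, R], which
  -- starts the induction in steps of ratio q.
  obtain ⟨j₁, hj₁⟩ := hk1 (q * θ) (by positivity)
  obtain ⟨ρ₁, hρ₁, hs⟩ := hj₀ (max j₀ j₁) (le_max_left _ _)
  obtain ⟨ρ₂, hρ₂, hrob₂⟩ := hrob (max j₀ j₁ + 1)
  obtain ⟨R, hR0, hR, L, hL, hn⟩ := hj₁ (min ρ₁ ρ₂) (by positivity)
  have hm := hmain μ (F (max j₀ j₁)) (F (max j₀ j₁ + 1)) A R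
    (fun r hr hrR => hs r hr ((hrR.trans hR).trans_le (min_le_left _ _)))
    (fun r hr hrR L hL => hrob₂ r hr ((hrR.trans hR).trans_le (min_le_right _ _)) L hL)
  have hbase : FlatAt k (q * θ) (F (max j₀ j₁)) R :=
    ⟨L, by omega, hn.mono le_rfl (Set.inter_subset_inter_left _ (hF (le_max_right _ _)))⟩
  have hflat : ∀ N : ℕ, ∀ t, q ^ (N + 1) * R ≤ t → t ≤ R → FlatAt k θ (F (max j₀ j₁)) t := by
    intro N
    induction N with
    | zero =>
      intro t ht1 ht2
      refine hbase.of_le ht2 ?_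
      rw [zero_add, pow_one] at ht1
      nlinarith
    | succ N ih =>
      intro t ht1 ht2
      rcases le_or_gt (q ^ (N + 1) * R) t with h | h
      · exact ih t h ht2
      · have ht0 : 0 < t := lt_of_lt_of_le (by positivity) ht1
        have hqN : q ^ (N + 1) ≤ q := by
          rw [pow_succ]
          exact mul_le_of_le_one_left hq.le (pow_le_one₀ hq.le hq1.le)
        have h1 : q ^ (N + 1) * R ≤ t / q := by
          rw [le_div_iff₀ hq]
          calc _ = q ^ (N + 1 + 1) * R := by ring
            _ ≤ t := ht1
        have h2 : t / q ≤ R := by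
          rw [div_le_iff₀ hq]
          nlinarith
        have h3 := (hm (t / q) (by positivity) h2 (ih _ h1 h2)).1
        rwa [mul_div_cancel₀ _ hq.ne'] at h3
  refine ⟨C, hC, R / 16, by positivity, fun r hr hrR => ?_⟩
  obtain ⟨N, hN⟩ := exists_pow_lt_of_lt_one (show 0 < 16 * r / R by positivity) hq1
  rw [lt_div_iff₀ hR0] at hN
  have hN1 : q ^ (N + 1) * R ≤ 16 * r := by
    have : q ^ (N + 1) ≤ q ^ N := pow_le_pow_of_le_one hq.le hq1.le (Nat.le_succ N)
    nlinarith
  have := (hm (16 * r) (by positivity) (by linarith) (hflat N _ hN1 (by linarith))).2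
  rwa [show 16 * r / 4 = 4 * r by ring, show 16 * r / 16 = r by ring] at this

end Iteration

/-! ### Radial test integrals from oscillation of truncated integrals. -/

section Radial
variable {n : ℕ}

theorem measurable_rieszKernel (m : ℕ) : Measurable (rieszKernel m : Euc n → Euc n) := by
  unfold rieszKernel; fun_prop

theorem norm_rieszKernel_le (m : ℕ) (v : Euc n) : ‖v‖ ^ m * ‖rieszKernel m v‖ ≤ 1 := by
  rw [rieszKernel, norm_smul, norm_inv, norm_pow, norm_norm]
  rcases eq_or_ne ‖v‖ 0 with h | h
  · rw [h]; simp
  · rw [pow_succ]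
    field_simp
    exact le_rfl

theorem norm_pow_smul_rieszKernel (m : ℕ) (v : Euc n) : ‖v‖ ^ (m + 1) • rieszKernel m v = v := by
  rw [rieszKernel, smul_smul]
  rcases eq_or_ne v 0 with h | h
  · simp [h]
  · rw [mul_inv_cancel₀ (by positivity), one_smul]

/-- If the truncated integrals oscillate by at most `D`, the integrals of radial test functions are
small. -/
theorem norm_setIntegral_radial_le (m : ℕ) (ν : Measure (Euc n)) [IsFiniteMeasure ν]
    {h h' : ℝ → ℝ} (hd : ∀ t, HasDerivAt h (h' t) t) (hc : Continuous h') {R : ℝ} (hR : 0 < R)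
    (hhR : h R = 0) {C : ℝ} (hC : ∀ t, 0 ≤ t → t ≤ R → |(m + 1) * h t + t * h' t| ≤ C) {D : ℝ}
    (hD : ∀ s, 0 < s → s ≤ R →
      ‖(∫ v in {v | s ≤ ‖v‖}, rieszKernel m v ∂ν) - ∫ v in {v | R ≤ ‖v‖}, rieszKernel m v ∂ν‖ ≤ D) :
    ‖∫ v in Metric.closedBall 0 R, h ‖v‖ • v ∂ν‖ ≤ C * R ^ (m + 1) * D := by
  have hch : Continuous h := continuous_iff_continuousAt.2 fun t => (hd t).continuousAt
  -- Since h(|v|) v = w(|v|) K(v) with K the kernel and w(0) = 0, it is the integral of w'(s) K(v)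
  -- over 0 < s ≤ |v|. Fubini turns ∫ h(|v|) v dν into ∫ w'(s) T(s) ds with T(s) the truncated
  -- integral.
  set w : ℝ → ℝ := fun t => t ^ (m + 1) * h t with hw
  set w' : ℝ → ℝ := fun t => t ^ m * ((m + 1) * h t + t * h' t) with hw'
  have hwd : ∀ t, HasDerivAt w (w' t) t := by
    intro t
    have := (hasDerivAt_pow (m + 1) t).mul (hd t)
    refine this.congr_deriv ?_
    simp only [hw', Nat.cast_add, Nat.cast_one, Nat.add_sub_cancel]
    ring
  have hw'c : Continuous w' := by fun_prop
  have hwint : ∀ t, 0 ≤ t → ∫ s in Set.Ioc 0 t, w' s = w t := by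
    intro t ht
    rw [← intervalIntegral.integral_of_le ht,
      intervalIntegral.integral_eq_sub_of_hasDerivAt (fun s _ => hwd s)
        (hw'c.intervalIntegrable _ _)]
    simp [hw]
  have hC0 : 0 ≤ C := (abs_nonneg _).trans (hC 0 le_rfl hR.le)
  have hw'b : ∀ s, 0 < s → s ≤ R → |w' s| ≤ C * s ^ m := by
    intro s h0 h1
    rw [hw', abs_mul, abs_of_nonneg (by positivity), mul_comm]
    gcongr
    exact hC s h0.le h1
  set S : Set (ℝ × Euc n) := {p | p.1 ≤ ‖p.2‖} with hS
  have hSm : MeasurableSet S := (isClosed_le (by fun_prop) (by fun_prop)).measurableSet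
  set G : ℝ → Euc n → Euc n := fun s v => S.indicator (fun p => w' p.1 • rieszKernel m p.2) (s, v)
    with hG
  have hGm : StronglyMeasurable (Function.uncurry G) := by
    have h1 : Measurable (fun p : ℝ × Euc n => w' p.1 • rieszKernel m p.2) :=
      (hw'c.measurable.comp measurable_fst).smul ((measurable_rieszKernel m).comp measurable_snd)
    exact (h1.indicator hSm).stronglyMeasurable
  have hGb : ∀ s, 0 < s → s ≤ R → ∀ v, ‖G s v‖ ≤ C := by
    intro s h0 h1 v
    simp only [hG]
    by_cases hv : (s, v) ∈ S
    · rw [Set.indicator_of_mem hv, norm_smul, Real.norm_eq_abs]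
      have hsv : s ≤ ‖v‖ := hv
      calc |w' s| * ‖rieszKernel m v‖ ≤ (C * s ^ m) * ‖rieszKernel m v‖ := by
            gcongr; exact hw'b s h0 h1
        _ ≤ (C * ‖v‖ ^ m) * ‖rieszKernel m v‖ := by gcongr
        _ = C * (‖v‖ ^ m * ‖rieszKernel m v‖) := by ring
        _ ≤ C * 1 := by gcongr; exact norm_rieszKernel_le m v
        _ = C := mul_one C
    · rw [Set.indicator_of_notMem hv, norm_zero]
      exact hC0
  have hGi : Integrable (Function.uncurry G) ((volume.restrict (Set.Ioc 0 R)).prod ν) := by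
    refine Integrable.of_bound hGm.aestronglyMeasurable C ?_
    have h1 : ∀ᵐ s ∂(volume.restrict (Set.Ioc (0 : ℝ) R)), 0 < s ∧ s ≤ R :=
      (ae_restrict_iff' measurableSet_Ioc).2 (Eventually.of_forall fun s hs => hs)
    have h2 := (Measure.quasiMeasurePreserving_fst (μ := volume.restrict (Set.Ioc (0 : ℝ) R))
      (ν := ν)).ae h1
    filter_upwards [h2] with p hp
    exact hGb p.1 hp.1 hp.2 p.2
  set T : ℝ → Euc n := fun s => ∫ v in {v | s ≤ ‖v‖}, rieszKernel m v ∂ν with hT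
  have hinner : ∀ s, ∫ v, G s v ∂ν = w' s • T s := by
    intro s
    have hm : MeasurableSet {v : Euc n | s ≤ ‖v‖} :=
      (isClosed_le continuous_const continuous_norm).measurableSet
    rw [hT, ← integral_smul, ← integral_indicator hm]
    rfl
  have houter : ∀ v, ∫ s in Set.Ioc 0 R, G s v =
      (Metric.closedBall (0 : Euc n) R).indicator (fun v => h ‖v‖ • v) v := by
    intro v
    have h1 : ∀ s, G s v = (Set.Iic ‖v‖).indicator w' s • rieszKernel m v := by
      intro s
      simp only [hG]
      by_cases hs : s ≤ ‖v‖
      · rw [Set.indicator_of_mem (show (s, v) ∈ S from hs), Set.indicator_of_mem (by exact hs)]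
      · rw [Set.indicator_of_notMem (show (s, v) ∉ S from hs), Set.indicator_of_notMem (by exact hs),
          zero_smul]
    simp only [h1]
    rw [integral_smul_const, setIntegral_indicator measurableSet_Iic, Set.Ioc_inter_Iic]
    by_cases hv : v ∈ Metric.closedBall (0 : Euc n) R
    · rw [Set.indicator_of_mem hv]
      rw [mem_closedBall_zero_iff] at hv
      rw [inf_eq_right.2 hv, hwint _ (norm_nonneg v), hw]
      simp only
      rw [mul_comm, mul_smul, norm_pow_smul_rieszKernel]
    · rw [Set.indicator_of_notMem hv]
      rw [mem_closedBall_zero_iff, not_le] at hv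
      rw [inf_eq_left.2 hv.le, hwint _ hR.le, hw]
      simp [hhR]
  have hball : MeasurableSet (Metric.closedBall (0 : Euc n) R) :=
    Metric.isClosed_closedBall.measurableSet
  have key : ∫ v in Metric.closedBall 0 R, h ‖v‖ • v ∂ν = ∫ s in Set.Ioc 0 R, w' s • T s := by
    rw [← integral_indicator hball]
    simp only [← houter, ← hinner]
    exact (integral_integral_swap hGi).symm
  have hi1 : IntegrableOn (fun s => w' s • T s) (Set.Ioc 0 R) := by
    have := hGi.integral_prod_left
    simpa only [Function.uncurry, hinner, IntegrableOn] using this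
  have hi2 : IntegrableOn (fun s => w' s • T R) (Set.Ioc 0 R) :=
    (hw'c.integrableOn_Ioc).smul_const _
  -- As w(R) = 0, the constant T R may be subtracted, so that only oscillation enters.
  have hz : ∫ s in Set.Ioc 0 R, w' s • T R = 0 := by
    rw [integral_smul_const, hwint R hR.le, hw]
    simp [hhR]
  rw [key, ← sub_zero (∫ s in Set.Ioc 0 R, w' s • T s), ← hz, ← integral_sub hi1 hi2]
  refine (norm_setIntegral_le_of_norm_le_const (C := C * R ^ m * D) (by simp) ?_).trans ?_
  · intro s hs
    rw [← smul_sub, norm_smul, Real.norm_eq_abs]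
    have h1 : |w' s| ≤ C * R ^ m := (hw'b s hs.1 hs.2).trans (by gcongr; exacts [hs.1.le, hs.2])
    exact mul_le_mul h1 (hD s hs.1 hs.2) (norm_nonneg _) (by positivity)
  · rw [Real.volume_real_Ioc_of_le hR.le, sub_zero, pow_succ]
    apply le_of_eq
    ring

end Radial

/-! ### Centre data and its consequences at small scales. -/

section Centers
variable {n : ℕ}

/-- The integral of the Riesz kernel outside the ellipsoid of size `s` around `b`. -/
noncomputable def ellTrunc (m : ℕ) (μ : Measure (Euc n)) (A : Euc n →L[ℝ] Euc n) (b : Euc n)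
    (s : ℝ) : Euc n :=
  ∫ z in {z | s ≤ ‖A (z - b)‖}, rieszKernel m (A (z - b)) ∂μ

/-- A nested sequence of sets of centres around the origin on which the shapes `A b` become round,
the truncated Riesz transforms oscillate less and less, the measure has a uniform lower density, and
each set is dense at the points of the next one. -/
structure CenterData (m : ℕ) (μ : Measure (Euc n)) (F : ℕ → Set (Euc n))
    (A : Euc n → Euc n →L[ℝ] Euc n) (c : ℝ) (ρ : ℕ → ℝ) : Prop where
  antitone : Antitone F
  zero_mem : ∀ j, 0 ∈ F j
  shape_zero : A 0 = 1
  c_pos : 0 < c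
  ρ_pos : ∀ j, 0 < ρ j
  shape : ∀ j, ∀ b ∈ F j, ‖A b - 1‖ ≤ 1 / (j + 1)
  osc : ∀ j, ∀ b ∈ F j, ∀ s t, 0 < s → s < ρ j → 0 < t → t < ρ j →
    ‖ellTrunc m μ (A b) b s - ellTrunc m μ (A b) b t‖ ≤ 1 / (j + 1)
  low : ∀ j, ∀ b ∈ F j, ∀ r, 0 < r → r < ρ j → c * r ^ m ≤ μ.real (Metric.closedBall b r)
  dense : ∀ j, ∀ b ∈ F (j + 1), ∀ s, 0 < s → s < ρ (j + 1) → ∀ V, MeasurableSet V →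
    Disjoint V (F j) → μ.real (V ∩ ellipsoid (A b) b s) ≤
      1 / (j + 1) * μ.real (ellipsoid (A b) b s)

variable {m : ℕ} {μ : Measure (Euc n)} [IsFiniteMeasure μ] {F : ℕ → Set (Euc n)}
  {A : Euc n → Euc n →L[ℝ] Euc n} {c : ℝ} {ρ : ℕ → ℝ}

theorem CenterData.norm_integral_radial_le (H : CenterData m μ F A c ρ) {j : ℕ} {b : Euc n}
    (hb : b ∈ F j) {h h' : ℝ → ℝ} (hd : ∀ t, HasDerivAt h (h' t) t) (hc : Continuous h') {R : ℝ}
    (hR : 0 < R) (hRρ : R < ρ j) (hhR : h R = 0) {C : ℝ}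
    (hC : ∀ t, 0 ≤ t → t ≤ R → |(m + 1) * h t + t * h' t| ≤ C) :
    ‖∫ z in ellipsoid (A b) b R, h ‖A b (z - b)‖ • A b (z - b) ∂μ‖ ≤
      C * R ^ (m + 1) * (1 / (j + 1)) := by
  have hφ : Measurable (fun z => A b (z - b)) := by fun_prop
  have hch : Continuous h := continuous_iff_continuousAt.2 fun t => (hd t).continuousAt
  have htr : ∀ s, ∫ v in {v | s ≤ ‖v‖}, rieszKernel m v ∂(μ.map (fun z => A b (z - b))) =
      ellTrunc m μ (A b) b s := by
    intro s
    rw [setIntegral_map ((isClosed_le continuous_const continuous_norm).measurableSet)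
      (measurable_rieszKernel m).aestronglyMeasurable hφ.aemeasurable]
    rfl
  have := norm_setIntegral_radial_le m (μ.map (fun z => A b (z - b))) hd hc hR hhR hC
    (D := 1 / (j + 1)) (fun s h0 h1 => by
      rw [htr, htr]
      exact H.osc j b hb s R h0 (h1.trans_lt hRρ) hR hRρ)
  rw [setIntegral_map Metric.isClosed_closedBall.measurableSet
    (Continuous.aestronglyMeasurable (by fun_prop)) hφ.aemeasurable] at this
  have he : (fun z => A b (z - b)) ⁻¹' Metric.closedBall 0 R = ellipsoid (A b) b R := by
    ext z; simp [ellipsoid]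
  rwa [he] at this

theorem integral_ellBump_dilation_ge {B : Euc n →L[ℝ] Euc n} {δ : ℝ} (hB : ‖B - 1‖ ≤ δ)
    (hδ : δ ≤ 1 / 2) (b : Euc n) {r : ℝ} (hr : 0 < r) :
    1 / 4 * μ.real (Metric.closedBall (r • b) (r / 4)) ≤
      ∫ z, ellBump B b z ^ 4 ∂(μ.map (fun z => r⁻¹ • z)) := by
  have hm : MeasurableSet (Metric.closedBall b (1 / 4)) := Metric.isClosed_closedBall.measurableSet
  have hpt : ∀ z, (Metric.closedBall b (1 / 4)).indicator (fun _ : Euc n => (1 / 4 : ℝ)) z ≤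
      ellBump B b z ^ 4 := by
    intro z
    by_cases hz : z ∈ Metric.closedBall b (1 / 4)
    · rw [Set.indicator_of_mem hz]
      rw [mem_closedBall_iff_norm] at hz
      have h1 := (abs_le.1 (abs_norm_apply_sub_norm_le hB (z - b))).2
      have h2 : ‖B (z - b)‖ ≤ 1 / 2 := by nlinarith [norm_nonneg (z - b)]
      have h3 : 3 / 4 ≤ ellBump B b z := by
        refine le_max_of_le_right ?_
        nlinarith [norm_nonneg (B (z - b))]
      calc (1 / 4 : ℝ) ≤ (3 / 4) ^ 4 := by norm_num
        _ ≤ _ := by gcongr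
    · rw [Set.indicator_of_notMem hz]
      exact pow_nonneg (ellBump_nonneg _ _ _) _
  have h3 := integral_mono
    (((integrable_const (1 / 4 : ℝ)).indicator hm :
      Integrable _ (μ.map (fun z : Euc n => r⁻¹ • z))))
    (integrable_ellBump_pow hB hδ b _ 4 (by norm_num)) hpt
  rw [integral_indicator hm, setIntegral_const, smul_eq_mul,
    map_measureReal_apply (by fun_prop) hm] at h3
  have he : (fun z : Euc n => r⁻¹ • z) ⁻¹' Metric.closedBall b (1 / 4) =
      Metric.closedBall (r • b) (r / 4) := by
    ext z
    have : z - r • b = r • (r⁻¹ • z - b) := by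
      rw [smul_sub, smul_smul, mul_inv_cancel₀ hr.ne', one_smul]
    simp only [Set.mem_preimage, mem_closedBall_iff_norm, this, norm_smul, Real.norm_eq_abs,
      abs_of_pos hr]
    rw [div_eq_mul_one_div r 4, mul_le_mul_iff_right₀ hr]
  rw [he] at h3
  linarith

/-- Apply the radial estimate to the profile (1 - (t/r)²)^N. After division by r the error is O(δ
r^m), while the lower density bounds ∫ p⁴ below by a multiple of r^m; no upper density is needed for
the relative error. -/
theorem CenterData.atScale (H : CenterData m μ F A c ρ) (ε : ℝ) (hε : 0 < ε) :
    ∃ j₀, ∀ j ≥ j₀, ∃ ρ > 0, ∀ r, 0 < r → r < ρ → AtScale ε μ (F j) (F (j + 1)) A r := by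
  have hc := H.c_pos
  -- Here m + 7 = (m + 1) + 2·3 bounds the profile term for N ≤ 3, the factor 2 undoes the shape,
  -- and 4^(m+1) comes from testing the mass on a ball of radius r/4, where the bump to the fourth
  -- is at least 1/4.
  set η := min (1 / 2) (min ε (ε * c / (2 * (m + 7) * 4 ^ (m + 1)))) with hη
  have hη0 : 0 < η := by positivity
  obtain ⟨j₀, hj₀⟩ := exists_nat_one_div_lt hη0
  refine ⟨j₀, fun j hj => ⟨min (ρ j) (ρ (j + 1)), lt_min (H.ρ_pos _) (H.ρ_pos _),
    fun r hr hrρ => ?_⟩⟩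
  have hrρ1 : r < ρ j := hrρ.trans_le (min_le_left _ _)
  have hrρ2 : r < ρ (j + 1) := hrρ.trans_le (min_le_right _ _)
  set δ : ℝ := 1 / ((j : ℝ) + 1) with hδ
  have hδη : δ ≤ η := by
    refine le_trans ?_ hj₀.le
    rw [hδ]
    gcongr
  have hδ2 : δ ≤ 1 / 2 := hδη.trans (min_le_left _ _)
  have hδε : δ ≤ ε := hδη.trans ((min_le_right _ _).trans (min_le_left _ _))
  have hδc : δ * (2 * (m + 7) * 4 ^ (m + 1)) ≤ ε * c := by
    rw [← le_div_iff₀ (by positivity)]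
    exact hδη.trans ((min_le_right _ _).trans (min_le_right _ _))
  have hlow : ∀ b, r • b ∈ F j → c * (r / 4) ^ m / 4 ≤
      ∫ z, ellBump (A (r • b)) b z ^ 4 ∂(μ.map (fun z => r⁻¹ • z)) := by
    intro b hb
    have h1 := integral_ellBump_dilation_ge (μ := μ) (H.shape j _ hb) hδ2 b hr
    have h2 := H.low j _ hb (r / 4) (by positivity) (by linarith)
    linarith
  refine ⟨fun b hb => H.antitone (Nat.le_succ j) hb, ?_, ?_, ?_, ?_, ?_, ?_⟩
  · show r • (0 : Euc n) ∈ F (j + 1)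
    rw [smul_zero]
    exact H.zero_mem _
  · simp only [smul_zero]
    exact H.shape_zero
  · intro b hb _
    exact (H.shape j _ hb).trans hδε
  · intro b hb _ N hN
    have hb : r • b ∈ F j := hb
    have hA := H.shape j _ hb
    set B := A (r • b) with hBdef
    have hN0 : N ≠ 0 := by omega
    have hd : ∀ t : ℝ, HasDerivAt (fun t : ℝ => (1 - (t / r) ^ 2) ^ N)
        (N * (1 - (t / r) ^ 2) ^ (N - 1) * (-(2 * (t / r) * (1 / r)))) t := by
      intro t
      have h1 : HasDerivAt (fun t : ℝ => t / r) (1 / r) t := (hasDerivAt_id t).div_const r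
      have h2 := ((h1.pow 2).const_sub 1).pow N
      refine h2.congr_deriv ?_
      simp
    have hC : ∀ t : ℝ, 0 ≤ t → t ≤ r → |((m : ℝ) + 1) * (1 - (t / r) ^ 2) ^ N +
        t * (N * (1 - (t / r) ^ 2) ^ (N - 1) * (-(2 * (t / r) * (1 / r))))| ≤ (m : ℝ) + 7 := by
      intro t h0 h1
      have u0 : 0 ≤ t / r := by positivity
      have u1 : t / r ≤ 1 := (div_le_one hr).2 h1
      have e : t * (N * (1 - (t / r) ^ 2) ^ (N - 1) * (-(2 * (t / r) * (1 / r)))) =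
          -(2 * N * ((1 - (t / r) ^ 2) ^ (N - 1) * (t / r) ^ 2)) := by
        field_simp
      rw [e]
      have q0 : 0 ≤ (t / r) ^ 2 := by positivity
      have q1 : (t / r) ^ 2 ≤ 1 := pow_le_one₀ u0 u1
      have p0 : 0 ≤ 1 - (t / r) ^ 2 := by linarith
      have p1 : 1 - (t / r) ^ 2 ≤ 1 := by linarith
      have a0 : 0 ≤ (1 - (t / r) ^ 2) ^ N := by positivity
      have a1 : (1 - (t / r) ^ 2) ^ N ≤ 1 := pow_le_one₀ p0 p1
      have b0 : 0 ≤ (1 - (t / r) ^ 2) ^ (N - 1) * (t / r) ^ 2 := by positivity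
      have b1 : (1 - (t / r) ^ 2) ^ (N - 1) * (t / r) ^ 2 ≤ 1 :=
        mul_le_one₀ (pow_le_one₀ p0 p1) q0 q1
      have hN3 : (N : ℝ) ≤ 3 := by
        have : N ≤ 3 := by omega
        exact_mod_cast this
      have hNn : (0 : ℝ) ≤ N := by positivity
      have hmn : (0 : ℝ) ≤ m := by positivity
      have c1 : (N : ℝ) * ((1 - (t / r) ^ 2) ^ (N - 1) * (t / r) ^ 2) ≤ 3 * 1 := by gcongr
      have c0 : 0 ≤ (N : ℝ) * ((1 - (t / r) ^ 2) ^ (N - 1) * (t / r) ^ 2) := by positivity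
      have d1 : ((m : ℝ) + 1) * (1 - (t / r) ^ 2) ^ N ≤ ((m : ℝ) + 1) * 1 := by gcongr
      have d0 : 0 ≤ ((m : ℝ) + 1) * (1 - (t / r) ^ 2) ^ N := by positivity
      rw [abs_le]
      constructor <;> linarith
    have hmain := H.norm_integral_radial_le hb hd (by fun_prop) hr hrρ1
      (by simp [div_self hr.ne', hN0]) hC
    have hB1 := integrable_ellBump_pow_smul hA hδ2 b (μ.map (fun z => r⁻¹ • z)) N hN0
      (g := fun z => z - b) (by fun_prop)
    have hm : MeasurableSet (ellipsoid B (r • b) r) := (isClosed_ellipsoid _ _ _).measurableSet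
    have hrel : B (∫ z, ellBump B b z ^ N • (z - b) ∂(μ.map (fun z => r⁻¹ • z))) =
        r⁻¹ • ∫ z in ellipsoid B (r • b) r,
          (1 - (‖B (z - r • b)‖ / r) ^ 2) ^ N • B (z - r • b) ∂μ := by
      have hcont := continuous_ellBump B b
      rw [← B.integral_comp_comm hB1, integral_map (by fun_prop)
        (Continuous.aestronglyMeasurable (by fun_prop)), ← integral_smul,
        ← integral_indicator hm]
      refine integral_congr_ae (Eventually.of_forall fun z => ?_)
      have hz : r⁻¹ • z - b = r⁻¹ • (z - r • b) := by
        rw [smul_sub, smul_smul, inv_mul_cancel₀ hr.ne', one_smul]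
      have hbump : ellBump B b (r⁻¹ • z) = max 0 (1 - (‖B (z - r • b)‖ / r) ^ 2) := by
        rw [ellBump, hz, map_smul, norm_smul, norm_inv, Real.norm_eq_abs, abs_of_pos hr,
          inv_mul_eq_div]
      simp only [map_smul, hz, hbump]
      by_cases hze : z ∈ ellipsoid B (r • b) r
      · rw [Set.indicator_of_mem hze]
        have h1 : ‖B (z - r • b)‖ / r ≤ 1 := (div_le_one hr).2 hze
        have h0 : 0 ≤ ‖B (z - r • b)‖ / r := by positivity
        have h2 : (‖B (z - r • b)‖ / r) ^ 2 ≤ 1 := pow_le_one₀ h0 h1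
        rw [max_eq_right (by linarith), smul_comm]
      · rw [Set.indicator_of_notMem hze]
        have h1 : r < ‖B (z - r • b)‖ := not_le.1 hze
        have h2 : 1 ≤ (‖B (z - r • b)‖ / r) ^ 2 := one_le_pow₀ ((one_le_div hr).2 h1.le)
        rw [max_eq_left (by linarith), zero_pow hN0, zero_smul]
    refine (norm_le_two_mul_norm_apply hA hδ2 _).trans ?_
    rw [hrel, norm_smul, norm_inv, Real.norm_eq_abs, abs_of_pos hr]
    have h5 := hlow b hb
    calc 2 * (r⁻¹ * _) ≤ 2 * (r⁻¹ * ((m + 7) * r ^ (m + 1) * δ)) := by gcongr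
      _ = δ * (2 * (m + 7) * 4 ^ (m + 1)) * ((r / 4) ^ m / 4) := by
        rw [div_pow]; field_simp; ring
      _ ≤ ε * c * ((r / 4) ^ m / 4) := by gcongr
      _ = ε * (c * (r / 4) ^ m / 4) := by ring
      _ ≤ _ := by gcongr
  · intro b hb _
    exact lt_of_lt_of_le (by positivity) (hlow b hb)
  · intro b hb _ s hs0 hs1 V hV hdisj
    have hb : r • b ∈ F (j + 1) := hb
    have hrr : ∀ z : Euc n, r⁻¹ • r • z = z := fun z => by
      rw [smul_smul, inv_mul_cancel₀ hr.ne', one_smul]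
    have hrr' : ∀ z : Euc n, r • r⁻¹ • z = z := fun z => by
      rw [smul_smul, mul_inv_cancel₀ hr.ne', one_smul]
    have hbF : b ∉ V := fun hbV =>
      (Set.disjoint_left.1 hdisj) hbV (H.antitone (Nat.le_succ j) hb)
    have hA := H.shape j _ (H.antitone (Nat.le_succ j) hb)
    -- The density in `CenterData` concerns s > 0; for s = 0 the ellipsoid is the single point b,
    -- which is not in V.
    rcases hs0.eq_or_lt with rfl | hs0
    · have : V ∩ ellipsoid (A (r • b)) b 0 = ∅ := by
        rw [Set.eq_empty_iff_forall_notMem]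
        rintro z ⟨hzV, hz⟩
        have h1 := norm_le_two_mul_norm_apply hA hδ2 (z - b)
        have h2 : ‖A (r • b) (z - b)‖ ≤ 0 := hz
        have h3 : z - b = 0 := norm_le_zero_iff.1 (by linarith)
        rw [sub_eq_zero] at h3
        exact hbF (h3 ▸ hzV)
      rw [this, measureReal_empty]
      positivity
    · have hpre : (fun z : Euc n => r⁻¹ • z) ⁻¹' ellipsoid (A (r • b)) b s =
          ellipsoid (A (r • b)) (r • b) (s * r) := by
        ext z
        have : r⁻¹ • z - b = r⁻¹ • (z - r • b) := by
          rw [smul_sub, hrr]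
        simp only [Set.mem_preimage, ellipsoid, Set.mem_ofPred_eq, this, map_smul, norm_smul,
          norm_inv, Real.norm_eq_abs, abs_of_pos hr]
        rw [inv_mul_le_iff₀ hr, mul_comm]
      have hme : MeasurableSet (ellipsoid (A (r • b)) b s) := (isClosed_ellipsoid _ _ _).measurableSet
      have hφ : Measurable (fun z : Euc n => r⁻¹ • z) := by fun_prop
      rw [map_measureReal_apply hφ (hV.inter hme), map_measureReal_apply hφ hme,
        Set.preimage_inter, hpre]
      refine (H.dense j _ hb (s * r) (by positivity) (by nlinarith) _ (hφ hV) ?_).trans ?_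
      · rw [Set.disjoint_left] at hdisj ⊢
        intro z hz hzF
        refine hdisj hz ?_
        show r • r⁻¹ • z ∈ F j
        rwa [hrr']
      · gcongr

/-- The doubling condition at the origin. -/
theorem CenterData.exists_measure_ball_le (H : CenterData m μ F A c ρ) :
    ∃ C > 0, ∃ ρ > 0, ∀ r, 0 < r → r < ρ →
      μ.real (Metric.closedBall 0 (4 * r)) ≤ C * μ.real (Metric.closedBall 0 r) :=
  _root_.exists_measure_ball_le μ F H.antitone A H.atScale

end Centers

/-! ### A covering theorem for nearly round ellipsoids. -/

section Covering
variable {E : Type*}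

/-- Greedy selection from a family of sets of bounded size: every point is covered by a selected
set, and of two selected points one has a comparable or bigger size and its set omits the other. -/
theorem exists_greedy_selection (Z : Set E) (U : E → Set E) (r : E → ℝ)
    (hr : ∀ x ∈ Z, 0 < r x ∧ r x ≤ 1) (hU : ∀ x ∈ Z, x ∈ U x) {q : ℝ} (hq : 0 < q) (hq1 : q < 1) :
    ∃ T ⊆ Z, (∀ x ∈ Z, ∃ y ∈ T, x ∈ U y) ∧
      ∀ x ∈ T, ∀ y ∈ T, x ≠ y → (q * r y ≤ r x ∧ y ∉ U x) ∨ (q * r x ≤ r y ∧ x ∉ U y) := by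
  classical
  have hex : ∀ x : E, ∃ k : ℕ, x ∈ Z → q ^ (k + 1) < r x := by
    intro x
    by_cases hx : x ∈ Z
    · obtain ⟨k, hk⟩ := exists_pow_lt_of_lt_one (hr x hx).1 hq1
      refine ⟨k, fun _ => lt_of_le_of_lt ?_ hk⟩
      exact pow_le_pow_of_le_one hq.le hq1.le (Nat.le_succ k)
    · exact ⟨0, fun h => absurd h hx⟩
  let k : E → ℕ := fun x => Nat.find (hex x)
  have hk1 : ∀ x ∈ Z, q ^ (k x + 1) < r x := fun x hx => Nat.find_spec (hex x) hx
  have hk2 : ∀ x ∈ Z, r x ≤ q ^ (k x) := by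
    intro x hx
    rcases Nat.eq_zero_or_pos (k x) with h | h
    · rw [h, pow_zero]; exact (hr x hx).2
    · have h1 := Nat.find_min (hex x) (m := k x - 1) (Nat.sub_lt h one_pos)
      rw [Classical.not_imp, not_lt, show k x - 1 + 1 = k x from Nat.sub_add_cancel h] at h1
      exact h1.2
  have hcomp : ∀ x ∈ Z, ∀ y ∈ Z, k x ≤ k y → q * r y ≤ r x := by
    intro x hx y hy h
    calc q * r y ≤ q * q ^ (k y) := by gcongr; exact hk2 y hy
      _ ≤ q * q ^ (k x) := by gcongr ?_ * ?_; exact pow_le_pow_of_le_one hq.le hq1.le h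
      _ = q ^ (k x + 1) := by ring
      _ ≤ r x := (hk1 x hx).le
  -- Points are ordered by size class q^(k+1) < r ≤ q^k, largest first, and within a class by a
  -- well-order; x is selected, by well-founded recursion, if no earlier selected set contains it.
  let f : E → ℕ × E := fun x => (k x, x)
  let R : E → E → Prop := InvImage (Prod.Lex (· < ·) WellOrderingRel) f
  have hwf : WellFounded R :=
    InvImage.wf f (WellFounded.prod_lex wellFounded_lt WellOrderingRel.isWellOrder.wf)
  let sel : E → Prop := hwf.fix (fun x ih => x ∈ Z ∧ ∀ y (h : R y x), ih y h → x ∉ U y)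
  have hsel : ∀ x, sel x ↔ x ∈ Z ∧ ∀ y, R y x → sel y → x ∉ U y := by
    intro x
    exact iff_of_eq (hwf.fix_eq _ x)
  have hRk : ∀ x y, R x y → k x ≤ k y := by
    intro x y h
    rcases Prod.lex_def.1 h with h | h
    · exact le_of_lt h
    · exact le_of_eq h.1
  have htri : ∀ x y, x ≠ y → R x y ∨ R y x := by
    intro x y hxy
    rcases lt_trichotomy (k x) (k y) with h | h | h
    · exact Or.inl (Prod.lex_def.2 (Or.inl h))
    · rcases trichotomous_of WellOrderingRel x y with h2 | h2 | h2
      · exact Or.inl (Prod.lex_def.2 (Or.inr ⟨h, h2⟩))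
      · exact absurd h2 hxy
      · exact Or.inr (Prod.lex_def.2 (Or.inr ⟨h.symm, h2⟩))
    · exact Or.inr (Prod.lex_def.2 (Or.inl h))
  refine ⟨{x | sel x}, fun x hx => ((hsel x).1 hx).1, fun x hx => ?_, fun x hx y hy hxy => ?_⟩
  · by_cases h : sel x
    · exact ⟨x, h, hU x hx⟩
    · rw [hsel] at h
      push Not at h
      obtain ⟨y, _, hy, hxy⟩ := h hx
      exact ⟨y, hy, hxy⟩
  · have hx' := (hsel x).1 hx
    have hy' := (hsel y).1 hy
    rcases htri x y hxy with h | h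
    · exact Or.inl ⟨hcomp x hx'.1 y hy'.1 (hRk _ _ h), hy'.2 x h hx⟩
    · exact Or.inr ⟨hcomp y hy'.1 x hx'.1 (hRk _ _ h), hx'.2 y h hy⟩

variable [NormedAddCommGroup E] [InnerProductSpace ℝ E]

theorem convex_ellipsoid (A : E →L[ℝ] E) (b : E) (s : ℝ) : Convex ℝ (ellipsoid A b s) := by
  intro x hx y hy u v hu hv huv
  have hx : ‖A (x - b)‖ ≤ s := hx
  have hy : ‖A (y - b)‖ ≤ s := hy
  have h1 : u • x + v • y - b = u • (x - b) + v • (y - b) := by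
    have : b = u • b + v • b := by rw [← add_smul, huv, one_smul]
    nth_rewrite 1 [this]
    module
  show ‖A (u • x + v • y - b)‖ ≤ s
  rw [h1, map_add, map_smul, map_smul]
  refine (norm_add_le _ _).trans ?_
  rw [norm_smul, norm_smul, Real.norm_eq_abs, Real.norm_eq_abs, abs_of_nonneg hu, abs_of_nonneg hv]
  calc u * ‖A (x - b)‖ + v * ‖A (y - b)‖ ≤ u * s + v * s := by gcongr
    _ = s := by rw [← add_mul, huv, one_mul]

theorem mem_ellipsoid_of_norm_le {A : E →L[ℝ] E} (hA : ‖A - 1‖ ≤ 1 / 100) {b z : E} {s : ℝ}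
    (h : ‖z - b‖ ≤ 99 / 100 * s) : z ∈ ellipsoid A b s := by
  have h1 := (abs_le.1 (abs_norm_apply_sub_norm_le hA (z - b))).2
  show ‖A (z - b)‖ ≤ s
  linarith [norm_nonneg (z - b)]

theorem norm_le_of_mem_ellipsoid {A : E →L[ℝ] E} (hA : ‖A - 1‖ ≤ 1 / 100) {b z : E} {s : ℝ}
    (h : z ∈ ellipsoid A b s) : ‖z - b‖ ≤ 100 / 99 * s := by
  have h1 := (abs_le.1 (abs_norm_apply_sub_norm_le hA (z - b))).1
  have h : ‖A (z - b)‖ ≤ s := h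
  linarith [norm_nonneg (z - b)]

/-- A nearly round ellipsoid around `x` containing `z`, with `z` not too close to `x`, contains the
points `y` that are not too far and are seen from `z` in nearly the same direction as `x`. -/
theorem mem_ellipsoid_of_inner_ge {A : E →L[ℝ] E} (hA : ‖A - 1‖ ≤ 1 / 100) {x y z : E} {s : ℝ}
    (hs : 0 < s) (hz : z ∈ ellipsoid A x s) (hxz : s / 10 ≤ ‖x - z‖)
    (hyz : ‖y - z‖ ≤ 104 / 100 * s) (hin : 3 / 5 * (‖x - z‖ * ‖y - z‖) ≤ inner ℝ (x - z) (y - z)) :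
    y ∈ ellipsoid A x s := by
  have ha : ‖x - z‖ ≤ 102 / 100 * s := by
    have := norm_le_of_mem_ellipsoid hA hz
    rw [norm_sub_rev] at this
    linarith
  set a := ‖x - z‖ with ha_def
  set b := ‖y - z‖ with hb_def
  have hb0 : 0 ≤ b := norm_nonneg _
  rcases le_or_gt (s / 2) b with hb | hb
  · refine mem_ellipsoid_of_norm_le hA ?_
    have h1 : ‖y - x‖ ^ 2 = b ^ 2 - 2 * inner ℝ (x - z) (y - z) + a ^ 2 := by
      have : y - x = (y - z) - (x - z) := by abel
      rw [this, norm_sub_sq_real, real_inner_comm]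
    refine abs_le_of_sq_le_sq' ?_ (by positivity) |>.2
    rw [h1]
    nlinarith [mul_nonneg (sub_nonneg.2 hxz) (sub_nonneg.2 ha),
      mul_nonneg (sub_nonneg.2 hb) (sub_nonneg.2 hyz),
      mul_nonneg (sub_nonneg.2 hxz) (sub_nonneg.2 hyz),
      mul_nonneg (sub_nonneg.2 ha) (sub_nonneg.2 hb),
      mul_nonneg (sub_nonneg.2 hxz) (sub_nonneg.2 hb),
      mul_nonneg (sub_nonneg.2 ha) (sub_nonneg.2 hyz)]
  · rcases hb0.eq_or_lt with hb0 | hb0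
    · have : y = z := by
        rw [← sub_eq_zero]
        exact norm_eq_zero.1 hb0.symm
      rwa [this]
    -- When y is closer than s/2 to z, move along the ray from z through y to distance s/2; that
    -- point is in the ellipsoid, and convexity brings y in.
    · set t := s / (2 * b) with ht
      have htb : t * b = s / 2 := by rw [ht]; field_simp
      have ht0 : 0 < t := by positivity
      have ht1 : 1 < t := by
        rw [ht, one_lt_div (by positivity)]; linarith
      have hp : z + t • (y - z) ∈ ellipsoid A x s := by
        refine mem_ellipsoid_of_norm_le hA ?_
        have h1 : ‖z + t • (y - z) - x‖ ^ 2 =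
            (t * b) ^ 2 - 2 * (t * inner ℝ (x - z) (y - z)) + a ^ 2 := by
          have : z + t • (y - z) - x = t • (y - z) - (x - z) := by abel
          rw [this, norm_sub_sq_real, norm_smul, Real.norm_eq_abs, abs_of_pos ht0,
            real_inner_smul_left, real_inner_comm]
        refine abs_le_of_sq_le_sq' ?_ (by positivity) |>.2
        rw [h1, htb]
        have h2 : 3 / 5 * (a * (t * b)) ≤ t * inner ℝ (x - z) (y - z) := by
          calc 3 / 5 * (a * (t * b)) = t * (3 / 5 * (a * b)) := by ring
            _ ≤ _ := by gcongr
        rw [htb] at h2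
        nlinarith [mul_nonneg (sub_nonneg.2 hxz) (sub_nonneg.2 ha)]
      have := convex_ellipsoid A x s hz hp
        (sub_nonneg.2 (inv_le_one_of_one_le₀ ht1.le)) (by positivity : 0 ≤ t⁻¹) (by ring)
      have e : (1 - t⁻¹) • z + t⁻¹ • (z + t • (y - z)) = y := by
        rw [smul_add, smul_smul, inv_mul_cancel₀ ht0.ne']
        module
      rwa [e] at this

theorem inner_lt_of_not_mem_ellipsoid {A B : E →L[ℝ] E} (hA : ‖A - 1‖ ≤ 1 / 100)
    (hB : ‖B - 1‖ ≤ 1 / 100) {x y z : E} {s t : ℝ} (hs : 0 < s) (hst : 100 / 101 * t ≤ s)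
    (hzx : z ∈ ellipsoid A x s) (hzy : z ∈ ellipsoid B y t) (hy : y ∉ ellipsoid A x s)
    (hxz : s / 10 ≤ ‖x - z‖) :
    inner ℝ (x - z) (y - z) < 3 / 5 * (‖x - z‖ * ‖y - z‖) := by
  by_contra h
  refine hy (mem_ellipsoid_of_inner_ge hA hs hzx hxz ?_ (not_lt.1 h))
  have := norm_le_of_mem_ellipsoid hB hzy
  rw [norm_sub_rev] at this
  linarith

variable [FiniteDimensional ℝ E]

/-- Bounded overlap of selected nearly round ellipsoids. -/
theorem card_le_of_mem_ellipsoid (S : Finset E) (A : E → E →L[ℝ] E) (r : E → ℝ) (z : E)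
    (hA : ∀ x ∈ S, ‖A x - 1‖ ≤ 1 / 100) (hr : ∀ x ∈ S, 0 < r x)
    (hz : ∀ x ∈ S, z ∈ ellipsoid (A x) x (r x))
    (hS : ∀ x ∈ S, ∀ y ∈ S, x ≠ y → (100 / 101 * r y ≤ r x ∧ y ∉ ellipsoid (A x) x (r x)) ∨
      (100 / 101 * r x ≤ r y ∧ x ∉ ellipsoid (A y) y (r y))) :
    S.card ≤ 5 ^ Module.finrank ℝ E + 1 := by
  classical
  -- For centres away from z, directions rescaled to norm 2 have inner products at most 12/5, hence
  -- are 1-separated, and at most 5^dim of them exist. At most one centre is very close to z: of two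
  -- such, one ellipsoid would contain the other centre.
  set P := S.filter (fun x => r x / 10 ≤ ‖x - z‖) with hP
  set Q := S.filter (fun x => ¬ r x / 10 ≤ ‖x - z‖) with hQ
  have hcard : P.card + Q.card = S.card := Finset.card_filter_add_card_filter_not _
  have hQ1 : Q.card ≤ 1 := by
    rw [Finset.card_le_one]
    intro x hx y hy
    by_contra hxy
    rw [hQ, Finset.mem_filter, not_le] at hx hy
    have h1 : ‖y - x‖ ≤ ‖y - z‖ + ‖x - z‖ := by
      have : y - x = (y - z) - (x - z) := by abel
      rw [this]; exact norm_sub_le _ _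
    have p1 := hr x hx.1
    have p2 := hr y hy.1
    rcases hS x hx.1 y hy.1 hxy with h | h
    · exact h.2 (mem_ellipsoid_of_norm_le (hA x hx.1) (by linarith))
    · refine h.2 (mem_ellipsoid_of_norm_le (hA y hy.1) ?_)
      rw [norm_sub_rev]
      linarith
  have hpos : ∀ x ∈ P, 0 < ‖x - z‖ := by
    intro x hx
    rw [hP, Finset.mem_filter] at hx
    have := hr x hx.1
    linarith
  have hin : ∀ x ∈ P, ∀ y ∈ P, x ≠ y →
      inner ℝ (x - z) (y - z) < 3 / 5 * (‖x - z‖ * ‖y - z‖) := by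
    intro x hx y hy hxy
    rw [hP, Finset.mem_filter] at hx hy
    rcases hS x hx.1 y hy.1 hxy with h | h
    · exact inner_lt_of_not_mem_ellipsoid (hA x hx.1) (hA y hy.1) (hr x hx.1) h.1 (hz x hx.1)
        (hz y hy.1) h.2 hx.2
    · rw [real_inner_comm, mul_comm ‖x - z‖]
      exact inner_lt_of_not_mem_ellipsoid (hA y hy.1) (hA x hx.1) (hr y hy.1) h.1 (hz y hy.1)
        (hz x hx.1) h.2 hy.2
  set g : E → E := fun x => (2 * ‖x - z‖⁻¹) • (x - z) with hg
  have hgn : ∀ x ∈ P, ‖g x‖ = 2 := by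
    intro x hx
    have := hpos x hx
    rw [hg, norm_smul, norm_mul, norm_inv, norm_norm, Real.norm_eq_abs, abs_two]
    field_simp
  have hgd : ∀ x ∈ P, ∀ y ∈ P, x ≠ y → 1 ≤ ‖g x - g y‖ := by
    intro x hx y hy hxy
    have hx0 := hpos x hx
    have hy0 := hpos y hy
    have h1 : ‖g x - g y‖ ^ 2 = 8 - 2 * inner ℝ (g x) (g y) := by
      rw [norm_sub_sq_real, hgn x hx, hgn y hy]; ring
    have h2 : inner ℝ (g x) (g y) ≤ (12 / 5 : ℝ) := by
      rw [hg]
      simp only [real_inner_smul_left, real_inner_smul_right]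
      calc 2 * ‖y - z‖⁻¹ * (2 * ‖x - z‖⁻¹ * inner ℝ (x - z) (y - z))
          ≤ 2 * ‖y - z‖⁻¹ * (2 * ‖x - z‖⁻¹ * (3 / 5 * (‖x - z‖ * ‖y - z‖))) := by
            gcongr; exact (hin x hx y hy hxy).le
        _ = 12 / 5 := by field_simp; norm_num
    nlinarith [norm_nonneg (g x - g y)]
  have hinj : Set.InjOn g P := by
    intro x hx y hy hxy
    by_contra hne
    have := hgd x hx y hy hne
    rw [hxy, sub_self, norm_zero] at this
    linarith
  have hPc : P.card ≤ 5 ^ Module.finrank ℝ E := by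
    rw [← Finset.card_image_of_injOn hinj]
    refine Besicovitch.card_le_of_separated _ ?_ ?_
    · intro c hc
      obtain ⟨x, hx, rfl⟩ := Finset.mem_image.1 hc
      exact (hgn x hx).le
    · intro c hc d hd hcd
      obtain ⟨x, hx, rfl⟩ := Finset.mem_image.1 hc
      obtain ⟨y, hy, rfl⟩ := Finset.mem_image.1 hd
      exact hgd x hx y hy (fun h => hcd (by rw [h]))
  omega

end Covering

/-! ### A density theorem along ellipsoids of arbitrary shapes. -/

section Density
variable {E : Type*} [NormedAddCommGroup E] [InnerProductSpace ℝ E]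
  [FiniteDimensional ℝ E]

/-- Arbitrary shapes fall into countably many classes, each made nearly round by a single linear
change of variables `Q i`. -/
theorem exists_denseSeq_units (E : Type*) [NormedAddCommGroup E] [InnerProductSpace ℝ E]
    [FiniteDimensional ℝ E] : ∃ Q : ℕ → (E →L[ℝ] E)ˣ, ∀ (δ : ℝ), 0 < δ → ∀ B : (E →L[ℝ] E)ˣ,
      ∃ i, ‖(B * (Q i)⁻¹ : E →L[ℝ] E) - 1‖ < δ := by
  have : ProperSpace (E →L[ℝ] E) := FiniteDimensional.proper_real _
  have : SecondCountableTopology (E →L[ℝ] E)ˣ :=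
    Units.isEmbedding_embedProduct.secondCountableTopology
  refine ⟨TopologicalSpace.denseSeq _, fun δ hδ B => ?_⟩
  have hc : Continuous fun u : (E →L[ℝ] E)ˣ => (B * (u⁻¹ : (E →L[ℝ] E)ˣ) : E →L[ℝ] E) - 1 :=
    (continuous_const.mul (Units.continuous_val.comp continuous_inv)).sub continuous_const
  have ho : IsOpen {u : (E →L[ℝ] E)ˣ | ‖(B * (u⁻¹ : (E →L[ℝ] E)ˣ) : E →L[ℝ] E) - 1‖ < δ} :=
    isOpen_lt hc.norm continuous_const
  obtain ⟨i, hi⟩ :=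
    (TopologicalSpace.denseRange_denseSeq (E →L[ℝ] E)ˣ).exists_mem_open ho ⟨B, by simpa using hδ⟩
  exact ⟨i, hi⟩

theorem countable_of_selected (A : E → E →L[ℝ] E) (r : E → ℝ) (T : Set E)
    (hA : ∀ x ∈ T, ‖A x - 1‖ ≤ 1 / 100) (hr : ∀ x ∈ T, 0 < r x)
    (hT : ∀ x ∈ T, ∀ y ∈ T, x ≠ y → (100 / 101 * r y ≤ r x ∧ y ∉ ellipsoid (A x) x (r x)) ∨
      (100 / 101 * r x ≤ r y ∧ x ∉ ellipsoid (A y) y (r y))) : T.Countable := by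
  have := FiniteDimensional.proper_real E
  have hsub : T ⊆ ⋃ i : ℕ, {x ∈ T | TopologicalSpace.denseSeq E i ∈ ellipsoid (A x) x (r x)} := by
    intro x hx
    obtain ⟨i, hi⟩ := (TopologicalSpace.denseRange_denseSeq E).exists_mem_open
      (Metric.isOpen_ball (x := x) (ε := 99 / 100 * r x))
      ⟨x, Metric.mem_ball_self (by have := hr x hx; positivity)⟩
    refine Set.mem_iUnion.2 ⟨i, hx, mem_ellipsoid_of_norm_le (hA x hx) ?_⟩
    rw [mem_ball_iff_norm] at hi
    exact hi.le
  refine (Set.countable_iUnion fun i => Set.Finite.countable ?_).mono hsub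
  by_contra hinf
  obtain ⟨S, hS, hcard⟩ := Set.Infinite.exists_subset_card_eq hinf (5 ^ Module.finrank ℝ E + 2)
  have := card_le_of_mem_ellipsoid S A r (TopologicalSpace.denseSeq E i)
    (fun x hx => hA x (hS hx).1) (fun x hx => hr x (hS hx).1) (fun x hx => (hS hx).2)
    (fun x hx y hy => hT x (hS hx).1 y (hS hy).1)
  omega

variable [MeasurableSpace E] [BorelSpace E]

/-- Sum of measures over a selected family of nearly round ellipsoids. -/
theorem sum_measure_ellipsoid_inter_le (μ : Measure E) (A : E → E →L[ℝ] E) (r : E → ℝ) (T : Set E)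
    (hA : ∀ x ∈ T, ‖A x - 1‖ ≤ 1 / 100) (hr : ∀ x ∈ T, 0 < r x)
    (hT : ∀ x ∈ T, ∀ y ∈ T, x ≠ y → (100 / 101 * r y ≤ r x ∧ y ∉ ellipsoid (A x) x (r x)) ∨
      (100 / 101 * r x ≤ r y ∧ x ∉ ellipsoid (A y) y (r y)))
    {W N : Set E} (hN : MeasurableSet N) (hW : ∀ x ∈ T, ellipsoid (A x) x (r x) ∩ N ⊆ W)
    (S : Finset T) :
    ∑ x ∈ S, μ (ellipsoid (A x) x (r x) ∩ N) ≤ (5 ^ Module.finrank ℝ E + 1 : ℕ) * μ W := by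
  classical
  have hm : ∀ x : E, MeasurableSet (ellipsoid (A x) x (r x) ∩ N) := fun x =>
    (isClosed_ellipsoid _ _ _).measurableSet.inter hN
  set W' := ⋃ x ∈ S, (ellipsoid (A (x : E)) x (r x) ∩ N) with hW'
  have hW'm : MeasurableSet W' := Finset.measurableSet_biUnion _ fun x _ => hm x
  have hW'W : W' ⊆ W := Set.iUnion₂_subset fun x _ => hW x x.2
  calc ∑ x ∈ S, μ (ellipsoid (A x) x (r x) ∩ N)
      = ∫⁻ z, ∑ x ∈ S, (ellipsoid (A (x : E)) x (r x) ∩ N).indicator (1 : E → ℝ≥0∞) z ∂μ := by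
        rw [lintegral_finsetSum S (f := fun (x : T) z =>
          (ellipsoid (A (x : E)) x (r x) ∩ N).indicator (1 : E → ℝ≥0∞) z)
          fun x _ => measurable_one.indicator (hm x)]
        exact Finset.sum_congr rfl fun x _ => (lintegral_indicator_one (hm x)).symm
    _ ≤ ∫⁻ z, W'.indicator (fun _ => ((5 ^ Module.finrank ℝ E + 1 : ℕ) : ℝ≥0∞)) z ∂μ := by
        refine lintegral_mono fun z => ?_
        simp only [Set.indicator_apply, Pi.one_apply]
        rw [← Finset.sum_filter, Finset.sum_const, nsmul_eq_mul, mul_one]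
        set P := S.filter (fun x : T => z ∈ ellipsoid (A (x : E)) x (r x) ∩ N) with hP
        split_ifs with hz
        · have h1 : P.card ≤ 5 ^ Module.finrank ℝ E + 1 := by
            rw [← Finset.card_map (Function.Embedding.subtype _)]
            have hmem : ∀ x ∈ P.map (Function.Embedding.subtype _), x ∈ T ∧
                z ∈ ellipsoid (A x) x (r x) := by
              intro x hx
              obtain ⟨y, hy, rfl⟩ := Finset.mem_map.1 hx
              exact ⟨y.2, (Finset.mem_filter.1 hy).2.1⟩
            refine card_le_of_mem_ellipsoid _ A r z (fun x hx => hA x (hmem x hx).1)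
              (fun x hx => hr x (hmem x hx).1) (fun x hx => (hmem x hx).2)
              (fun x hx y hy => hT x (hmem x hx).1 y (hmem y hy).1)
          exact_mod_cast h1
        · have h1 : P = ∅ := by
            rw [hP, Finset.filter_eq_empty_iff]
            intro x hx hzx
            exact hz (Set.mem_biUnion (show x ∈ (S : Set T) from hx) hzx)
          rw [h1]; simp
    _ = (5 ^ Module.finrank ℝ E + 1 : ℕ) * μ W' := lintegral_indicator_const hW'm _
    _ ≤ _ := by gcongr

/-- Z lies in Nᶜ, which has an open neighbourhood O with μ(O \ Nᶜ) < η. Select a cover of Z by bad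
ellipsoids inside O; bounded overlap bounds their total mass by ε⁻¹ (5^dim + 1) η, and η is
arbitrary. Z need not be measurable. -/
theorem measure_eq_zero_of_frequently_ellipsoid (μ : Measure E) [IsFiniteMeasure μ]
    (A : E → E →L[ℝ] E) {Z N : Set E} (hN : MeasurableSet N) (hZN : Disjoint Z N)
    (hA : ∀ x ∈ Z, ‖A x - 1‖ ≤ 1 / 100) {ε : ℝ≥0∞} (hε : ε ≠ 0) (hε' : ε ≠ ∞)
    (hbad : ∀ x ∈ Z, ∀ ρ > 0, ∃ s, 0 < s ∧ s < ρ ∧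
      ε * μ (ellipsoid (A x) x s) ≤ μ (ellipsoid (A x) x s ∩ N)) : μ Z = 0 := by
  set K : ℝ≥0∞ := ε⁻¹ * (5 ^ Module.finrank ℝ E + 1 : ℕ) with hK
  have hKtop : K ≠ ∞ := ENNReal.mul_ne_top (ENNReal.inv_ne_top.2 hε) (ENNReal.natCast_ne_top _)
  have key : ∀ η : ℝ≥0∞, η ≠ 0 → μ Z ≤ K * η := by
    intro η hη
    obtain ⟨O, hNO, hO, _, hOη⟩ := hN.compl.exists_isOpen_sdiff_lt (measure_ne_top μ _) hη
    have hch : ∀ x, ∃ s : ℝ, x ∈ Z → 0 < s ∧ s ≤ 1 ∧ ellipsoid (A x) x s ⊆ O ∧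
        ε * μ (ellipsoid (A x) x s) ≤ μ (ellipsoid (A x) x s ∩ N) := by
      intro x
      by_cases hx : x ∈ Z
      · obtain ⟨ρ, hρ, hball⟩ := Metric.isOpen_iff.1 hO x (hNO (Set.disjoint_left.1 hZN hx))
        obtain ⟨s, hs0, hs1, hs⟩ := hbad x hx (min 1 (ρ / 2)) (by positivity)
        have hsρ := hs1.trans_le (min_le_right _ _)
        refine ⟨s, fun _ => ⟨hs0, (hs1.trans_le (min_le_left _ _)).le, fun z hz => hball ?_, hs⟩⟩
        have := norm_le_of_mem_ellipsoid (hA x hx) hz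
        rw [mem_ball_iff_norm]
        linarith
      · exact ⟨0, fun h => absurd h hx⟩
    choose r hr using hch
    obtain ⟨T, hTZ, hcov, hsel⟩ := exists_greedy_selection Z
      (fun x => ellipsoid (A x) x (r x)) r (fun x hx => ⟨(hr x hx).1, (hr x hx).2.1⟩)
      (fun x hx => by simpa [ellipsoid] using (hr x hx).1.le) (q := 100 / 101) (by norm_num)
      (by norm_num)
    have hTA : ∀ x ∈ T, ‖A x - 1‖ ≤ 1 / 100 := fun x hx => hA x (hTZ hx)
    have hTr : ∀ x ∈ T, 0 < r x := fun x hx => (hr x (hTZ hx)).1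
    have hTc : T.Countable := countable_of_selected A r T hTA hTr hsel
    calc μ Z ≤ μ (⋃ x ∈ T, ellipsoid (A x) x (r x)) := by
          refine measure_mono fun x hx => ?_
          obtain ⟨y, hy, hxy⟩ := hcov x hx
          exact Set.mem_biUnion hy hxy
      _ ≤ ∑' x : T, μ (ellipsoid (A x) x (r x)) := measure_biUnion_le μ hTc _
      _ ≤ ∑' x : T, ε⁻¹ * μ (ellipsoid (A x) x (r x) ∩ N) := by
          refine ENNReal.tsum_le_tsum fun x => ?_
          rw [← ENNReal.div_eq_inv_mul, ENNReal.le_div_iff_mul_le (Or.inl hε) (Or.inl hε'),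
            mul_comm]
          exact (hr x (hTZ x.2)).2.2.2
      _ = ε⁻¹ * ∑' x : T, μ (ellipsoid (A x) x (r x) ∩ N) := ENNReal.tsum_mul_left
      _ ≤ ε⁻¹ * ((5 ^ Module.finrank ℝ E + 1 : ℕ) * μ (O \ Nᶜ)) := by
          gcongr
          refine ENNReal.summable.tsum_le_of_sum_le fun S => ?_
          refine sum_measure_ellipsoid_inter_le μ A r T hTA hTr hsel hN (fun x hx z hz => ?_) S
          exact ⟨(hr x (hTZ hx)).2.2.1 hz.1, fun h => h hz.2⟩
      _ ≤ K * η := by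
          rw [hK, mul_assoc]
          gcongr
  have h0 : Tendsto (fun η : ℝ≥0∞ => K * η) (𝓝[>] 0) (𝓝 0) := by
    have := ENNReal.Tendsto.const_mul (a := K) (tendsto_id (α := ℝ≥0∞) (x := 𝓝 0)) (Or.inr hKtop)
    rw [mul_zero] at this
    exact this.mono_left nhdsWithin_le_nhds
  refine le_antisymm (ge_of_tendsto h0 ?_) zero_le
  filter_upwards [self_mem_nhdsWithin] with η hη
  exact key η (ne_of_gt hη)

/-- Density theorem along ellipsoids of arbitrary shapes. -/
theorem ae_density_ellipsoid (μ : Measure E) [IsFiniteMeasure μ] (B : E → (E →L[ℝ] E)ˣ) (F : Set E)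
    {ε : ℝ} (hε : 0 < ε) :
    ∀ᵐ x ∂μ, x ∈ F → ∃ ρ > 0, ∀ s, 0 < s → s < ρ → ∀ V, MeasurableSet V → Disjoint V F →
      μ.real (V ∩ ellipsoid (B x : E →L[ℝ] E) x s) ≤ ε * μ.real (ellipsoid (B x : E →L[ℝ] E) x s) := by
  obtain ⟨Q, hQ⟩ := exists_denseSeq_units E
  -- F may be non-measurable, so its measurable hull is used: a measurable set missing F meets the
  -- hull in a null set.
  set N : Set E := (toMeasurable μ F)ᶜ with hN
  have hNm : MeasurableSet N := (measurableSet_toMeasurable μ F).compl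
  set Z : ℕ → Set E := fun i => {x | x ∈ F ∧ ‖(B x * (Q i)⁻¹ : E →L[ℝ] E) - 1‖ ≤ 1 / 100 ∧
    ∀ ρ > 0, ∃ s, 0 < s ∧ s < ρ ∧ ENNReal.ofReal ε * μ (ellipsoid (B x : E →L[ℝ] E) x s) ≤
      μ (ellipsoid (B x : E →L[ℝ] E) x s ∩ N)} with hZ
  have hZ0 : ∀ i, μ (Z i) = 0 := by
    intro i
    set e : E ≃ᵐ E := (ContinuousLinearEquiv.unitsEquiv ℝ E (Q i)).toHomeomorph.toMeasurableEquiv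
      with he
    have hez : ∀ z, e z = (Q i : E →L[ℝ] E) z := fun z => rfl
    have hinv : ∀ v, ((Q i)⁻¹ : (E →L[ℝ] E)ˣ).val ((Q i : E →L[ℝ] E) v) = v := by
      intro v
      rw [← mul_apply_eq_comp, Units.inv_mul, one_apply_eq_self]
    have hell : ∀ x s, e ⁻¹' ellipsoid (B (e.symm (e x)) * (Q i)⁻¹ : E →L[ℝ] E) (e x) s =
        ellipsoid (B x : E →L[ℝ] E) x s := by
      intro x s
      ext z
      rw [e.symm_apply_apply]
      simp only [Set.mem_preimage, ellipsoid, Set.mem_ofPred_eq, hez, ← map_sub,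
        mul_apply_eq_comp, hinv]
    have hell2 : ∀ x s, e ⁻¹' (ellipsoid (B (e.symm (e x)) * (Q i)⁻¹ : E →L[ℝ] E) (e x) s ∩
        e.symm ⁻¹' N) = ellipsoid (B x : E →L[ℝ] E) x s ∩ N := by
      intro x s
      rw [Set.preimage_inter, hell]
      congr 1
      ext z
      simp
    have h := measure_eq_zero_of_frequently_ellipsoid (μ.map e)
      (fun y => (B (e.symm y) * (Q i)⁻¹ : E →L[ℝ] E)) (Z := e '' Z i) (N := e.symm ⁻¹' N)
      (e.symm.measurable hNm) ?_ ?_ (ε := ENNReal.ofReal ε) (by simpa using hε)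
      ENNReal.ofReal_ne_top ?_
    · rw [e.map_apply, e.injective.preimage_image] at h
      exact h
    · rw [Set.disjoint_left]
      rintro _ ⟨x, hx, rfl⟩ hxN
      rw [Set.mem_preimage, e.symm_apply_apply] at hxN
      exact hxN (subset_toMeasurable μ F hx.1)
    · rintro _ ⟨x, hx, rfl⟩
      rw [e.symm_apply_apply]
      exact hx.2.1
    · rintro _ ⟨x, hx, rfl⟩ ρ hρ
      obtain ⟨s, hs0, hs1, hs⟩ := hx.2.2 ρ hρ
      refine ⟨s, hs0, hs1, ?_⟩
      rwa [e.map_apply, e.map_apply, hell, hell2]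
  have hae : ∀ᵐ x ∂μ, ∀ i, x ∉ Z i := ae_all_iff.2 fun i => measure_eq_zero_iff_ae_notMem.1 (hZ0 i)
  filter_upwards [hae] with x hx hxF
  obtain ⟨i, hi⟩ := hQ (1 / 100) (by norm_num) (B x)
  have hxi := hx i
  simp only [hZ, Set.mem_ofPred_eq, not_and] at hxi
  have h1 := hxi hxF hi.le
  push Not at h1
  obtain ⟨ρ, hρ, h2⟩ := h1
  refine ⟨ρ, hρ, fun s hs0 hs1 V hV hVF => ?_⟩
  have h3 := (h2 s hs0 hs1).le
  set U := ellipsoid (B x : E →L[ℝ] E) x s with hU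
  have hUm : MeasurableSet U := (isClosed_ellipsoid _ _ _).measurableSet
  have h4 : μ (V ∩ U) ≤ μ (U ∩ N) := by
    have h5 : μ (toMeasurable μ F ∩ V) = 0 := by
      rw [Measure.measure_toMeasurable_inter hV (measure_ne_top μ F), hVF.symm.inter_eq,
        measure_empty]
    calc μ (V ∩ U) ≤ μ ((toMeasurable μ F ∩ V) ∪ (U ∩ N)) := by
          refine measure_mono fun z hz => ?_
          by_cases hzF : z ∈ toMeasurable μ F
          · exact Or.inl ⟨hzF, hz.1⟩
          · exact Or.inr ⟨hz.2, hzF⟩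
      _ ≤ μ (toMeasurable μ F ∩ V) + μ (U ∩ N) := measure_union_le _ _
      _ = μ (U ∩ N) := by rw [h5, zero_add]
  have h6 := ENNReal.toReal_mono (ENNReal.mul_ne_top ENNReal.ofReal_ne_top (measure_ne_top μ U))
    (h4.trans h3)
  rwa [ENNReal.toReal_mul, ENNReal.toReal_ofReal hε.le] at h6

end Density

/-! ### Decomposition into cells and construction of the centre data. -/

section Cells
variable {n : ℕ}

/-- The points of `G` whose shape is close to a given one, whose truncated integrals oscillate little
below the scale `1 / (l + 1)`, and at which `G` is dense along ellipsoids below that scale. -/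
def subcell (m : ℕ) (μ : Measure (Euc n)) (B : Euc n → (Euc n →L[ℝ] Euc n)ˣ)
    (q : (Euc n →L[ℝ] Euc n)ˣ) (j l : ℕ) (G : Set (Euc n)) : Set (Euc n) :=
  {b | b ∈ G ∧ ‖(B b * q⁻¹ : Euc n →L[ℝ] Euc n) - 1‖ ≤ 1 / (4 * (j + 1)) ∧
    (∀ s t : ℝ, 0 < s → s < 1 / (l + 1) → 0 < t → t < 1 / (l + 1) →
      ‖ellTrunc m μ (B b) b s - ellTrunc m μ (B b) b t‖ ≤ 1 / (j + 1)) ∧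
    ∀ s : ℝ, 0 < s → s < 1 / (l + 1) → ∀ V, MeasurableSet V → Disjoint V G →
      μ.real (V ∩ ellipsoid (B b : Euc n →L[ℝ] Euc n) b s) ≤
        1 / (j + 1) * μ.real (ellipsoid (B b : Euc n →L[ℝ] Euc n) b s)}

/-- The points at which the `m`-dimensional lower bound of the measure holds with constant and scale
`1 / (l + 1)`. -/
def lowerRegularSet (m : ℕ) (μ : Measure (Euc n)) (l : ℕ) : Set (Euc n) :=
  {b | ∀ r : ℝ, 0 < r → r < 1 / (l + 1) → r ^ m ≤ (l + 1) * μ.real (Metric.closedBall b r)}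

/-- Iterated subcells, indexed by lists. -/
def cell (m : ℕ) (μ : Measure (Euc n)) (B : Euc n → (Euc n →L[ℝ] Euc n)ˣ)
    (Q : ℕ → (Euc n →L[ℝ] Euc n)ˣ) (l₀ : ℕ) : List (ℕ × ℕ) → Set (Euc n)
  | [] => lowerRegularSet m μ l₀
  | p :: σ => subcell m μ B (Q p.1) σ.length p.2 (cell m μ B Q l₀ σ)

variable {m : ℕ} {μ : Measure (Euc n)} {B : Euc n → (Euc n →L[ℝ] Euc n)ˣ}
  {Q : ℕ → (Euc n →L[ℝ] Euc n)ˣ}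

theorem exists_cell_sequence {l₀ : ℕ} {a : Euc n} (h0 : a ∈ lowerRegularSet m μ l₀)
    (h : ∀ σ, a ∈ cell m μ B Q l₀ σ → ∃ i l, a ∈ cell m μ B Q l₀ ((i, l) :: σ)) :
    ∃ (G : ℕ → Set (Euc n)) (i l : ℕ → ℕ), G 0 = lowerRegularSet m μ l₀ ∧ (∀ k, a ∈ G k) ∧
      ∀ k, G (k + 1) = subcell m μ B (Q (i k)) k (l k) (G k) := by
  choose! i l hil using h
  let σ : ℕ → List (ℕ × ℕ) := fun k => Nat.rec [] (fun _ s => (i s, l s) :: s) k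
  have hσ : ∀ k, σ (k + 1) = (i (σ k), l (σ k)) :: σ k := fun k => rfl
  have hlen : ∀ k, (σ k).length = k := by
    intro k
    induction k with
    | zero => rfl
    | succ k ih => rw [hσ, List.length_cons, ih]
  refine ⟨fun k => cell m μ B Q l₀ (σ k), fun k => i (σ k), fun k => l (σ k), rfl, fun k => ?_,
    fun k => ?_⟩
  · induction k with
    | zero => exact h0
    | succ k ih => exact hil _ ih
  · simp only [hσ, cell, hlen]

variable [IsFiniteMeasure μ]

theorem ae_exists_mem_subcell
    (hQ : ∀ δ : ℝ, 0 < δ → ∀ B : (Euc n →L[ℝ] Euc n)ˣ,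
      ∃ i, ‖(B * (Q i)⁻¹ : Euc n →L[ℝ] Euc n) - 1‖ < δ)
    (hosc : ∀ᵐ a ∂μ, ∀ ε > 0, ∃ ρ > 0, ∀ s t : ℝ, 0 < s → s < ρ → 0 < t → t < ρ →
      ‖ellTrunc m μ (B a) a s - ellTrunc m μ (B a) a t‖ ≤ ε) (j : ℕ) (G : Set (Euc n)) :
    ∀ᵐ a ∂μ, a ∈ G → ∃ i l, a ∈ subcell m μ B (Q i) j l G := by
  have hε : (0 : ℝ) < 1 / (j + 1) := by positivity
  filter_upwards [hosc, ae_density_ellipsoid μ B G hε] with a h1 h2 haG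
  obtain ⟨ρ₁, hρ₁, h1⟩ := h1 _ hε
  obtain ⟨ρ₂, hρ₂, h2⟩ := h2 haG
  obtain ⟨i, hi⟩ := hQ (1 / (4 * (j + 1))) (by positivity) (B a)
  obtain ⟨l, hl⟩ := exists_nat_one_div_lt (lt_min hρ₁ hρ₂)
  have hl1 := hl.trans_le (min_le_left _ _)
  have hl2 := hl.trans_le (min_le_right _ _)
  exact ⟨i, l, haG, hi.le, fun s t hs0 hs1 ht0 ht1 => h1 s t hs0 (hs1.trans hl1) ht0 (ht1.trans hl1),
    fun s hs0 hs1 => h2 s hs0 (hs1.trans hl2)⟩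

/-- With w = u v⁻¹ - 1 one has w = (u q⁻¹ - 1) - (v q⁻¹ - 1) - w (v q⁻¹ - 1), and the last term is
absorbed on the left. -/
theorem norm_mul_inv_sub_one_le {R : Type*} [NormedRing R] [NormOneClass R] (u v q : Rˣ) {δ : ℝ}
    (hδ : δ ≤ 1 / 4) (hu : ‖(u * q⁻¹ : R) - 1‖ ≤ δ) (hv : ‖(v * q⁻¹ : R) - 1‖ ≤ δ) :
    ‖(u * v⁻¹ : R) - 1‖ ≤ 4 * δ := by
  set w : R := (u * v⁻¹ : R) - 1 with hw
  have h0 : 0 ≤ δ := (norm_nonneg _).trans hu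
  have hvq : (u * v⁻¹ : R) * (v * q⁻¹ : R) = u * q⁻¹ := by
    rw [mul_assoc, ← mul_assoc (v⁻¹ : Rˣ).val, Units.inv_mul, one_mul]
  have h1 : w = ((u * q⁻¹ : R) - 1) - ((v * q⁻¹ : R) - 1) - w * ((v * q⁻¹ : R) - 1) := by
    have : w * (v * q⁻¹ : R) = u * q⁻¹ - v * q⁻¹ := by
      rw [hw, sub_mul, hvq, one_mul]
    rw [mul_sub, this, mul_one]
    abel
  have h2 : ‖w‖ ≤ δ + δ + ‖w‖ * δ := by
    calc ‖w‖ = ‖((u * q⁻¹ : R) - 1) - ((v * q⁻¹ : R) - 1) - w * ((v * q⁻¹ : R) - 1)‖ := by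
          rw [← h1]
      _ ≤ ‖((u * q⁻¹ : R) - 1) - ((v * q⁻¹ : R) - 1)‖ + ‖w * ((v * q⁻¹ : R) - 1)‖ :=
          norm_sub_le _ _
      _ ≤ (‖(u * q⁻¹ : R) - 1‖ + ‖(v * q⁻¹ : R) - 1‖) + ‖w‖ * ‖(v * q⁻¹ : R) - 1‖ :=
          add_le_add (norm_sub_le _ _) (norm_mul_le _ _)
      _ ≤ δ + δ + ‖w‖ * δ := by gcongr
  nlinarith [norm_nonneg w]

/-- The change of variables z ↦ B(a)(z - a) makes the shape at a the identity and carries ellipsoids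
and truncated integrals to those of the shapes B(ψ b) B(a)⁻¹, which are near 1 since both factors
are near the same `Q i`. -/
theorem centerData_of_cells {l₀ : ℕ} {a : Euc n} {G : ℕ → Set (Euc n)} {i l : ℕ → ℕ}
    (hG0 : G 0 = lowerRegularSet m μ l₀) (ha : ∀ k, a ∈ G k)
    (hG : ∀ k, G (k + 1) = subcell m μ B (Q (i k)) k (l k) (G k)) :
    ∃ F A c ρ, CenterData m (μ.map (fun z => (B a : Euc n →L[ℝ] Euc n) (z - a))) F A c ρ := by
  have hanti : Antitone G := antitone_nat_of_succ_le fun k => by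
    rw [hG]; exact fun b hb => hb.1
  set D : Euc n →L[ℝ] Euc n := (B a : Euc n →L[ℝ] Euc n) with hD
  set D' : Euc n →L[ℝ] Euc n := ((B a)⁻¹ : (Euc n →L[ℝ] Euc n)ˣ).val with hD'
  have hD'D : ∀ v, D' (D v) = v := fun v => by
    rw [← mul_apply_eq_comp, hD, hD', Units.inv_mul, one_apply_eq_self]
  have hDD' : ∀ v, D (D' v) = v := fun v => by
    rw [← mul_apply_eq_comp, hD, hD', Units.mul_inv, one_apply_eq_self]
  set φ : Euc n → Euc n := fun z => D (z - a) with hφ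
  set ψ : Euc n → Euc n := fun b => a + D' b with hψ
  have hφψ : ∀ b, φ (ψ b) = b := fun b => by simp [hφ, hψ, hDD']
  have hφm : Measurable φ := by fun_prop
  set A : Euc n → Euc n →L[ℝ] Euc n := fun b => (B (ψ b) * (B a)⁻¹ : Euc n →L[ℝ] Euc n) with hA
  have hAφ : ∀ b z, A b (φ z - b) = (B (ψ b) : Euc n →L[ℝ] Euc n) (z - ψ b) := by
    intro b z
    have h1 : φ z - b = D (z - ψ b) := by
      conv_lhs => rw [← hφψ b]
      rw [hφ]
      simp only [← map_sub]
      congr 1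
      abel
    rw [h1, hA]
    simp only [mul_apply_eq_comp]
    rw [← hD', hD'D]
  have hψ0 : ψ 0 = a := by simp [hψ]
  have hellm : ∀ b s, MeasurableSet (ellipsoid (A b) b s) := fun b s =>
    (isClosed_ellipsoid _ _ _).measurableSet
  have hell : ∀ b s, φ ⁻¹' ellipsoid (A b) b s =
      ellipsoid (B (ψ b) : Euc n →L[ℝ] Euc n) (ψ b) s := by
    intro b s
    ext z
    simp only [ellipsoid, Set.mem_preimage, Set.mem_ofPred_eq, hAφ]
  have htr : ∀ b s, ellTrunc m (μ.map φ) (A b) b s = ellTrunc m μ (B (ψ b)) (ψ b) s := by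
    intro b s
    have h1 : MeasurableSet {z | s ≤ ‖A b (z - b)‖} :=
      (isClosed_le (by fun_prop) (by fun_prop)).measurableSet
    have h2 : Measurable fun z => rieszKernel m (A b (z - b)) :=
      (measurable_rieszKernel m).comp (by fun_prop)
    rw [ellTrunc, setIntegral_map h1 h2.aestronglyMeasurable hφm.aemeasurable]
    simp only [hAφ]
    congr 2
    ext z
    simp only [Set.mem_preimage, Set.mem_ofPred_eq, hAφ]
  have hmem : ∀ k b, ψ b ∈ G (k + 1) → ψ b ∈ subcell m μ B (Q (i k)) k (l k) (G k) := by
    intro k b hb; rwa [hG] at hb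
  set c : ℝ := 1 / ((l₀ + 1) * (‖D‖ + 1) ^ m) with hc
  -- The index is shifted because `G 0` carries only the lower density; shape and oscillation start
  -- at `G 1`.
  refine ⟨fun j => {b | ψ b ∈ G (j + 1)}, A, c, fun j => min (1 / (l j + 1)) (1 / (l₀ + 1)),
    ?_, ?_, ?_, ?_, ?_, ?_, ?_, ?_, ?_⟩
  · exact fun j k hjk b hb => hanti (Nat.succ_le_succ hjk) hb
  · intro j
    show ψ 0 ∈ G (j + 1)
    rw [hψ0]
    exact ha _
  · rw [hA]
    simp only [hψ0, Units.mul_inv]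
  · positivity
  · intro j
    positivity
  · intro j b hb
    have h1 := (hmem j b hb).2.1
    have h2 : a ∈ subcell m μ B (Q (i j)) j (l j) (G j) := by rw [← hG]; exact ha _
    have h4 : (1 : ℝ) / (4 * (j + 1)) ≤ 1 / 4 := by
      apply one_div_le_one_div_of_le (by norm_num)
      have : (0 : ℝ) ≤ j := by positivity
      linarith
    -- The identity operator has norm one only on a nontrivial space.
    rcases subsingleton_or_nontrivial (Euc n) with hs | hs
    · have : A b - 1 = 0 := Subsingleton.elim _ _
      rw [this, norm_zero]
      positivity
    · refine (norm_mul_inv_sub_one_le (B (ψ b)) (B a) (Q (i j)) h4 h1 h2.2.1).trans_eq ?_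
      field_simp
  · intro j b hb s t hs0 hs1 ht0 ht1
    rw [htr, htr]
    exact (hmem j b hb).2.2.1 s t hs0 (hs1.trans_le (min_le_left _ _)) ht0
      (ht1.trans_le (min_le_left _ _))
  · intro j b hb r hr0 hr1
    have h1 : ψ b ∈ lowerRegularSet m μ l₀ := by
      rw [← hG0]; exact hanti (Nat.zero_le _) hb
    have hD1 : 1 ≤ ‖D‖ + 1 := by linarith [norm_nonneg D]
    have hr2 : r / (‖D‖ + 1) < 1 / (l₀ + 1) :=
      (div_le_self hr0.le hD1).trans_lt (hr1.trans_le (min_le_right _ _))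
    have h2 := h1 (r / (‖D‖ + 1)) (by positivity) hr2
    have h3 : μ.real (Metric.closedBall (ψ b) (r / (‖D‖ + 1))) ≤
        (μ.map φ).real (Metric.closedBall b r) := by
      rw [map_measureReal_apply hφm Metric.isClosed_closedBall.measurableSet]
      refine measureReal_mono fun z hz => ?_
      rw [mem_closedBall_iff_norm] at hz
      rw [Set.mem_preimage, mem_closedBall_iff_norm]
      have h4 : φ z - b = D (z - ψ b) := by
        conv_lhs => rw [← hφψ b]
        rw [hφ]
        simp only [← map_sub]
        congr 1
        abel
      rw [h4]
      calc ‖D (z - ψ b)‖ ≤ ‖D‖ * ‖z - ψ b‖ := D.le_opNorm _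
        _ ≤ (‖D‖ + 1) * (r / (‖D‖ + 1)) := by gcongr; linarith
        _ = r := by field_simp
    calc c * r ^ m = (l₀ + 1 : ℝ)⁻¹ * (r / (‖D‖ + 1)) ^ m := by
          rw [hc, div_pow]; field_simp
      _ ≤ (l₀ + 1 : ℝ)⁻¹ * ((l₀ + 1) * μ.real (Metric.closedBall (ψ b) (r / (‖D‖ + 1)))) := by
          gcongr
      _ = μ.real (Metric.closedBall (ψ b) (r / (‖D‖ + 1))) := by
          rw [← mul_assoc, inv_mul_cancel₀ (by positivity), one_mul]
      _ ≤ _ := h3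
  · intro j b hb s hs0 hs1 V hV hdisj
    rw [map_measureReal_apply hφm (hV.inter (hellm _ _)), map_measureReal_apply hφm (hellm _ _),
      Set.preimage_inter, hell]
    refine ((hmem (j + 1) b hb).2.2.2 s hs0 (hs1.trans_le (min_le_left _ _)) _ (hφm hV) ?_).trans ?_
    · rw [Set.disjoint_left] at hdisj ⊢
      intro z hz hzG
      refine hdisj hz ?_
      show ψ (φ z) ∈ G (j + 1)
      simpa [hφ, hψ, hD'D] using hzG
    · gcongr
      linarith

/-- Cells depend on earlier choices, but there are countably many finite lists of choices, so a
single null set is discarded; at any remaining point the refinement can be continued forever. -/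
theorem ae_exists_centerData
    (hdens : ∀ᵐ a ∂μ, ∃ l, a ∈ lowerRegularSet m μ l)
    (hosc : ∀ᵐ a ∂μ, ∀ ε > 0, ∃ ρ > 0, ∀ s t : ℝ, 0 < s → s < ρ → 0 < t → t < ρ →
      ‖ellTrunc m μ (B a) a s - ellTrunc m μ (B a) a t‖ ≤ ε) :
    ∀ᵐ a ∂μ, ∃ F A c ρ,
      CenterData m (μ.map (fun z => (B a : Euc n →L[ℝ] Euc n) (z - a))) F A c ρ := by
  obtain ⟨Q, hQ⟩ := exists_denseSeq_units (Euc n)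
  have h : ∀ᵐ a ∂μ, ∀ (l₀ : ℕ) (σ : List (ℕ × ℕ)), a ∈ cell m μ B Q l₀ σ →
      ∃ i l, a ∈ cell m μ B Q l₀ ((i, l) :: σ) :=
    ae_all_iff.2 fun l₀ => ae_all_iff.2 fun σ => ae_exists_mem_subcell hQ hosc _ _
  filter_upwards [hdens, h] with a ⟨l₀, h0⟩ h
  obtain ⟨G, i, l, hG0, ha, hG⟩ := exists_cell_sequence h0 (h l₀)
  exact centerData_of_cells hG0 ha hG

end Cells

/-! ### Blow-up limits: support at the origin and approximation by centres. -/

section BlowUp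
variable {n : ℕ}

/-- `ν` is the vague limit of the blow-ups of `μ` at the origin by the factors `(r i)⁻¹`, normalized
by `c i`. -/
structure IsBlowUpLimit (μ ν : Measure (Euc n)) (c r : ℕ → ℝ) : Prop where
  c_pos : ∀ i, 0 < c i
  r_pos : ∀ i, 0 < r i
  r_tendsto : Tendsto r atTop (𝓝 0)
  tendsto : ∀ f : Euc n → ℝ, Continuous f → HasCompactSupport f →
    Tendsto (fun i => c i * ∫ z, f ((r i)⁻¹ • z) ∂μ) atTop (𝓝 (∫ y, f y ∂ν))

/-- The tent function `max 0 (η - |z - x|)`. -/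
noncomputable def tent (x : Euc n) (η : ℝ) (z : Euc n) : ℝ := max 0 (η - ‖z - x‖)

theorem continuous_tent (x : Euc n) (η : ℝ) : Continuous (tent x η) := by
  unfold tent; fun_prop

theorem tent_nonneg (x : Euc n) (η : ℝ) (z : Euc n) : 0 ≤ tent x η z := le_max_left _ _

theorem tent_eq_zero {x : Euc n} {η : ℝ} {z : Euc n} (h : η ≤ ‖z - x‖) : tent x η z = 0 :=
  max_eq_left (by linarith)

theorem tent_le {x : Euc n} {η : ℝ} (hη : 0 ≤ η) (z : Euc n) : tent x η z ≤ η :=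
  max_le hη (by linarith [norm_nonneg (z - x)])

theorem hasCompactSupport_tent (x : Euc n) (η : ℝ) : HasCompactSupport (tent x η) := by
  refine HasCompactSupport.intro (isCompact_closedBall x η) fun z hz => tent_eq_zero ?_
  rw [mem_closedBall_iff_norm, not_le] at hz
  exact hz.le

theorem integral_tent_pos_iff (ν : Measure (Euc n)) [IsLocallyFiniteMeasure ν] (x : Euc n)
    (η : ℝ) : 0 < ∫ z, tent x η z ∂ν ↔ 0 < ν (Metric.ball x η) := by
  rw [integral_pos_iff_support_of_nonneg (fun z => tent_nonneg x η z)
    ((continuous_tent x η).integrable_of_hasCompactSupport (hasCompactSupport_tent x η))]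
  have : Function.support (tent x η) = Metric.ball x η := by
    ext z
    rw [Function.mem_support, mem_ball_iff_norm]
    constructor
    · intro h
      by_contra h2
      exact h (tent_eq_zero (not_lt.1 h2))
    · intro h
      exact ne_of_gt (lt_max_of_lt_right (by linarith))
  rw [this]

theorem inv_smul_sub_eq {r : ℝ} (hr : 0 < r) (z x : Euc n) :
    r⁻¹ • z - x = r⁻¹ • (z - r • x) := by
  rw [smul_sub, smul_smul, inv_mul_cancel₀ hr.ne', one_smul]

theorem norm_inv_smul_sub {r : ℝ} (hr : 0 < r) (z x : Euc n) :
    ‖r⁻¹ • z - x‖ = r⁻¹ * ‖z - r • x‖ := by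
  rw [inv_smul_sub_eq hr, norm_smul, norm_inv, Real.norm_eq_abs, abs_of_pos hr]

variable {μ ν : Measure (Euc n)} {c r : ℕ → ℝ}

theorem IsBlowUpLimit.eventually_mul_lt (h : IsBlowUpLimit μ ν c r) (R : ℝ) {ρ : ℝ}
    (hρ : 0 < ρ) : ∀ᶠ i in atTop, R * r i < ρ := by
  have : Tendsto (fun i => R * r i) atTop (𝓝 (R * 0)) := h.r_tendsto.const_mul R
  rw [mul_zero] at this
  exact this.eventually_lt_const hρ

variable [IsFiniteMeasure μ]

theorem integrable_tent_dilation (x : Euc n) {η : ℝ} (hη : 0 ≤ η) (r : ℝ) :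
    Integrable (fun z => tent x η (r⁻¹ • z)) μ := by
  have := continuous_tent x η
  refine Integrable.of_bound (C := η) (Continuous.aestronglyMeasurable (by fun_prop))
    (Eventually.of_forall fun z => ?_)
  rw [Real.norm_eq_abs, abs_of_nonneg (tent_nonneg _ _ _)]
  exact tent_le hη _

theorem integral_tent_dilation_le (x : Euc n) {η : ℝ} (hη : 0 ≤ η) {r : ℝ} (hr : 0 < r) :
    ∫ z, tent x η (r⁻¹ • z) ∂μ ≤ η * μ.real (Metric.closedBall (r • x) (η * r)) := by
  have hm : MeasurableSet (Metric.closedBall (r • x) (η * r)) :=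
    Metric.isClosed_closedBall.measurableSet
  have hpt : ∀ z, tent x η (r⁻¹ • z) ≤
      (Metric.closedBall (r • x) (η * r)).indicator (fun _ : Euc n => η) z := by
    intro z
    by_cases hz : z ∈ Metric.closedBall (r • x) (η * r)
    · rw [Set.indicator_of_mem hz]; exact tent_le hη _
    · rw [Set.indicator_of_notMem hz]
      rw [mem_closedBall_iff_norm, not_le] at hz
      refine (tent_eq_zero ?_).le
      rw [norm_inv_smul_sub hr, le_inv_mul_iff₀ hr]
      linarith
  have := integral_mono (integrable_tent_dilation x hη r)
    ((integrable_const η).indicator hm : Integrable _ μ) hpt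
  rwa [integral_indicator hm, setIntegral_const, smul_eq_mul, mul_comm] at this

theorem le_integral_tent_dilation (x : Euc n) {η : ℝ} (hη : 0 ≤ η) (δ : ℝ) {r : ℝ} (hr : 0 < r) :
    (η - δ) * μ.real (Metric.closedBall (r • x) (δ * r)) ≤
      ∫ z, tent x η (r⁻¹ • z) ∂μ := by
  have hm : MeasurableSet (Metric.closedBall (r • x) (δ * r)) :=
    Metric.isClosed_closedBall.measurableSet
  have hpt : ∀ z, (Metric.closedBall (r • x) (δ * r)).indicator (fun _ : Euc n => η - δ) z ≤
      tent x η (r⁻¹ • z) := by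
    intro z
    by_cases hz : z ∈ Metric.closedBall (r • x) (δ * r)
    · rw [Set.indicator_of_mem hz]
      rw [mem_closedBall_iff_norm] at hz
      refine le_max_of_le_right ?_
      rw [norm_inv_smul_sub hr]
      have : r⁻¹ * ‖z - r • x‖ ≤ δ := by
        rw [inv_mul_le_iff₀ hr]; linarith
      linarith
    · rw [Set.indicator_of_notMem hz]
      exact tent_nonneg _ _ _
  have := integral_mono ((integrable_const (η - δ)).indicator hm : Integrable _ μ)
    (integrable_tent_dilation x hη r) hpt
  rwa [integral_indicator hm, setIntegral_const, smul_eq_mul, mul_comm] at this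

theorem IsBlowUpLimit.exists_upper_bound (h : IsBlowUpLimit μ ν c r) {R : ℝ} (hR : 0 ≤ R) :
    ∃ M > 0, ∀ᶠ i in atTop, c i * μ.real (Metric.closedBall 0 (R * r i)) ≤ M := by
  have ht := h.tendsto _ (continuous_tent 0 (R + 1)) (hasCompactSupport_tent 0 (R + 1))
  have h0 : 0 ≤ ∫ y, tent 0 (R + 1) y ∂ν := integral_nonneg fun z => tent_nonneg _ _ _
  refine ⟨∫ y, tent 0 (R + 1) y ∂ν + 1, by linarith, ?_⟩
  filter_upwards [ht.eventually_lt_const (lt_add_one _)] with i hi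
  have h1 := le_integral_tent_dilation (μ := μ) 0 (show 0 ≤ R + 1 by linarith) R (h.r_pos i)
  rw [add_sub_cancel_left, one_mul, smul_zero] at h1
  have := h.c_pos i
  exact (mul_le_mul_of_nonneg_left h1 this.le).trans hi.le

theorem IsBlowUpLimit.exists_lower_bound [IsLocallyFiniteMeasure ν] (h : IsBlowUpLimit μ ν c r)
    {x : Euc n} {η : ℝ} (hη : 0 < η) (hx : 0 < ν (Metric.ball x η)) :
    ∃ κ > 0, ∀ᶠ i in atTop, κ ≤ c i * μ.real (Metric.closedBall (r i • x) (η * r i)) := by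
  have ht := h.tendsto _ (continuous_tent x η) (hasCompactSupport_tent x η)
  have h0 := (integral_tent_pos_iff ν x η).2 hx
  set I := ∫ y, tent x η y ∂ν
  refine ⟨I / 2 / η, by positivity, ?_⟩
  filter_upwards [ht.eventually_const_lt (half_lt_self h0)] with i hi
  have h1 := integral_tent_dilation_le (μ := μ) x hη.le (h.r_pos i)
  have := mul_le_mul_of_nonneg_left h1 (h.c_pos i).le
  rw [div_le_iff₀ hη]
  linarith

theorem IsBlowUpLimit.ball_pos_of_lower_bound [IsLocallyFiniteMeasure ν]
    (h : IsBlowUpLimit μ ν c r) {x : Euc n} {η δ κ : ℝ} (hδ : 0 ≤ δ) (hδη : δ < η) (hκ : 0 < κ)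
    (hx : ∀ᶠ i in atTop, κ ≤ c i * μ.real (Metric.closedBall (r i • x) (δ * r i))) :
    0 < ν (Metric.ball x η) := by
  have ht := h.tendsto _ (continuous_tent x η) (hasCompactSupport_tent x η)
  rw [← integral_tent_pos_iff]
  refine lt_of_lt_of_le (mul_pos (sub_pos.2 hδη) hκ) (ge_of_tendsto ht ?_)
  filter_upwards [hx] with i hi
  have h1 := le_integral_tent_dilation (μ := μ) x (hδ.trans hδη.le) δ (h.r_pos i)
  have h2 := mul_le_mul_of_nonneg_left h1 (h.c_pos i).le
  have h3 := mul_le_mul_of_nonneg_left hi (sub_pos.2 hδη).le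
  linarith

variable {m : ℕ} {F : ℕ → Set (Euc n)} {A : Euc n → Euc n →L[ℝ] Euc n} {c₀ : ℝ} {ρ : ℕ → ℝ}

/-- Some large ball around 0 has positive ν-mass; N doublings pass this mass, up to the factor C^N,
to the ball of radius τ/2 at every small scale, and hence to ν. -/
theorem IsBlowUpLimit.zero_mem_support [IsLocallyFiniteMeasure ν] (h : IsBlowUpLimit μ ν c r)
    (H : CenterData m μ F A c₀ ρ) (hν : ν ≠ 0) : (0 : Euc n) ∈ ν.support := by
  obtain ⟨C, hC, ρ, hρ, hdoub⟩ := H.exists_measure_ball_le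
  have hiter : ∀ (N : ℕ) (s : ℝ), 0 < s → 4 ^ N * s < ρ →
      μ.real (Metric.closedBall 0 (4 ^ N * s)) ≤ C ^ N * μ.real (Metric.closedBall 0 s) := by
    intro N
    induction N with
    | zero => intro s _ _; simp
    | succ N ih =>
      intro s hs hsρ
      have h4 : (4 : ℝ) ^ (N + 1) * s = 4 * (4 ^ N * s) := by ring
      have hpos : 0 < (4 : ℝ) ^ N * s := by positivity
      rw [h4] at hsρ ⊢
      refine (hdoub _ hpos (by linarith)).trans ?_
      rw [pow_succ', mul_assoc]
      gcongr
      exact ih s hs (by linarith)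
  rw [Measure.mem_support_iff_forall]
  intro U hU
  obtain ⟨τ, hτ, hball⟩ := Metric.mem_nhds_iff.1 hU
  refine lt_of_lt_of_le ?_ (measure_mono hball)
  obtain ⟨N, hN⟩ : ∃ N : ℕ, 0 < ν (Metric.ball 0 (4 ^ N * (τ / 2))) := by
    by_contra hcon
    push Not at hcon
    apply hν
    rw [← Measure.measure_univ_eq_zero]
    have huniv : (Set.univ : Set (Euc n)) ⊆ ⋃ N : ℕ, Metric.ball 0 (4 ^ N * (τ / 2)) := by
      intro z _
      obtain ⟨N, hN⟩ := pow_unbounded_of_one_lt (‖z‖ / (τ / 2)) (by norm_num : (1 : ℝ) < 4)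
      rw [div_lt_iff₀ (by positivity)] at hN
      exact Set.mem_iUnion.2 ⟨N, by rwa [mem_ball_zero_iff]⟩
    exact measure_mono_null huniv (measure_iUnion_null fun N => le_antisymm (hcon N) zero_le)
  obtain ⟨κ, hκ, hlow⟩ := h.exists_lower_bound (by positivity) hN
  refine h.ball_pos_of_lower_bound (δ := τ / 2) (κ := κ / C ^ N) (by positivity) (by linarith)
    (by positivity) ?_
  filter_upwards [hlow, h.eventually_mul_lt (4 ^ N * (τ / 2)) hρ] with i h1 h2
  rw [smul_zero] at h1 ⊢
  have hri := h.r_pos i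
  have hci := h.c_pos i
  rw [mul_assoc] at h1 h2
  have h3 := mul_le_mul_of_nonneg_left (hiter N (τ / 2 * r i) (by positivity) h2) hci.le
  rw [div_le_iff₀ (by positivity)]
  linarith

/-- The normalised mass near x stays above κ. If that ball missed F K, density of F K at the origin
would bound it by M / (K + 1), which is below κ for large K. -/
theorem IsBlowUpLimit.eventually_exists_center [IsLocallyFiniteMeasure ν]
    (h : IsBlowUpLimit μ ν c r) (H : CenterData m μ F A c₀ ρ) {x : Euc n} (hx : x ∈ ν.support)
    {η : ℝ} (hη : 0 < η) (hη1 : η ≤ 1) (j : ℕ) :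
    ∀ᶠ i in atTop, ∃ b, r i • b ∈ F j ∧ ‖b - x‖ ≤ η := by
  obtain ⟨κ, hκ, hlow⟩ := h.exists_lower_bound hη
    ((Measure.mem_support_iff_forall x).1 hx _ (Metric.ball_mem_nhds x hη))
  obtain ⟨M, hM, hup⟩ := h.exists_upper_bound (R := ‖x‖ + 1) (by positivity)
  obtain ⟨J, hJ⟩ := exists_nat_one_div_lt (show 0 < κ / M by positivity)
  set K := max j J with hK
  filter_upwards [hlow, hup, h.eventually_mul_lt (‖x‖ + 1) (H.ρ_pos (K + 1))]
    with i h1 h2 h3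
  by_contra hcon
  push Not at hcon
  have hri := h.r_pos i
  have hci := h.c_pos i
  have hdisj : Disjoint (Metric.closedBall (r i • x) (η * r i)) (F K) := by
    rw [Set.disjoint_left]
    intro z hz hzF
    rw [mem_closedBall_iff_norm] at hz
    have h4 := hcon ((r i)⁻¹ • z) (by
      rw [smul_smul, mul_inv_cancel₀ hri.ne', one_smul]
      exact H.antitone (le_max_left j J) hzF)
    rw [norm_inv_smul_sub hri, lt_inv_mul_iff₀ hri] at h4
    linarith
  have h5 := H.dense K 0 (H.zero_mem _) ((‖x‖ + 1) * r i) (by positivity) h3 _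
    Metric.isClosed_closedBall.measurableSet hdisj
  have hell : ellipsoid (A 0) 0 ((‖x‖ + 1) * r i) = Metric.closedBall 0 ((‖x‖ + 1) * r i) := by
    ext z
    simp [ellipsoid, H.shape_zero]
  rw [hell, Set.inter_eq_left.2] at h5
  · have h6 : 1 / ((K : ℝ) + 1) < κ / M := by
      refine lt_of_le_of_lt ?_ hJ
      have : (J : ℝ) ≤ K := by exact_mod_cast le_max_right j J
      gcongr
    rw [lt_div_iff₀ hM] at h6
    have h7 := mul_le_mul_of_nonneg_left h5 hci.le
    have h8 : 1 / ((K : ℝ) + 1) * (c i * μ.real (Metric.closedBall 0 ((‖x‖ + 1) * r i))) ≤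
        1 / ((K : ℝ) + 1) * M := by gcongr
    linarith
  · refine Metric.closedBall_subset_closedBall' ?_
    rw [dist_zero_right, norm_smul, Real.norm_eq_abs, abs_of_pos hri]
    nlinarith

/-- This keeps the symmetry errors, of order r^m, bounded after normalisation; it plays the role of
an upper density bound. -/
theorem IsBlowUpLimit.exists_mul_pow_le (h : IsBlowUpLimit μ ν c r)
    (H : CenterData m μ F A c₀ ρ) : ∃ M > 0, ∀ᶠ i in atTop, c i * r i ^ m ≤ M := by
  obtain ⟨M, hM, hup⟩ := h.exists_upper_bound (R := 1) zero_le_one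
  have hc₀ := H.c_pos
  refine ⟨M / c₀, by positivity, ?_⟩
  filter_upwards [hup, h.eventually_mul_lt 1 (H.ρ_pos 0)] with i h1 h2
  rw [one_mul] at h1 h2
  have h3 := mul_le_mul_of_nonneg_left (H.low 0 0 (H.zero_mem 0) (r i) (h.r_pos i) h2)
    (h.c_pos i).le
  rw [le_div_iff₀ hc₀]
  linarith

end BlowUp

/-! ### Near-symmetry passes to the limit. -/

section Symmetry
variable {n m : ℕ} {μ ν : Measure (Euc n)} [IsFiniteMeasure μ] {F : ℕ → Set (Euc n)}
  {A : Euc n → Euc n →L[ℝ] Euc n} {c₀ : ℝ} {ρ : ℕ → ℝ} {c r : ℕ → ℝ}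

theorem CenterData.norm_integral_radial_dilation_le (H : CenterData m μ F A c₀ ρ) {j : ℕ} {b : Euc n}
    {r : ℝ} (hr : 0 < r) (hb : r • b ∈ F j) {f : ℝ → ℝ} (hf : ContDiff ℝ 1 f) {R : ℝ} (hR : 0 < R)
    (hfR : ∀ t ≥ R, f t = 0) (hRρ : R * r < ρ j) {C : ℝ}
    (hC : ∀ t ∈ Set.Icc 0 R, |(m + 1) * f t + t * deriv f t| ≤ C) :
    ‖∫ z, f ‖A (r • b) (r⁻¹ • z - b)‖ • A (r • b) (r⁻¹ • z - b) ∂μ‖ ≤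
      C * R ^ (m + 1) * r ^ m * (1 / (j + 1)) := by
  have hd : ∀ t : ℝ, HasDerivAt (fun t => f (t / r)) (deriv f (t / r) * (1 / r)) t := by
    intro t
    have h1 : HasDerivAt (fun t : ℝ => t / r) (1 / r) t := (hasDerivAt_id t).div_const r
    exact (hf.differentiable one_ne_zero (t / r)).hasDerivAt.comp t h1
  have hc : Continuous fun t => deriv f (t / r) * (1 / r) :=
    ((hf.continuous_deriv le_rfl).comp (by fun_prop)).mul continuous_const
  have h1 := H.norm_integral_radial_le hb hd hc (R := R * r) (by positivity) hRρ
    (by rw [mul_div_cancel_right₀ _ hr.ne']; exact hfR R le_rfl) (C := C) (fun t h0 h1 => by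
      have := hC (t / r) ⟨by positivity, (div_le_iff₀ hr).2 h1⟩
      convert this using 3
      field_simp)
  have hm : MeasurableSet (ellipsoid (A (r • b)) (r • b) (R * r)) :=
    (isClosed_ellipsoid _ _ _).measurableSet
  have h2 : ∫ z, f ‖A (r • b) (r⁻¹ • z - b)‖ • A (r • b) (r⁻¹ • z - b) ∂μ =
      r⁻¹ • ∫ z in ellipsoid (A (r • b)) (r • b) (R * r),
        f (‖A (r • b) (z - r • b)‖ / r) • A (r • b) (z - r • b) ∂μ := by
    rw [← integral_smul, ← integral_indicator hm]
    refine integral_congr_ae (Eventually.of_forall fun z => ?_)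
    simp only
    rw [inv_smul_sub_eq hr, map_smul, norm_smul, norm_inv, Real.norm_eq_abs, abs_of_pos hr,
      inv_mul_eq_div]
    by_cases hz : z ∈ ellipsoid (A (r • b)) (r • b) (R * r)
    · rw [Set.indicator_of_mem hz, smul_comm]
    · rw [Set.indicator_of_notMem hz, hfR, zero_smul]
      have h3 : R * r < ‖A (r • b) (z - r • b)‖ := not_le.1 hz
      exact (le_div_iff₀ hr).2 h3.le
  rw [h2, norm_smul, norm_inv, Real.norm_eq_abs, abs_of_pos hr, inv_mul_le_iff₀ hr]
  refine h1.trans_eq ?_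
  rw [mul_pow, pow_succ r]
  ring

/-- At a centre r b with b near x the integral is small after normalisation. Uniform continuity of
the test function allows b and its nearly round shape to be replaced by x and the identity, at a
cost proportional to the bounded normalised mass of a fixed ball. -/
theorem IsBlowUpLimit.integral_radial_eq_zero [IsLocallyFiniteMeasure ν]
    (h : IsBlowUpLimit μ ν c r) (H : CenterData m μ F A c₀ ρ) {x : Euc n} (hx : x ∈ ν.support)
    {f : ℝ → ℝ} (hf : ContDiff ℝ 1 f) {R : ℝ} (hR : 0 < R) (hfR : ∀ t ≥ R, f t = 0) (e : Euc n) :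
    ∫ z, f ‖z - x‖ * inner ℝ (z - x) e ∂ν = 0 := by
  obtain ⟨C, hC⟩ : ∃ C, ∀ t ∈ Set.Icc 0 R, |(m + 1) * f t + t * deriv f t| ≤ C := by
    have hcont : Continuous fun t : ℝ => ((m : ℝ) + 1) * f t + t * deriv f t := by
      have := hf.continuous
      have := hf.continuous_deriv le_rfl
      fun_prop
    exact isCompact_Icc.exists_bound_of_continuousOn hcont.continuousOn
  have hC0 : 0 ≤ C := (abs_nonneg _).trans (hC 0 ⟨le_rfl, hR.le⟩)
  set G : Euc n → Euc n := fun v => f ‖v‖ • v with hG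
  have hGc : Continuous G := by
    have := hf.continuous
    fun_prop
  have hG0 : ∀ v, R ≤ ‖v‖ → G v = 0 := fun v hv => by simp only [hG, hfR _ hv, zero_smul]
  have hGs : HasCompactSupport G := by
    refine HasCompactSupport.intro (isCompact_closedBall 0 R) fun v hv => hG0 v ?_
    rw [mem_closedBall_zero_iff, not_le] at hv
    exact hv.le
  set g : Euc n → ℝ := fun v => inner ℝ (G v) e with hg
  have hgc : Continuous g := by fun_prop
  have hgs : HasCompactSupport g := hGs.comp_left (g := fun v => inner ℝ v e) (inner_zero_left e)
  have hgu := hgs.uniformContinuous_of_continuous hgc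
  obtain ⟨CG, hCG⟩ := hGc.bounded_above_of_compact_support hGs
  have hgx : HasCompactSupport fun z => g (z - x) := by
    have := hgs.comp_homeomorph (Homeomorph.subRight x)
    exact this
  have ht := h.tendsto (fun z => g (z - x)) (by fun_prop) hgx
  -- For |y| > R' both test functions vanish: |y - x| ≥ R, and |D(y - b)| ≥ |y - b|/2 ≥ R since |b|
  -- ≤ |x| + 1.
  set R' := 2 * R + ‖x‖ + 1 with hR'
  obtain ⟨M₁, hM₁, hup⟩ := h.exists_upper_bound (R := R') (by positivity)
  obtain ⟨M₂, hM₂, hpow⟩ := h.exists_mul_pow_le H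
  have key : ∀ ε > 0, |∫ z, g (z - x) ∂ν| ≤ ε * (C * R ^ (m + 1) * M₂ * ‖e‖ + M₁) := by
    intro ε hε
    obtain ⟨δ, hδ, hgδ⟩ := Metric.uniformContinuous_iff.1 hgu ε hε
    obtain ⟨j, hj⟩ := exists_nat_one_div_lt
      (show 0 < min ε (min (1 / 2) (δ / (2 * (R' + ‖x‖ + 2)))) by positivity)
    set θ : ℝ := 1 / ((j : ℝ) + 1) with hθ
    have hθ0 : 0 ≤ θ := by positivity
    have hj1 : θ ≤ ε := hj.le.trans (min_le_left _ _)
    have hj2 : θ ≤ 1 / 2 := hj.le.trans ((min_le_right _ _).trans (min_le_left _ _))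
    have hj3 : θ ≤ δ / (2 * (R' + ‖x‖ + 2)) :=
      hj.le.trans ((min_le_right _ _).trans (min_le_right _ _))
    rw [le_div_iff₀ (by positivity)] at hj3
    refine le_of_tendsto ht.abs ?_
    filter_upwards [hup, hpow, h.eventually_mul_lt R (H.ρ_pos j),
      h.eventually_exists_center H hx (η := min 1 (δ / 4)) (by positivity) (min_le_left _ _) j]
      with i h1 h2 h3 ⟨b, hbF, hbx⟩
    have hri := h.r_pos i
    have hci := h.c_pos i
    have hbx1 : ‖b - x‖ ≤ 1 := hbx.trans (min_le_left _ _)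
    have hbx2 : ‖b - x‖ ≤ δ / 4 := hbx.trans (min_le_right _ _)
    have hbn : ‖b‖ ≤ ‖x‖ + 1 := by
      have := norm_sub_norm_le b x
      linarith
    set D := A (r i • b) with hD
    have hDn : ‖D - 1‖ ≤ θ := H.shape j _ hbF
    have hI1 := H.norm_integral_radial_dilation_le hri hbF hf hR hfR h3 hC
    have iG : Integrable (fun z => G (D ((r i)⁻¹ • z - b))) μ :=
      Integrable.of_bound (Continuous.aestronglyMeasurable (by fun_prop)) CG
        (Eventually.of_forall fun z => hCG _)
    have ig : Integrable (fun z => g (D ((r i)⁻¹ • z - b))) μ := iG.inner_const e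
    have igx : Integrable (fun z => g ((r i)⁻¹ • z - x)) μ := by
      refine Integrable.inner_const (f := fun z => G ((r i)⁻¹ • z - x)) ?_ e
      exact Integrable.of_bound (Continuous.aestronglyMeasurable (by fun_prop)) CG
        (Eventually.of_forall fun z => hCG _)
    have hb1 : |∫ z, g (D ((r i)⁻¹ • z - b)) ∂μ| ≤ C * R ^ (m + 1) * r i ^ m * θ * ‖e‖ := by
      have e1 : ∫ z, g (D ((r i)⁻¹ • z - b)) ∂μ = inner ℝ (∫ z, G (D ((r i)⁻¹ • z - b)) ∂μ) e := by
        rw [real_inner_comm, ← integral_inner iG]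
        simp only [hg, real_inner_comm e]
      rw [e1]
      refine (abs_real_inner_le_norm _ _).trans ?_
      gcongr
    have hm : MeasurableSet (Metric.closedBall (0 : Euc n) (R' * r i)) :=
      Metric.isClosed_closedBall.measurableSet
    have hb2 : |∫ z, (g ((r i)⁻¹ • z - x) - g (D ((r i)⁻¹ • z - b))) ∂μ| ≤
        ε * μ.real (Metric.closedBall 0 (R' * r i)) := by
      have hle := norm_integral_le_of_norm_le (μ := μ)
        (f := fun z => g ((r i)⁻¹ • z - x) - g (D ((r i)⁻¹ • z - b)))
        (((integrable_const ε).indicator hm : Integrable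
          ((Metric.closedBall (0 : Euc n) (R' * r i)).indicator fun _ => ε) μ))
        (Eventually.of_forall fun z => ?_)
      · rwa [integral_indicator hm, setIntegral_const, smul_eq_mul, mul_comm,
          Real.norm_eq_abs] at hle
      · set y := (r i)⁻¹ • z with hy
        have hyn : ‖y‖ = (r i)⁻¹ * ‖z‖ := by
          have := norm_inv_smul_sub hri z 0
          rwa [sub_zero, smul_zero, sub_zero] at this
        have hyb : ‖y - b‖ ≤ ‖y‖ + ‖b‖ := norm_sub_le _ _
        by_cases hz : z ∈ Metric.closedBall (0 : Euc n) (R' * r i)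
        · rw [Set.indicator_of_mem hz]
          rw [mem_closedBall_zero_iff] at hz
          have hy1 : ‖y‖ ≤ R' := by
            rw [hyn, inv_mul_le_iff₀ hri]; linarith
          refine (le_of_lt (hgδ ?_ : dist (g (y - x)) (g (D (y - b))) < ε))
          rw [dist_eq_norm]
          have e2 : y - x - D (y - b) = (b - x) - (D - 1) (y - b) := by
            rw [sub_apply, one_apply_eq_self]; abel
          rw [e2]
          calc ‖(b - x) - (D - 1) (y - b)‖ ≤ ‖b - x‖ + ‖(D - 1) (y - b)‖ := norm_sub_le _ _
            _ ≤ δ / 4 + θ * (R' + ‖x‖ + 2) := by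
                gcongr
                refine ((D - 1).le_opNorm _).trans ?_
                gcongr
                linarith
            _ < δ := by linarith
        · rw [Set.indicator_of_notMem hz]
          rw [mem_closedBall_zero_iff, not_le] at hz
          have hy1 : R' < ‖y‖ := by
            rw [hyn, lt_inv_mul_iff₀ hri]; linarith
          have hx1 := norm_sub_norm_le y x
          have hb3 := norm_sub_norm_le y b
          have hD2 := norm_le_two_mul_norm_apply hDn hj2 (y - b)
          have z1 : G (y - x) = 0 := hG0 _ (by linarith)
          have z2 : G (D (y - b)) = 0 := hG0 _ (by linarith)
          simp only [hg, z1, z2, sub_self, norm_zero, le_refl]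
    rw [integral_sub igx ig] at hb2
    set I2 := ∫ z, g ((r i)⁻¹ • z - x) ∂μ
    set I1 := ∫ z, g (D ((r i)⁻¹ • z - b)) ∂μ
    have hI2 : |I2| ≤ C * R ^ (m + 1) * r i ^ m * θ * ‖e‖ +
        ε * μ.real (Metric.closedBall 0 (R' * r i)) := by
      have : |I2| ≤ |I2 - I1| + |I1| := by
        have := abs_add_le (I2 - I1) I1
        simpa using this
      linarith
    calc |c i * I2| = c i * |I2| := by rw [abs_mul, abs_of_pos hci]
      _ ≤ c i * (C * R ^ (m + 1) * r i ^ m * θ * ‖e‖ +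
          ε * μ.real (Metric.closedBall 0 (R' * r i))) := by gcongr
      _ = θ * (C * R ^ (m + 1) * (c i * r i ^ m) * ‖e‖) +
          ε * (c i * μ.real (Metric.closedBall 0 (R' * r i))) := by ring
      _ ≤ ε * (C * R ^ (m + 1) * M₂ * ‖e‖) + ε * M₁ := by gcongr
      _ = _ := by ring
  have hgeq : ∀ z, f ‖z - x‖ * inner ℝ (z - x) e = g (z - x) := fun z => by
    simp only [hg, hG, real_inner_smul_left]
  simp only [hgeq]
  set L := C * R ^ (m + 1) * M₂ * ‖e‖ + M₁ with hL
  have hL0 : 0 < L := by positivity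
  by_contra hne
  have hpos : 0 < |∫ z, g (z - x) ∂ν| := abs_pos.2 hne
  have := key (|∫ z, g (z - x) ∂ν| / (2 * L)) (by positivity)
  have e3 : |∫ z, g (z - x) ∂ν| / (2 * L) * L = |∫ z, g (z - x) ∂ν| / 2 := by field_simp
  rw [e3] at this
  linarith

end Symmetry

/-! ### From smooth radial profiles to balls and annuli. -/

section Limits
variable {n : ℕ} {ν : Measure (Euc n)} [IsLocallyFiniteMeasure ν] {x : Euc n}

theorem integral_radial_eq_zero_of_tendsto
    (hsym : ∀ (f : ℝ → ℝ), ContDiff ℝ 1 f → ∀ R > 0, (∀ t ≥ R, f t = 0) → ∀ e : Euc n,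
      ∫ z, f ‖z - x‖ * inner ℝ (z - x) e ∂ν = 0)
    {f : ℕ → ℝ → ℝ} {g : ℝ → ℝ} {R C : ℝ} (hR : 0 < R) (hf : ∀ k, ContDiff ℝ 1 (f k))
    (hfR : ∀ k, ∀ t ≥ R, f k t = 0) (hC : ∀ k, ∀ t ≥ 0, |f k t| ≤ C)
    (hfg : ∀ t ≥ 0, Tendsto (fun k => f k t) atTop (𝓝 (g t))) (e : Euc n) :
    ∫ z, g ‖z - x‖ * inner ℝ (z - x) e ∂ν = 0 := by
  have hC0 : 0 ≤ C := (abs_nonneg _).trans (hC 0 0 le_rfl)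
  have hm : MeasurableSet (Metric.closedBall x R) := Metric.isClosed_closedBall.measurableSet
  have hfin : ν (Metric.closedBall x R) < ∞ := (isCompact_closedBall x R).measure_lt_top
  have hlim := tendsto_integral_of_dominated_convergence (μ := ν)
    (F := fun k z => f k ‖z - x‖ * inner ℝ (z - x) e)
    (f := fun z => g ‖z - x‖ * inner ℝ (z - x) e)
    ((Metric.closedBall x R).indicator fun _ => C * (R * ‖e‖)) ?_ ?_ ?_ ?_
  · simp only [hsym _ (hf _) R hR (hfR _) e] at hlim
    exact tendsto_nhds_unique hlim tendsto_const_nhds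
  · intro k
    have := (hf k).continuous
    exact Continuous.aestronglyMeasurable (by fun_prop)
  · exact (integrable_indicator_iff hm).2 (integrableOn_const hfin.ne)
  · intro k
    refine Eventually.of_forall fun z => ?_
    by_cases hz : z ∈ Metric.closedBall x R
    · rw [Set.indicator_of_mem hz]
      rw [mem_closedBall_iff_norm] at hz
      rw [norm_mul, Real.norm_eq_abs, Real.norm_eq_abs]
      refine mul_le_mul (hC k _ (norm_nonneg _)) ((abs_real_inner_le_norm _ _).trans ?_)
        (abs_nonneg _) hC0
      gcongr
    · rw [Set.indicator_of_notMem hz]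
      rw [mem_closedBall_iff_norm, not_le] at hz
      rw [hfR k _ hz.le, zero_mul, norm_zero]
  · exact Eventually.of_forall fun z => (hfg _ (norm_nonneg _)).mul_const _

/-- The shift by 1 makes the limit equal to 1 at s = 0, so that closed balls and closed annuli are
obtained exactly. -/
theorem tendsto_smoothTransition_mul_add_one {a : ℕ → ℝ} (ha : Tendsto a atTop atTop) (s : ℝ) :
    Tendsto (fun k => Real.smoothTransition (a k * s + 1)) atTop
      (𝓝 (if 0 ≤ s then 1 else 0)) := by
  refine tendsto_const_nhds.congr' ?_
  split_ifs with hs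
  · filter_upwards [ha.eventually_ge_atTop 0] with k hk
    exact (Real.smoothTransition.one_of_one_le (by nlinarith)).symm
  · push Not at hs
    filter_upwards [ha.eventually_ge_atTop (1 / -s)] with k hk
    rw [div_le_iff₀ (by linarith)] at hk
    exact (Real.smoothTransition.zero_of_nonpos (by linarith)).symm

theorem isPointOfSymmetry_of_radial
    (hsym : ∀ (f : ℝ → ℝ), ContDiff ℝ 1 f → ∀ R > 0, (∀ t ≥ R, f t = 0) → ∀ e : Euc n,
      ∫ z, f ‖z - x‖ * inner ℝ (z - x) e ∂ν = 0) : IsPointOfSymmetry ν x := by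
  intro e r hr
  have ha : Tendsto (fun k : ℕ => (k : ℝ) + 1) atTop atTop :=
    tendsto_atTop_add_const_right _ _ tendsto_natCast_atTop_atTop
  have h := integral_radial_eq_zero_of_tendsto hsym
    (f := fun k t => Real.smoothTransition (((k : ℝ) + 1) * (r - t) + 1))
    (g := fun t => if 0 ≤ r - t then 1 else 0) (R := r + 1) (C := 1) (by positivity)
    (fun k => Real.smoothTransition.contDiff.comp (by fun_prop))
    (fun k t ht => Real.smoothTransition.zero_of_nonpos (by
      have : (0 : ℝ) ≤ k := by positivity
      nlinarith))
    (fun k t _ => by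
      rw [abs_of_nonneg (Real.smoothTransition.nonneg _)]
      exact Real.smoothTransition.le_one _)
    (fun t _ => tendsto_smoothTransition_mul_add_one ha (r - t)) e
  rw [← integral_indicator Metric.isClosed_closedBall.measurableSet, ← h]
  refine integral_congr_ae (Eventually.of_forall fun z => ?_)
  by_cases hz : z ∈ Metric.closedBall x r
  · have hz' := mem_closedBall_iff_norm.1 hz
    simp only [Set.indicator_of_mem hz, sub_nonneg, if_pos hz', one_mul]
  · have hz' := fun h => hz (mem_closedBall_iff_norm.2 h)
    simp only [Set.indicator_of_notMem hz, sub_nonneg, if_neg hz', zero_mul]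

theorem integral_annulus_rieszKernel_eq_zero (m : ℕ)
    (hsym : ∀ (f : ℝ → ℝ), ContDiff ℝ 1 f → ∀ R > 0, (∀ t ≥ R, f t = 0) → ∀ e : Euc n,
      ∫ z, f ‖z - x‖ * inner ℝ (z - x) e ∂ν = 0) {r R : ℝ} (hr : 0 < r) (hrR : r < R) :
    ∫ y in {y : Euc n | r ≤ ‖y - x‖ ∧ ‖y - x‖ ≤ R}, rieszKernel m (y - x) ∂ν = 0 := by
  set S : Set (Euc n) := {y : Euc n | r ≤ ‖y - x‖ ∧ ‖y - x‖ ≤ R} with hS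
  have hSm : MeasurableSet S := by
    have h1 : IsClosed {y : Euc n | r ≤ ‖y - x‖} := isClosed_le (by fun_prop) (by fun_prop)
    have h2 : IsClosed {y : Euc n | ‖y - x‖ ≤ R} := isClosed_le (by fun_prop) (by fun_prop)
    exact (h1.inter h2).measurableSet
  -- In the non-integrable case the Bochner integral is 0 by convention, so no integrability proof
  -- is required.
  by_cases hint : IntegrableOn (fun y => rieszKernel m (y - x)) S ν
  swap
  · exact integral_undef hint
  refine ext_inner_right ℝ fun e => ?_
  rw [inner_zero_left, real_inner_comm, ← integral_inner hint]
  -- The term 2 / r makes the inner cutoff vanish for t ≤ r/2, away from the singularity of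
  -- t^(-(m+1)).
  set a : ℕ → ℝ := fun k => (k : ℝ) + (1 + 2 / r) with ha_def
  have ha : Tendsto a atTop atTop :=
    tendsto_atTop_add_const_right _ _ tendsto_natCast_atTop_atTop
  have ha1 : ∀ k, 1 ≤ a k := fun k => by
    have : (0 : ℝ) ≤ k := by positivity
    have : 0 ≤ 2 / r := by positivity
    simp only [ha_def]
    linarith
  have har : ∀ k, 2 ≤ a k * r := fun k => by
    have h0 : (0 : ℝ) ≤ k := by positivity
    have h1 : 2 / r * r = 2 := by field_simp
    simp only [ha_def]
    nlinarith [mul_nonneg h0 hr.le]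
  have hzero : ∀ k t, t ≤ r / 2 → Real.smoothTransition (a k * (t - r) + 1) = 0 := fun k t ht =>
    Real.smoothTransition.zero_of_nonpos (by nlinarith [har k, ha1 k])
  have h := integral_radial_eq_zero_of_tendsto hsym
    (f := fun k t => Real.smoothTransition (a k * (R - t) + 1) *
      Real.smoothTransition (a k * (t - r) + 1) * (t ^ (m + 1))⁻¹)
    (g := fun t => (if 0 ≤ R - t then 1 else 0) * (if 0 ≤ t - r then 1 else 0) * (t ^ (m + 1))⁻¹)
    (R := R + 1) (C := ((r / 2) ^ (m + 1))⁻¹) (by linarith) ?_ ?_ ?_ ?_ e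
  · rw [← integral_indicator hSm, ← h]
    refine integral_congr_ae (Eventually.of_forall fun z => ?_)
    by_cases hz : z ∈ S
    · simp only [Set.indicator_of_mem hz, sub_nonneg, if_pos hz.1, if_pos hz.2, rieszKernel,
        inner_smul_right, real_inner_comm e, one_mul]
    · rw [Set.indicator_of_notMem hz]
      simp only [sub_nonneg]
      rw [eq_comm, mul_eq_zero, mul_eq_zero, mul_eq_zero]
      left; left
      by_cases h1 : ‖z - x‖ ≤ R
      · right
        exact if_neg fun h2 => hz ⟨h2, h1⟩
      · left
        exact if_neg h1
  · intro k
    rw [contDiff_iff_contDiffAt]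
    intro t
    have h1 : ContDiff ℝ 1 fun t => Real.smoothTransition (a k * (R - t) + 1) *
        Real.smoothTransition (a k * (t - r) + 1) :=
      (Real.smoothTransition.contDiff.comp (by fun_prop)).mul
        (Real.smoothTransition.contDiff.comp (by fun_prop))
    rcases lt_or_ge t (r / 2) with ht | ht
    · refine (contDiffAt_const (c := (0 : ℝ))).congr_of_eventuallyEq ?_
      filter_upwards [Iio_mem_nhds ht] with s hs
      rw [hzero k s (le_of_lt hs), mul_zero, zero_mul]
    · have : t ^ (m + 1) ≠ 0 := by
        have : 0 < t := by linarith
        positivity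
      exact h1.contDiffAt.mul ((contDiffAt_id.pow _).inv this)
  · intro k t ht
    rw [Real.smoothTransition.zero_of_nonpos (by nlinarith [ha1 k]), zero_mul, zero_mul]
  · intro k t ht
    rcases lt_or_ge t (r / 2) with h1 | h1
    · rw [hzero k t h1.le, mul_zero, zero_mul, abs_zero]
      positivity
    · rw [abs_mul, abs_mul, abs_of_nonneg (Real.smoothTransition.nonneg _),
        abs_of_nonneg (Real.smoothTransition.nonneg _), abs_of_nonneg (by positivity)]
      calc _ ≤ 1 * 1 * ((r / 2) ^ (m + 1))⁻¹ := by
            gcongr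
            · exact Real.smoothTransition.nonneg _
            · exact Real.smoothTransition.le_one _
            · exact Real.smoothTransition.le_one _
        _ = _ := by ring
  · intro t _
    exact ((tendsto_smoothTransition_mul_add_one ha (R - t)).mul
      (tendsto_smoothTransition_mul_add_one ha (t - r))).mul_const _

end Limits

/-! ### Translation of the hypotheses and the conclusion. -/

section Tangents
variable {n : ℕ}

/-- The inverse matrices as invertible operators. -/
noncomputable def shapeUnit (Λ : Euc n → Matrix.GeneralLinearGroup (Fin n) ℝ) (a : Euc n) :
    (Euc n →L[ℝ] Euc n)ˣ :=
  Units.map (Matrix.toEuclideanCLM (𝕜 := ℝ) (n := Fin n) : Matrix (Fin n) (Fin n) ℝ →* _) (Λ a)⁻¹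

theorem exists_mem_lowerRegularSet {m : ℕ} {μ : Measure (Euc n)} [IsFiniteMeasure μ] {a : Euc n}
    (h : 0 < lowerDensity m μ a) : ∃ l, a ∈ lowerRegularSet m μ l := by
  obtain ⟨δ, hδ0, hδ⟩ := exists_between h
  have hδtop : δ ≠ ∞ := (hδ.trans_le le_top).ne
  have hev := eventually_lt_of_lt_liminf hδ
  obtain ⟨ρ, hρ, hsub⟩ := mem_nhdsGT_iff_exists_Ioo_subset.1 hev
  have hδr : 0 < δ.toReal := ENNReal.toReal_pos hδ0.ne' hδtop
  obtain ⟨l, hl⟩ := exists_nat_one_div_lt (lt_min hρ hδr)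
  refine ⟨l, fun r hr0 hr1 => ?_⟩
  have h1 : δ < μ (Metric.closedBall a r) / ENNReal.ofReal (r ^ m) :=
    hsub ⟨hr0, hr1.trans (hl.trans_le (min_le_left _ _))⟩
  have hrm : 0 < r ^ m := by positivity
  have h2 : δ * ENNReal.ofReal (r ^ m) ≤ μ (Metric.closedBall a r) :=
    ENNReal.mul_le_of_le_div h1.le
  have h3 := ENNReal.toReal_mono (measure_ne_top μ _) h2
  rw [ENNReal.toReal_mul, ENNReal.toReal_ofReal hrm.le] at h3
  have h4 : 1 / ((l : ℝ) + 1) ≤ δ.toReal := hl.le.trans (min_le_right _ _)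
  rw [div_le_iff₀ (by positivity)] at h4
  calc r ^ m ≤ (δ.toReal * (l + 1)) * r ^ m := le_mul_of_one_le_left hrm.le h4
    _ = (l + 1) * (δ.toReal * r ^ m) := by ring
    _ ≤ (l + 1) * μ.real (Metric.closedBall a r) := by gcongr; exact h3

theorem exists_norm_sub_le_of_tendsto {E : Type*} [NormedAddCommGroup E] {T : ℝ → E} {v : E}
    (h : Tendsto T (𝓝[>] 0) (𝓝 v)) {ε : ℝ} (hε : 0 < ε) :
    ∃ ρ > 0, ∀ s t : ℝ, 0 < s → s < ρ → 0 < t → t < ρ → ‖T s - T t‖ ≤ ε := by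
  have hev := h.eventually (Metric.ball_mem_nhds v (half_pos hε))
  obtain ⟨ρ, hρ, hsub⟩ := mem_nhdsGT_iff_exists_Ioo_subset.1 hev
  refine ⟨ρ, hρ, fun s t hs0 hs1 ht0 ht1 => ?_⟩
  have h1 : dist (T s) v < ε / 2 := hsub ⟨hs0, hs1⟩
  have h2 : dist (T t) v < ε / 2 := hsub ⟨ht0, ht1⟩
  rw [← dist_eq_norm]
  linarith [dist_triangle_right (T s) (T t) v]

theorem isBlowUpLimit_of_weakStarTendsto {Λ : Euc n → Matrix.GeneralLinearGroup (Fin n) ℝ}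
    {μ ν : Measure (Euc n)} {a : Euc n} {c r : ℕ → ℝ} (hc : ∀ i, 0 < c i) (hr : ∀ i, 0 < r i)
    (hr0 : Tendsto r atTop (𝓝 0))
    (h : WeakStarTendsto (fun i => ENNReal.ofReal (c i) • Measure.map (rescale Λ a (r i)) μ) ν) :
    IsBlowUpLimit (μ.map (fun z => (shapeUnit Λ a : Euc n →L[ℝ] Euc n) (z - a))) ν c r := by
  refine ⟨hc, hr, hr0, fun f hf hfs => (h f hf hfs).congr fun i => ?_⟩
  have hcomp : rescale Λ a (r i) =
      (fun z => (r i)⁻¹ • z) ∘ fun z => (shapeUnit Λ a : Euc n →L[ℝ] Euc n) (z - a) := by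
    funext z
    simp only [Function.comp_apply, ← map_smul]
    rfl
  rw [integral_smul_measure, ENNReal.toReal_ofReal (hc i).le, smul_eq_mul, hcomp,
    ← Measure.map_map (by fun_prop) (by fun_prop),
    integral_map (by fun_prop) hf.aestronglyMeasurable]

end Tangents

theorem propositionp (n m : ℕ) (hm : 1 ≤ m) (hmn : m < n)
    (Λ : Euc n → Matrix.GeneralLinearGroup (Fin n) ℝ)
    (μ : Measure (Euc n)) [IsFiniteMeasure μ]
    (hdens : ∀ᵐ a ∂μ, 0 < lowerDensity m μ a)
    (hpv : ∀ᵐ a ∂μ, PrincipalValueExists m Λ μ a) :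
    (∀ᵐ a ∂μ, ∀ ν ∈ lambdaTangents Λ μ a, ∀ x ∈ ν.support, ∀ r R : ℝ, 0 < r → r < R →
      ∫ y in {y : Euc n | r ≤ ‖y - x‖ ∧ ‖y - x‖ ≤ R}, rieszKernel m (y - x) ∂ν = 0) ∧
    (∀ᵐ a ∂μ, lambdaTangents Λ μ a ⊆ symmetricMeasures n) := by
  have hdata := ae_exists_centerData (m := m) (μ := μ) (B := shapeUnit Λ)
    (hdens.mono fun a ha => exists_mem_lowerRegularSet ha)
    (hpv.mono fun a ⟨v, hv⟩ ε hε => exists_norm_sub_le_of_tendsto hv hε)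
  constructor
  · filter_upwards [hdata] with a ⟨F, A, c₀, ρ, H⟩ ν ⟨hν, _, c, s, hc, hs, hs0, hw⟩ x hx r R hr hrR
    exact integral_annulus_rieszKernel_eq_zero m
      (fun f hf R hR hfR e => (isBlowUpLimit_of_weakStarTendsto hc hs hs0 hw).integral_radial_eq_zero
        H hx hf hR hfR e) hr hrR
  · filter_upwards [hdata] with a ⟨F, A, c₀, ρ, H⟩ ν ⟨hν, hν0, c, s, hc, hs, hs0, hw⟩
    have hlim := isBlowUpLimit_of_weakStarTendsto hc hs hs0 hw
    exact ⟨⟨hν, hν0, fun x hx => isPointOfSymmetry_of_radial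
      fun f hf R hR hfR e => hlim.integral_radial_eq_zero H hx hf hR hfR e⟩,
      hlim.zero_mem_support H hν0⟩
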